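/- **Setting.** For $G:\mathbb R\to\mathbb R_+$ and $y\in\mathbb R^m$ let $\|y\|_G=\inf\{\alpha>0:\sum_{r}G(|y_r|/\alpha)\le 1\}$. $G$ has property $\mathcal P$ if: (1) $G$ is nondecreasing and convex on $[0,\infty)$; (2) $G(0)=0$, $G(1)=1$, $G(-x)=G(x)$; (3) there is $s>0$ with $G(x)=sx+1-s$ for $x>1$; (4) $G$ is twice differentiable on some interval $(0,\delta)$, the limits $G'_+(0)$ and $G''_+(0)=\lim_{h\to0^+}(G'(h)-G'_+(0))/h\in[-\infty,\infty]$ exist, and $G'_+(0)>0$ or $G''_+(0)>0$; (5) there is $C_G>0$ with $G(y)/G(x)\le C_G(y/x)^2$ for all $0<x<y$. Write $\mathrm{nnz}$ for the number of nonzero entries. **Algorithm.** Input: $A_i\in\mathbb R^{n_i\times d}$, $b_i\in\mathbb R^{n_i}$ $(1\le i\le k)$. Put $n=\sum_i n_i$, $A=[A_1^\top,\dots,A_k^\top]^\top$, $b=[b_1^\top,\dots,b_k^\top]^\top$, and choose $t_1=\Theta(d^2)$, $t_2=\Theta(d)$, $t_3=\Theta(t_2\log t_2)$. Independently for each $i$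 draw: a diagonal $D^{(i)}\in\mathbb R^{n_i\times n_i}$ with independent diagonal entries of distribution function $1-e^{-G_i(t)}$, $t\ge0$; $\Pi_1^{(i)}\in\mathbb R^{t_1\times n_i}$ whose column $r$ has the single nonzero entry $\sigma_r$ in row $h(r)$, with $\sigma_r$ uniform in $\{\pm1\}$ and $h(r)$ uniform in $\{1,\dots,t_1\}$, all independent; $\Pi_2^{(i)}\in\mathbb R^{t_2\times t_1}$ with i.i.d. standard Gaussian entries scaled by $1/\sqrt{t_2}$; and $B^{(i)}=(\sqrt{\pi/2}/t_3)\,Q^{(i)}$, where $Q^{(i)}\in\mathbb R^{t_3\times t_2}$ has i.i.d. $\mathcal N(0,1)$ entries. Let $B,\Pi_2,\Pi_1,D$ be the block diagonal matrices with these blocks and $S=B\Pi_2\Pi_1D^{-1}$. Form $SA$, $Sb$ and output a minimizer $\hat x$ of $\|S(Ax-b)\|_1$ over $x\in\mathbb R^d$. **Theorem.** Let $k\ge1$ be a constant. If the lower constants in the three $\Theta$'s are large enough (depending only on $k$), the following holds, for all fixed upper constants, for all $G_1,\dots,G_k$ with property $\mathcal P$ and all $d\ge1$, $n_i$ with $n=\sum_in_i\ge2$,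 $A_i$, $b_i$. (a) With probability at least $0.7$, every minimizer $\hat x$ of $\|S(Ax-b)\|_1$ (one always exists) satisfies $$\sum_{i=1}^k\|A_i\hat x-b_i\|_{G_i}\le O(\beta'_G\,d\log^2n)\cdot\min_{x\in\mathbb R^d}\sum_{i=1}^k\|A_ix-b_i\|_{G_i},$$ where $\beta'_G$ depends only on $G_1,\dots,G_k$ (and the $O$ only on $k$ and the constants in the $\Theta$'s). (b) On a real random access machine (exact arithmetic $+,-,\times,/,\sqrt{\phantom{x}}$ and comparisons at unit cost; the random draws available at unit cost per access; the input given as a list of the nonzero entries of the $A_i$ and $b_i$) there is one program, depending only on $k$, that for every $\varepsilon\in(0,1]$ and for all values of the draws computes $SA$ and $Sb$ exactly and outputs $\hat x$ with $\|S(A\hat x-b)\|_1\le(1+\varepsilon)\min_x\|S(Ax-b)\|_1$, in time $$O\Big(\sum_{i=1}^k\big(\mathrm{nnz}(A_i)+\mathrm{nnz}(b_i)\big)\Big)+\mathrm{poly}\big(d,\log(1/\varepsilon)\big),$$ with constants that do not depend on the $G_i$. On the event in (a) this output $\hat x$ satisfies the error bound in (a) as well. In particular, for constant $\varepsilon$,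 and if no $A_i$ has a zero row (so that $\mathrm{nnz}(b_i)\le n_i\le\mathrm{nnz}(A_i)$), the running time is $O(\sum_i\mathrm{nnz}(A_i))+\mathrm{poly}(d)$. -/

import Mathlib

open Filter Topology MeasureTheory ProbabilityTheory Matrix

noncomputable section

namespace OrliczRegression

/-! ### Orlicz norms and property `𝒫` -/

/-- The Orlicz norm `‖x‖_G = inf {α > 0 | ∑ G(|x_i| / α) ≤ 1}`. -/
def orliczNorm (G : ℝ → ℝ) {n : ℕ} (x : Fin n → ℝ) : ℝ :=
  sInf {α : ℝ | 0 < α ∧ ∑ r, G (|x r| / α) ≤ 1}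

/-- Property `𝒫` of a loss function. -/
structure PropertyP (G : ℝ → ℝ) : Prop where
  monotoneOn : MonotoneOn G (Set.Ici 0)
  convexOn : ConvexOn ℝ (Set.Ici 0) G
  map_zero : G 0 = 0
  map_one : G 1 = 1
  even : ∀ x, G (-x) = G x
  linear : ∃ s : ℝ, 0 < s ∧ ∀ x, 1 < x → G x = s * x + (1 - s)
  /-- `G` is twice differentiable on some `(0, δ)`; the right derivatives `G'_+(0)` and `G''_+(0)`
  exist (the second one possibly being `+∞`, as for `|x|^p` with `1 < p < 2`), and one of them is
  positive. -/
  smooth : ∃ δ : ℝ, 0 < δ ∧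
    (∀ x ∈ Set.Ioo 0 δ, DifferentiableAt ℝ G x ∧ DifferentiableAt ℝ (deriv G) x) ∧
    ∃ (g₁ : ℝ) (g₂ : EReal), HasDerivWithinAt G g₁ (Set.Ici 0) 0 ∧
      Tendsto (fun h : ℝ => (((deriv G h - g₁) / h : ℝ) : EReal)) (𝓝[>] 0) (𝓝 g₂) ∧
      (0 < g₁ ∨ 0 < g₂)
  /-- At most quadratic growth, `G y / G x ≤ C (y / x) ^ 2`, written without division by `G x`
  (this form also forces `G x ≠ 0`). -/
  growth : ∃ C : ℝ, 0 < C ∧ ∀ x y : ℝ, 0 < x → x < y → G y ≤ C * (y / x) ^ 2 * G x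

/-- `ν` is the probability distribution on `[0, ∞)` with distribution function `1 - exp (-G t)`. -/
def HasOrliczCDF (G : ℝ → ℝ) (ν : Measure ℝ) : Prop :=
  IsProbabilityMeasure ν ∧ ∀ t : ℝ, 0 ≤ t → ν.real (Set.Iic t) = 1 - Real.exp (-G t)

/-! ### The random sketch -/

/-- All random draws for one block with `n` rows: the diagonal of `D`, the random signs and the
hash function of the sparse embedding, and the two standard Gaussian matrices. -/
abbrev BlockDraw (n t₁ t₂ t₃ : ℕ) : Type :=
  (Fin n → ℝ) × (Fin n → Bool) × (Fin n → Fin t₁) ×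
    (Fin t₂ → Fin t₁ → ℝ) × (Fin t₃ → Fin t₂ → ℝ)

namespace BlockDraw

variable {n t₁ t₂ t₃ : ℕ}

/-- The diagonal of `D`. -/
def diag (ω : BlockDraw n t₁ t₂ t₃) : Fin n → ℝ := ω.1

/-- The random signs. -/
def sign (ω : BlockDraw n t₁ t₂ t₃) (r : Fin n) : ℝ := if ω.2.1 r then 1 else -1

/-- The hash function. -/
def hash (ω : BlockDraw n t₁ t₂ t₃) : Fin n → Fin t₁ := ω.2.2.1

/-- The unscaled Gaussian matrix of the dense `ℓ₂` embedding. -/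
def gauss (ω : BlockDraw n t₁ t₂ t₃) : Matrix (Fin t₂) (Fin t₁) ℝ := Matrix.of ω.2.2.2.1

/-- The unscaled Gaussian matrix of the embedding of `ℓ₂` into `ℓ₁`. -/
def gaussL1 (ω : BlockDraw n t₁ t₂ t₃) : Matrix (Fin t₃) (Fin t₂) ℝ := Matrix.of ω.2.2.2.2

/-- `D⁻¹`. The entries of `D` are almost surely nonzero. -/
def Dinv (ω : BlockDraw n t₁ t₂ t₃) : Matrix (Fin n) (Fin n) ℝ :=
  Matrix.diagonal fun r => (ω.diag r)⁻¹

/-- The sparse embedding matrix `Π₁ = Φ Y`. -/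
def Pi1 (ω : BlockDraw n t₁ t₂ t₃) : Matrix (Fin t₁) (Fin n) ℝ :=
  (Matrix.of fun a r => if ω.hash r = a then (1 : ℝ) else 0) * Matrix.diagonal ω.sign

/-- The Gaussian matrix `Π₂`, scaled by `1 / √t₂`. -/
def Pi2 (ω : BlockDraw n t₁ t₂ t₃) : Matrix (Fin t₂) (Fin t₁) ℝ :=
  (1 / √(t₂ : ℝ)) • ω.gauss

/-- The Gaussian matrix `B = (√(π/2) / t₃) Q`. -/
def B (ω : BlockDraw n t₁ t₂ t₃) : Matrix (Fin t₃) (Fin t₂) ℝ :=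
  (√(Real.pi / 2) / (t₃ : ℝ)) • ω.gaussL1

end BlockDraw

/-- The law of the draws for one block: all of them are independent; the diagonal entries of `D`
have law `ν`, signs and hash values are uniform, Gaussian entries are `N(0, 1)`. -/
def blockLaw (ν : Measure ℝ) (n t₁ t₂ t₃ : ℕ) : Measure (BlockDraw n t₁ t₂ t₃) :=
  (Measure.pi fun _ => ν).prod <|
  (Measure.pi fun _ => uniformOn (Set.univ : Set Bool)).prod <|
  (Measure.pi fun _ => uniformOn (Set.univ : Set (Fin t₁))).prod <|
  (Measure.pi fun _ => Measure.pi fun _ => gaussianReal 0 1).prod <|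
  Measure.pi fun _ => Measure.pi fun _ => gaussianReal 0 1

/-- The draws for all `k` blocks. -/
abbrev Draw {k : ℕ} (n : Fin k → ℕ) (t₁ t₂ t₃ : ℕ) : Type :=
  (i : Fin k) → BlockDraw (n i) t₁ t₂ t₃

/-- The law of all draws; the blocks are independent. -/
def drawLaw {k : ℕ} (ν : Fin k → Measure ℝ) (n : Fin k → ℕ) (t₁ t₂ t₃ : ℕ) :
    Measure (Draw n t₁ t₂ t₃) :=
  Measure.pi fun i => blockLaw (ν i) (n i) t₁ t₂ t₃

/-- `S = B Π₂ Π₁ D⁻¹`, the product of the four block diagonal matrices. -/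
def sketch {k : ℕ} {n : Fin k → ℕ} {t₁ t₂ t₃ : ℕ} (ω : Draw n t₁ t₂ t₃) :
    Matrix (Σ _ : Fin k, Fin t₃) (Σ i : Fin k, Fin (n i)) ℝ :=
  blockDiagonal' (fun i => (ω i).B) * blockDiagonal' (fun i => (ω i).Pi2) *
    blockDiagonal' (fun i => (ω i).Pi1) * blockDiagonal' (fun i => (ω i).Dinv)

/-- The matrix `A` obtained by stacking `A_1, …, A_k`. -/
def stack {k : ℕ} {n : Fin k → ℕ} {m : ℕ} (A : (i : Fin k) → Matrix (Fin (n i)) (Fin m) ℝ) :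
    Matrix (Σ i : Fin k, Fin (n i)) (Fin m) ℝ :=
  Matrix.of fun p j => A p.1 p.2 j

/-- The vector `b` obtained by stacking `b_1, …, b_k`. -/
def stackVec {k : ℕ} {n : Fin k → ℕ} (b : (i : Fin k) → Fin (n i) → ℝ) :
    (Σ i : Fin k, Fin (n i)) → ℝ :=
  fun p => b p.1 p.2

/-- The combined loss `∑ ‖A_i x - b_i‖_{G_i}`. -/
def loss {k d : ℕ} {n : Fin k → ℕ} (G : Fin k → ℝ → ℝ)
    (A : (i : Fin k) → Matrix (Fin (n i)) (Fin d) ℝ) (b : (i : Fin k) → Fin (n i) → ℝ)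
    (x : Fin d → ℝ) : ℝ :=
  ∑ i, orliczNorm (G i) (A i *ᵥ x - b i)

/-- The sketched loss `‖S (A x - b)‖₁`. -/
def sketchedLoss {k d : ℕ} {n : Fin k → ℕ} {t₁ t₂ t₃ : ℕ} (ω : Draw n t₁ t₂ t₃)
    (A : (i : Fin k) → Matrix (Fin (n i)) (Fin d) ℝ) (b : (i : Fin k) → Fin (n i) → ℝ)
    (x : Fin d → ℝ) : ℝ :=
  ∑ p, |(sketch ω *ᵥ (stack A *ᵥ x - stackVec b)) p|

/-! ### Sparse inputs -/

/-- The matrix `[A b]`; its last column is `b`. -/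
def augment {n d : ℕ} (A : Matrix (Fin n) (Fin d) ℝ) (b : Fin n → ℝ) :
    Matrix (Fin n) (Fin (d + 1)) ℝ :=
  Matrix.of fun r => Fin.snoc (A r) (b r)

/-- The number of nonzero entries of a matrix. -/
def nnz {m n : ℕ} (A : Matrix (Fin m) (Fin n) ℝ) : ℕ :=
  Nat.card {p : Fin m × Fin n // A p.1 p.2 ≠ 0}

/-- The number of nonzero entries of a vector. -/
def nnzVec {m : ℕ} (b : Fin m → ℝ) : ℕ :=
  Nat.card {r : Fin m // b r ≠ 0}

/-- `L` lists the positions of the nonzero entries of `M`, each one once, in any order. -/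
def ListsNonzeros {m n : ℕ} (L : List (Fin m × Fin n)) (M : Matrix (Fin m) (Fin n) ℝ) : Prop :=
  L.Nodup ∧ ∀ p, p ∈ L ↔ M p.1 p.2 ≠ 0

/-! ### A real random access machine

Programs are structured programs over arrays of natural numbers and arrays of real numbers, each
with three indices; arrays are named by natural numbers. Real arithmetic (with square roots) is
exact. Natural numbers can only be copied and incremented, so they stay bounded by the input and
the number of steps. Every executed assignment and every evaluated test is one step: the
expressions of a program are fixed, so this is the number of operations up to a factor that
depends only on the program. -/

/-- Memory contents. -/
structure Memory where
  int : ℕ → ℕ → ℕ → ℕ → ℕ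
  real : ℕ → ℕ → ℕ → ℕ → ℝ

/-- Overwrite one integer cell. -/
def Memory.setInt (s : Memory) (a i j l v : ℕ) : Memory :=
  { s with int := fun a' i' j' l' =>
      if a' = a ∧ i' = i ∧ j' = j ∧ l' = l then v else s.int a' i' j' l' }

/-- Overwrite one real cell. -/
def Memory.setReal (s : Memory) (a i j l : ℕ) (v : ℝ) : Memory :=
  { s with real := fun a' i' j' l' =>
      if a' = a ∧ i' = i ∧ j' = j ∧ l' = l then v else s.real a' i' j' l' }

/-- Integer expressions. -/
inductive IntExpr where
  | const (m : ℕ)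
  | get (a : ℕ) (i j l : IntExpr)
  | succ (e : IntExpr)

/-- Value of an integer expression. -/
def IntExpr.eval (s : Memory) : IntExpr → ℕ
  | .const m => m
  | .get a i j l => s.int a (i.eval s) (j.eval s) (l.eval s)
  | .succ e => e.eval s + 1

/-- Real expressions; the only constants are rational numbers and `π`. -/
inductive RealExpr where
  | const (q : ℚ)
  | pi
  | ofInt (e : IntExpr)
  | get (a : ℕ) (i j l : IntExpr)
  | add (e f : RealExpr)
  | sub (e f : RealExpr)
  | mul (e f : RealExpr)
  | div (e f : RealExpr)
  | sqrt (e : RealExpr)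

/-- Value of a real expression. -/
def RealExpr.eval (s : Memory) : RealExpr → ℝ
  | .const q => (q : ℝ)
  | .pi => Real.pi
  | .ofInt e => (e.eval s : ℝ)
  | .get a i j l => s.real a (i.eval s) (j.eval s) (l.eval s)
  | .add e f => e.eval s + f.eval s
  | .sub e f => e.eval s - f.eval s
  | .mul e f => e.eval s * f.eval s
  | .div e f => e.eval s / f.eval s
  | .sqrt e => √(e.eval s)

/-- Tests. -/
inductive Test where
  | intLt (e f : IntExpr)
  | realLt (e f : RealExpr)
  | realLe (e f : RealExpr)

/-- Truth of a test. -/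
def Test.Holds (s : Memory) : Test → Prop
  | .intLt e f => e.eval s < f.eval s
  | .realLt e f => e.eval s < f.eval s
  | .realLe e f => e.eval s ≤ f.eval s

/-- Programs. -/
inductive Program where
  | skip
  | setInt (a : ℕ) (i j l : IntExpr) (e : IntExpr)
  | setReal (a : ℕ) (i j l : IntExpr) (e : RealExpr)
  | seq (p q : Program)
  | ite (c : Test) (p q : Program)
  | loop (c : Test) (p : Program)

/-- `Runs p s s' T`: started with memory `s`, the program `p` halts after exactly `T` steps with
memory `s'`. `Program.loop c p` repeats `p` while `c` holds. -/
inductive Runs : Program → Memory → Memory → ℕ → Prop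
  | skip (s : Memory) : Runs .skip s s 1
  | setInt (s : Memory) (a : ℕ) (i j l e : IntExpr) :
      Runs (.setInt a i j l e) s
        (s.setInt a (i.eval s) (j.eval s) (l.eval s) (e.eval s)) 1
  | setReal (s : Memory) (a : ℕ) (i j l : IntExpr) (e : RealExpr) :
      Runs (.setReal a i j l e) s
        (s.setReal a (i.eval s) (j.eval s) (l.eval s) (e.eval s)) 1
  | seq {p q : Program} {s s' s'' : Memory} {T T' : ℕ}
      (h : Runs p s s' T) (h' : Runs q s' s'' T') : Runs (.seq p q) s s'' (T + T')
  | iteTrue {c : Test} {p q : Program} {s s' : Memory} {T : ℕ}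
      (hc : c.Holds s) (h : Runs p s s' T) : Runs (.ite c p q) s s' (T + 1)
  | iteFalse {c : Test} {p q : Program} {s s' : Memory} {T : ℕ}
      (hc : ¬ c.Holds s) (h : Runs q s s' T) : Runs (.ite c p q) s s' (T + 1)
  | loopStop {c : Test} {p : Program} {s : Memory} (hc : ¬ c.Holds s) :
      Runs (.loop c p) s s 1
  | loopStep {c : Test} {p : Program} {s s' s'' : Memory} {T T' : ℕ}
      (hc : c.Holds s) (h : Runs p s s' T) (h' : Runs (.loop c p) s' s'' T') :
      Runs (.loop c p) s s'' (T + T' + 1)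

/-- Extension of a finite sequence by zeros. -/
def pad {α : Type} [Zero α] {m : ℕ} (f : Fin m → α) (i : ℕ) : α :=
  if h : i < m then f ⟨i, h⟩ else 0

/-- The initial memory. It holds the sizes, for every block the list of the nonzero entries
(row, column, value) of `[A_i b_i]`, the accuracy `ε`, and the random draws, which the program
thus obtains at one step per access. All other cells are `0`. -/
def initialMemory {k d : ℕ} {n : Fin k → ℕ} {t₁ t₂ t₃ : ℕ}
    (A : (i : Fin k) → Matrix (Fin (n i)) (Fin d) ℝ) (b : (i : Fin k) → Fin (n i) → ℝ)
    (L : (i : Fin k) → List (Fin (n i) × Fin (d + 1))) (ε : ℝ) (ω : Draw n t₁ t₂ t₃) :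
    Memory where
  int a i j _ :=
    match a with
    | 0 => ([k, d, t₁, t₂, t₃] : List ℕ).getD i 0
    | 1 => pad (fun i' => (L i').length) i
    | 2 => pad (fun i' => pad (fun p => ((L i').get p).1.val) j) i
    | 3 => pad (fun i' => pad (fun p => ((L i').get p).2.val) j) i
    | 4 => pad (fun i' => pad (fun r => ((ω i').hash r).val) j) i
    | _ => 0
  real a i j l :=
    match a with
    | 0 => if i = 0 then ε else 0
    | 1 => pad (fun i' => pad (fun p =>
        augment (A i') (b i') ((L i').get p).1 ((L i').get p).2) j) i
    | 2 => pad (fun i' => pad (fun r => (ω i').diag r) j) i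
    | 3 => pad (fun i' => pad (fun r => (ω i').sign r) j) i
    | 4 => pad (fun i' => pad (fun u => pad (fun v => (ω i').gauss u v) l) j) i
    | 5 => pad (fun i' => pad (fun u => pad (fun v => (ω i').gaussL1 u v) l) j) i
    | _ => 0

/-- The output vector `x̂`: the first `d` cells of the real array `6`. -/
def output (d : ℕ) (s : Memory) : Fin d → ℝ := fun j => s.real 6 j 0 0

/-- The real array `7` holds the sketched matrix `S [A b]`. -/
def HoldsSketch {k d : ℕ} {n : Fin k → ℕ} {t₁ t₂ t₃ : ℕ}
    (A : (i : Fin k) → Matrix (Fin (n i)) (Fin d) ℝ) (b : (i : Fin k) → Fin (n i) → ℝ)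
    (ω : Draw n t₁ t₂ t₃) (s : Memory) : Prop :=
  ∀ (i : Fin k) (u : Fin t₃) (j : Fin (d + 1)),
    s.real 7 i u j = (sketch ω * stack fun i => augment (A i) (b i)) ⟨i, u⟩ j

end OrliczRegression

end

open OrliczRegression

noncomputable section

namespace OrliczRegression

/-! ### Nets of the unit sphere -/

section Nets

variable {E : Type*} [NormedAddCommGroup E] [NormedSpace ℝ E] [FiniteDimensional ℝ E]

/-! Part (a) rests on two one-sided estimates, with κ₁ = O(d log n) and κ₂ = O(log n). Outside an
event of probability 0.3, in every block, ‖y‖_G ≤ κ₁ ‖Sy‖₁ for all y in the column span of [A_i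
b_i], and ‖Sy*‖₁ ≤ κ₂ ‖y*‖_G for the one residual y* of a fixed optimal x*. Hence if x̂ minimises
the sketched loss up to a factor 2, then loss(x̂) ≤ κ₁‖S(Ax̂ − b)‖₁ ≤ 2κ₁‖S(Ax* − b)‖₁ ≤ 2κ₁κ₂
loss(x*). No upper bound on a whole subspace is needed (`exists_good_event`).

The rescaling D⁻¹ carries the Orlicz norm to ℓ₂. By independence, P(D_r > s_r for all r) = exp(−∑
G(s_r)), so with convexity the event ‖D⁻¹u‖_∞ < ‖u‖_G/(2l) has probability at most e^{−l}. For l of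
order d log n this survives a union bound over a net of n^{O(d)} points (`rescaling_lower`).
Conversely, for one fixed y the entries of D⁻¹y are split into O(log n) dyadic scales. At most
quadratic growth of G bounds the contribution of each scale to a truncated second moment by a
constant, so ‖D⁻¹y‖₂ = O(√(log n)) ‖y‖_G with good probability (`rescaling_upper`). The other
factors preserve ℓ₂ norms up to constants: Π₁ by a second moment computation (`sparse_embedding`),
Π₂ and B by Gaussian tail bounds on nets (`gaussian_embedding`), where B ends in ℓ₁. The lower
estimate uses only ‖·‖_∞ ≤ ‖·‖₂.

For part (b), the sparse embedding is applied with one update per nonzero entry; all later work has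
size polynomial in d. The sketched problem is put into the form ‖Uz − r‖₁, where the columns of U
are orthonormal or zero and r is orthogonal to them. With N rows, the value ‖r‖₁ at z = 0 is within
√N of the optimum, and good competitors lie in the ball of radius ‖r‖₁. Around (1 − δ)z, with δ =
ε/(2N), there is a ball of radius δ‖r‖₁ on which the loss is at most (1 + ε) times its value at z.
The ellipsoid method therefore stops after a number of steps polynomial in d and log(1/ε),
independently of the conditioning of the data (`OrthoPair.l1Loss_near_le`, `EllipsoidInv.step`,
`EllipsoidInv.final`). A small program logic (`Ends`, `Computes`) transfers this to the machine. -/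

theorem card_le_of_separated_unitBall {γ : ℝ} (hγ : 0 < γ) (s : Finset E)
    (hs : ∀ c ∈ s, ‖c‖ ≤ 1) (h : ∀ c ∈ s, ∀ d ∈ s, c ≠ d → γ ≤ ‖c - d‖) :
    (s.card : ℝ) ≤ (1 + 2 / γ) ^ Module.finrank ℝ E := by
  borelize E
  let μ : Measure E := Measure.addHaar
  let δ : ℝ := γ / 2
  let ρ : ℝ := 1 + γ / 2
  have δpos : 0 < δ := by positivity
  have ρpos : 0 < ρ := by positivity
  -- Packing by volume: the balls of radius γ/2 around the points are disjoint and lie in the ball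
  -- of radius 1 + γ/2.
  set A := ⋃ c ∈ s, Metric.ball (c : E) δ with hA
  have D : Set.Pairwise (s : Set E) (Function.onFun Disjoint fun c => Metric.ball (c : E) δ) := by
    rintro c hc d hd hcd
    apply Metric.ball_disjoint_ball
    rw [dist_eq_norm]
    convert h c hc d hd hcd
    simp only [δ]; ring
  have A_subset : A ⊆ Metric.ball (0 : E) ρ := by
    refine Set.iUnion₂_subset fun x hx => ?_
    apply Metric.ball_subset_ball'
    calc δ + dist x 0 ≤ δ + 1 := by rw [dist_zero_right]; gcongr; exact hs x hx
      _ = ρ := by simp only [δ, ρ]; ring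
  have I : (s.card : ENNReal) * ENNReal.ofReal (δ ^ Module.finrank ℝ E) * μ (Metric.ball 0 1) ≤
      ENNReal.ofReal (ρ ^ Module.finrank ℝ E) * μ (Metric.ball 0 1) :=
    calc (s.card : ENNReal) * ENNReal.ofReal (δ ^ Module.finrank ℝ E) * μ (Metric.ball 0 1)
        = μ A := by
          rw [hA, measure_biUnion_finset D fun c _ => measurableSet_ball]
          have I : 0 < δ := δpos
          simp only [μ.addHaar_ball_of_pos _ δpos]
          simp [mul_assoc]
      _ ≤ μ (Metric.ball (0 : E) ρ) := measure_mono A_subset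
      _ = ENNReal.ofReal (ρ ^ Module.finrank ℝ E) * μ (Metric.ball 0 1) := by
          simp only [μ.addHaar_ball_of_pos _ ρpos]
  have J : (s.card : ENNReal) * ENNReal.ofReal (δ ^ Module.finrank ℝ E) ≤
      ENNReal.ofReal (ρ ^ Module.finrank ℝ E) :=
    (ENNReal.mul_le_mul_iff_left (Metric.measure_ball_pos μ (0 : E) one_pos).ne'
      measure_ball_lt_top.ne).1 I
  have K : (s.card : ℝ) * δ ^ Module.finrank ℝ E ≤ ρ ^ Module.finrank ℝ E := by
    have := ENNReal.toReal_mono ENNReal.ofReal_ne_top J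
    simpa [ENNReal.toReal_mul, ENNReal.toReal_ofReal (pow_nonneg δpos.le _),
      ENNReal.toReal_ofReal (pow_nonneg ρpos.le _)] using this
  have e : 1 + 2 / γ = ρ / δ := by simp only [ρ, δ]; field_simp; ring
  rw [e, div_pow, le_div_iff₀ (by positivity)]
  exact K

/-- A maximal γ-separated subset of the sphere is a net, and one exists because packing bounds the
cardinality. The norm is arbitrary: the Gaussian matrices use the Euclidean norm, the exponential
rescaling the sup norm. -/
theorem exists_unitSphere_net {γ : ℝ} (hγ : 0 < γ) :
    ∃ s : Finset E, (s.card : ℝ) ≤ (1 + 2 / γ) ^ Module.finrank ℝ E ∧ (∀ u ∈ s, ‖u‖ = 1) ∧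
      ∀ v : E, ‖v‖ = 1 → ∃ u ∈ s, ‖v - u‖ ≤ γ := by
  classical
  let P : ℕ → Prop := fun m => ∃ s : Finset E, s.card = m ∧ (∀ u ∈ s, ‖u‖ = 1) ∧
    ∀ c ∈ s, ∀ d ∈ s, c ≠ d → γ ≤ ‖c - d‖
  have bound : ∀ m, P m → m ≤ ⌊(1 + 2 / γ) ^ Module.finrank ℝ E⌋₊ := by
    rintro m ⟨s, rfl, h1, h2⟩
    exact Nat.le_floor (card_le_of_separated_unitBall hγ s (fun c hc => (h1 c hc).le) h2)
  obtain ⟨m, ⟨s, hm, h1, h2⟩, hmax⟩ : ∃ m, P m ∧ ∀ m', P m' → m' ≤ m := by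
    have h0 : P 0 := ⟨∅, by simp, by simp, by simp⟩
    exact ⟨_, Nat.findGreatest_spec (Nat.zero_le _) h0,
      fun m' h' => Nat.le_findGreatest (bound m' h') h'⟩
  refine ⟨s, card_le_of_separated_unitBall hγ s (fun c hc => (h1 c hc).le) h2, h1, ?_⟩
  intro v hv
  by_contra! hcon
  have hvs : v ∉ s := fun h => by simpa using (hcon v h).trans' hγ
  have := hmax (s.card + 1) ⟨insert v s, Finset.card_insert_of_notMem hvs, ?_, ?_⟩
  · omega
  · intro u hu
    rcases Finset.mem_insert.1 hu with rfl | hu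
    exacts [hv, h1 u hu]
  · intro c hc d hd hcd
    rcases Finset.mem_insert.1 hc with hc | hc <;> rcases Finset.mem_insert.1 hd with hd | hd
    · exact absurd (hc.trans hd.symm) hcd
    · rw [hc]; exact (hcon d hd).le
    · rw [hd, norm_sub_rev]; exact (hcon c hc).le
    · exact h2 c hc d hd hcd

end Nets

/-! ### Gaussian matrices -/

section Gaussian

/-- Chernoff's bound for the product of independent copies. -/
theorem measureReal_pi_le_prod_le {μ : Measure ℝ} [IsProbabilityMeasure μ] {f : ℝ → ℝ}
    (hf : ∀ x, 0 < f x) (hI : 0 < ∫ x, f x ∂μ) {c : ℝ} (hc : 0 < c) (t : ℕ) :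
    (Measure.pi fun _ : Fin t => μ).real {g | c ^ t ≤ ∏ i, f (g i)} ≤ ((∫ x, f x ∂μ) / c) ^ t := by
  have h1 : ∫ g : Fin t → ℝ, ∏ i, f (g i) ∂(Measure.pi fun _ => μ) = (∫ x, f x ∂μ) ^ t := by
    simpa using integral_fintype_prod_eq_pow (ι := Fin t) (μ := μ) f
  have h2 : Integrable (fun g : Fin t → ℝ => ∏ i, f (g i)) (Measure.pi fun _ => μ) := by
    -- An undefined integral has the value 0, but this one is a power of a positive number.
    by_contra h
    have := h1.symm.trans (integral_undef h)
    exact (pow_pos hI t).ne' this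
  have h3 := mul_meas_ge_le_integral_of_nonneg (μ := Measure.pi fun _ : Fin t => μ)
    (f := fun g : Fin t → ℝ => ∏ i, f (g i))
    (ae_of_all _ fun g => Finset.prod_nonneg fun i _ => (hf _).le) h2 (c ^ t)
  rw [h1] at h3
  rw [div_pow, le_div_iff₀ (by positivity), mul_comm]
  exact h3

/-- The Gaussian density is at most 1/√(2π) ≤ 1/2, and exp(−8|x|) has Lebesgue integral 1/4. This
moment drives the small-ball estimate for ∑ |g_i|. -/
theorem integral_exp_neg_abs_gaussianReal :
    0 < ∫ x, Real.exp (-(8 * |x|)) ∂gaussianReal 0 1 ∧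
      ∫ x, Real.exp (-(8 * |x|)) ∂gaussianReal 0 1 ≤ 1 / 8 := by
  have hL : ∫ x : ℝ, Real.exp (-(8 * |x|)) = 1 / 4 := by
    rw [integral_comp_abs (f := fun x => Real.exp (-(8 * x)))]
    have := integral_exp_mul_Ioi (a := -8) (by norm_num) 0
    simp only [neg_mul] at this
    rw [this]; norm_num
  have hLi : Integrable fun x : ℝ => Real.exp (-(8 * |x|)) := by
    by_contra h
    rw [integral_undef h] at hL; norm_num at hL
  have hle : ∀ x : ℝ, Real.exp (-(8 * |x|)) ≤ 1 := fun x => by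
    rw [Real.exp_le_one_iff]; have := abs_nonneg x; linarith
  have hi : Integrable (fun x : ℝ => Real.exp (-(8 * |x|))) (gaussianReal 0 1) := by
    refine Integrable.of_bound (C := 1) (by fun_prop) (ae_of_all _ fun x => ?_)
    rw [Real.norm_eq_abs, abs_of_pos (Real.exp_pos _)]; exact hle x
  refine ⟨integral_exp_pos hi, ?_⟩
  rw [integral_gaussianReal_eq_integral_smul (by norm_num)]
  have h2 : (2 : ℝ) ≤ √(2 * Real.pi) :=
    Real.le_sqrt_of_sq_le (by nlinarith [Real.pi_gt_three])
  have h3 : (√(2 * Real.pi))⁻¹ ≤ 2⁻¹ := inv_anti₀ (by norm_num) h2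
  calc ∫ x, gaussianPDFReal 0 1 x • Real.exp (-(8 * |x|))
      ≤ ∫ x, 2⁻¹ * Real.exp (-(8 * |x|)) := by
        refine integral_mono_of_nonneg (ae_of_all _ fun x => ?_) (hLi.const_mul _)
          (ae_of_all _ fun x => ?_)
        · exact mul_nonneg (gaussianPDFReal_nonneg _ _ _) (Real.exp_pos _).le
        · simp only [smul_eq_mul, gaussianPDFReal_def, NNReal.coe_one, mul_one, sub_zero]
          refine mul_le_mul_of_nonneg_right ?_ (Real.exp_pos _).le
          calc (√(2 * Real.pi))⁻¹ * Real.exp (-x ^ 2 / 2) ≤ (√(2 * Real.pi))⁻¹ * 1 := by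
                refine mul_le_mul_of_nonneg_left ?_ (by positivity)
                rw [Real.exp_le_one_iff]; nlinarith [sq_nonneg x]
            _ ≤ 2⁻¹ := by rw [mul_one]; exact h3
    _ = 1 / 8 := by rw [integral_const_mul, hL]; norm_num

theorem integral_exp_sq_gaussianReal :
    ∫ x, Real.exp (x ^ 2 / 4) ∂gaussianReal 0 1 = √2 := by
  rw [integral_gaussianReal_eq_integral_smul (by norm_num)]
  have : ∀ x : ℝ, gaussianPDFReal 0 1 x • Real.exp (x ^ 2 / 4)
      = (√(2 * Real.pi))⁻¹ * Real.exp (-(1 / 4) * x ^ 2) := fun x => by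
    simp only [smul_eq_mul, gaussianPDFReal_def, NNReal.coe_one, mul_one, sub_zero]
    rw [mul_assoc, ← Real.exp_add]; congr 2; ring
  simp_rw [this]
  rw [integral_const_mul, integral_gaussian, ← Real.sqrt_inv, ← Real.sqrt_mul (by positivity)]
  congr 1
  have := Real.pi_pos
  field_simp; norm_num

/-- The event says that ∏ exp(−8|g_i|) is at least e^{−t}; each factor has mean at most 1/8, and e/8
≤ 1/2. -/
theorem pi_gaussianReal_sum_abs_le_le (t : ℕ) :
    (Measure.pi fun _ : Fin t => gaussianReal 0 1).real {g | ∑ i, |g i| ≤ t / 8}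
      ≤ (1 / 2) ^ t := by
  obtain ⟨h0, h1⟩ := integral_exp_neg_abs_gaussianReal
  have h := measureReal_pi_le_prod_le (fun x => Real.exp_pos _) h0 (c := Real.exp (-1))
    (Real.exp_pos _) t
  refine (measureReal_mono ?_).trans (h.trans ?_)
  · intro g hg
    simp only [Set.mem_ofPred_eq] at hg ⊢
    rw [← Real.exp_sum, ← Real.exp_nat_mul, Real.exp_le_exp, Finset.sum_neg_distrib,
      ← Finset.mul_sum]
    linarith
  · refine pow_le_pow_left₀ (div_nonneg h0.le (Real.exp_pos _).le) ?_ t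
    rw [div_le_iff₀ (Real.exp_pos _), Real.exp_neg]
    refine h1.trans ?_
    have := Real.exp_one_lt_d9
    rw [← div_eq_mul_inv, le_div_iff₀ (Real.exp_pos _)]
    linarith

/-- The event says that ∏ exp(g_i²/4) is at least e^{4t}; each factor has mean √2, and √2/e⁴ ≤ 1/2.
-/
theorem pi_gaussianReal_sum_sq_ge_le (t : ℕ) :
    (Measure.pi fun _ : Fin t => gaussianReal 0 1).real {g | 16 * t ≤ ∑ i, g i ^ 2}
      ≤ (1 / 2) ^ t := by
  have hI := integral_exp_sq_gaussianReal
  have h := measureReal_pi_le_prod_le (μ := gaussianReal 0 1)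
    (f := fun x => Real.exp (x ^ 2 / 4)) (fun x => Real.exp_pos _)
    (by rw [hI]; positivity) (c := Real.exp 4) (Real.exp_pos _) t
  rw [hI] at h
  refine (measureReal_mono ?_).trans (h.trans ?_)
  · intro g hg
    simp only [Set.mem_ofPred_eq] at hg ⊢
    rw [← Real.exp_sum, ← Real.exp_nat_mul, Real.exp_le_exp, ← Finset.sum_div]
    linarith
  · refine pow_le_pow_left₀ (by positivity) ?_ t
    rw [div_le_iff₀ (Real.exp_pos _)]
    have h2 : √2 ≤ 2 := Real.sqrt_le_iff.2 ⟨by norm_num, by norm_num⟩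
    have h4 := Real.add_one_le_exp (4 : ℝ)
    linarith

/-- Rotation invariance of the Gaussian; it reduces a fixed unit vector to independent standard
normal coordinates. -/
theorem map_gaussian_inner {m : ℕ} (z : EuclideanSpace ℝ (Fin m)) (hz : ‖z‖ = 1) :
    (Measure.pi fun _ : Fin m => gaussianReal 0 1).map (fun g => ∑ j, g j * z j)
      = gaussianReal 0 1 := by
  have e : (fun g : Fin m → ℝ => ∑ j, g j * z j)
      = (innerSL ℝ z : StrongDual ℝ (EuclideanSpace ℝ (Fin m))) ∘ (WithLp.toLp 2) := by
    ext g
    simp [PiLp.inner_apply, mul_comm]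
  rw [e, ← Measure.map_map (by fun_prop) (by fun_prop), map_pi_eq_stdGaussian,
    IsGaussian.map_eq_gaussianReal, integral_strongDual_stdGaussian, variance_dual_stdGaussian]
  simp [hz]

theorem map_gaussian_mulVec {t m : ℕ} (z : EuclideanSpace ℝ (Fin m)) (hz : ‖z‖ = 1) :
    (Measure.pi fun _ : Fin t => Measure.pi fun _ : Fin m => gaussianReal 0 1).map
      (fun g i => ∑ j, g i j * z j) = Measure.pi fun _ => gaussianReal 0 1 := by
  have h := map_gaussian_inner z hz
  have : ∀ _ : Fin t, SigmaFinite ((Measure.pi fun _ : Fin m => gaussianReal 0 1).map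
      (fun g => ∑ j, g j * z j)) := fun _ => by rw [h]; infer_instance
  rw [Measure.pi_map_pi (X := fun _ : Fin t => Fin m → ℝ) (f := fun _ g => ∑ j, g j * z j)
    (fun _ => Measurable.aemeasurable (by fun_prop))]
  simp_rw [h]

/-- A Gaussian matrix embeds every low dimensional subspace of `ℓ₂` into `ℓ₁` and into `ℓ₂`. -/
theorem gaussian_embedding {t m q ℓ : ℕ} (V : Submodule ℝ (EuclideanSpace ℝ (Fin m)))
    (hV : Module.finrank ℝ V ≤ q) (ht : 9 * q + ℓ + 1 ≤ t) :
    (Measure.pi fun _ : Fin t => Measure.pi fun _ : Fin m => gaussianReal 0 1)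
      {g | ¬ ∀ v ∈ V, (t : ℝ) / 16 * ‖v‖ ≤ ∑ i, |∑ j, g i j * v j| ∧
        ∑ i, (∑ j, g i j * v j) ^ 2 ≤ 64 * t * ‖v‖ ^ 2} ≤ ENNReal.ofReal ((1 / 2) ^ ℓ) := by
  set P := Measure.pi fun _ : Fin t => Measure.pi fun _ : Fin m => gaussianReal 0 1 with hP
  -- The mesh 1/128 is matched to the operator norm bound 8√t below: moving to a net point changes
  -- the ℓ₁ norm by at most √t · 8√t/128 = t/16, half of the bound t/8 on the net.
  obtain ⟨s, hs, hs1, hnet⟩ := exists_unitSphere_net (E := V) (γ := 1 / 128) (by norm_num)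
  let T : (Fin t → Fin m → ℝ) → V →ₗ[ℝ] EuclideanSpace ℝ (Fin t) := fun g =>
    { toFun := fun v => WithLp.toLp 2 fun i => ∑ j, g i j * (v : EuclideanSpace ℝ (Fin m)) j
      map_add' := fun u v => by ext i; simp [mul_add, Finset.sum_add_distrib]
      map_smul' := fun c v => by
        ext i; simp only [Submodule.coe_smul, PiLp.smul_apply, smul_eq_mul, RingHom.id_apply,
          Finset.mul_sum]; exact Finset.sum_congr rfl fun j _ => by ring }
  have hT : ∀ g v i, T g v i = ∑ j, g i j * (v : EuclideanSpace ℝ (Fin m)) j := fun _ _ _ => rfl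
  have hsub : {g | ¬ ∀ v ∈ V, (t : ℝ) / 16 * ‖v‖ ≤ ∑ i, |∑ j, g i j * v j| ∧
        ∑ i, (∑ j, g i j * v j) ^ 2 ≤ 64 * t * ‖v‖ ^ 2} ⊆
      ⋃ u ∈ s, ({g | ∑ i, |T g u i| ≤ t / 8} ∪ {g | 16 * t ≤ ∑ i, T g u i ^ 2}) := by
    intro g hg
    by_contra hcon
    simp only [Set.mem_iUnion, Set.mem_union, Set.mem_ofPred_eq, not_exists, not_or, not_le] at hcon
    apply hg
    have hl2 : ∀ v, ∑ i, T g v i ^ 2 = ‖T g v‖ ^ 2 := fun v => by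
      rw [EuclideanSpace.norm_sq_eq]; simp
    have hl1 : ∀ v, ∑ i, |T g v i| ≤ √t * ‖T g v‖ := fun v => by
      rw [EuclideanSpace.norm_eq, ← Real.sqrt_mul (Nat.cast_nonneg t)]
      refine Real.le_sqrt_of_sq_le ?_
      have := sq_sum_le_card_mul_sum_sq (s := Finset.univ) (f := fun i => |T g v i|)
      simpa using this
    let L : V →L[ℝ] EuclideanSpace ℝ (Fin t) := LinearMap.toContinuousLinearMap (T g)
    have hL : ∀ v, L v = T g v := fun _ => rfl
    -- Bootstrapping: the bound 4√t on the net gives ‖L‖ ≤ 4√t + ‖L‖/128, and the last term is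
    -- absorbed.
    have hop : ‖L‖ ≤ 8 * √t := by
      have h1 : ‖L‖ ≤ 4 * √t + ‖L‖ * (1 / 128) := by
        refine L.opNorm_le_of_unit_norm (by positivity) fun v hv => ?_
        obtain ⟨u, hu, huv⟩ := hnet v hv
        have hu2 : ‖L u‖ ≤ 4 * √t := by
          have := (hcon u hu).2
          rw [hl2] at this
          refine abs_le_of_sq_le_sq' ?_ (by positivity) |>.2
          rw [mul_pow, Real.sq_sqrt (Nat.cast_nonneg _), hL]; linarith
        calc ‖L v‖ = ‖L u + L (v - u)‖ := by rw [← map_add]; simp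
          _ ≤ ‖L u‖ + ‖L (v - u)‖ := norm_add_le _ _
          _ ≤ 4 * √t + ‖L‖ * (1 / 128) := by
            gcongr
            exact (L.le_opNorm _).trans (by gcongr)
      have : 0 ≤ √(t : ℝ) := by positivity
      linarith
    have hunit : ∀ v : V, ‖v‖ = 1 → (t : ℝ) / 16 ≤ ∑ i, |T g v i| := fun v hv => by
      obtain ⟨u, hu, huv⟩ := hnet v hv
      have h1 := (hcon u hu).1
      have h2 : ∑ i, |T g (v - u) i| ≤ t / 16 := by
        refine (hl1 _).trans ?_
        have h3 : ‖T g (v - u)‖ ≤ 8 * √t * (1 / 128) :=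
          (L.le_opNorm _).trans (mul_le_mul hop huv (norm_nonneg _) (by positivity))
        calc √t * ‖T g (v - u)‖ ≤ √t * (8 * √t * (1 / 128)) := by gcongr
          _ = (√t * √t) / 16 := by ring
          _ = t / 16 := by rw [Real.mul_self_sqrt (Nat.cast_nonneg _)]
      have h3 : ∑ i, |T g u i| ≤ ∑ i, |T g v i| + ∑ i, |T g (v - u) i| := by
        rw [← Finset.sum_add_distrib]
        refine Finset.sum_le_sum fun i _ => ?_
        have : T g u i = T g v i - T g (v - u) i := by rw [map_sub]; simp
        rw [this]; exact abs_sub _ _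
      linarith
    intro v hv
    constructor
    · rcases eq_or_ne v 0 with rfl | hv0
      · simp
      have hvn : 0 < ‖v‖ := norm_pos_iff.2 hv0
      have h := hunit (‖v‖⁻¹ • (⟨v, hv⟩ : V)) (by
        rw [norm_smul, norm_inv, norm_norm]; exact inv_mul_cancel₀ hvn.ne')
      rw [map_smul] at h
      simp only [PiLp.smul_apply, smul_eq_mul, abs_mul, abs_inv, abs_norm, ← Finset.mul_sum] at h
      rw [inv_mul_eq_div, le_div_iff₀ hvn] at h
      exact h
    · have h1 := L.le_opNorm ⟨v, hv⟩
      have h2 : ‖T g ⟨v, hv⟩‖ ≤ 8 * √t * ‖v‖ := h1.trans (by gcongr; exact le_of_eq rfl)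
      have h3 := pow_le_pow_left₀ (norm_nonneg _) h2 2
      rw [← hl2, mul_pow, mul_pow, Real.sq_sqrt (Nat.cast_nonneg _)] at h3
      norm_num at h3
      exact h3
  refine (measure_mono hsub).trans ((measure_biUnion_finset_le _ _).trans ?_)
  have hbd : ∀ u ∈ s, P ({g | ∑ i, |T g u i| ≤ t / 8} ∪ {g | 16 * t ≤ ∑ i, T g u i ^ 2})
      ≤ ENNReal.ofReal (2 * (1 / 2) ^ t) := fun u hu => by
    have hm := map_gaussian_mulVec (t := t) (u : EuclideanSpace ℝ (Fin m)) (hs1 u hu)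
    have hmeas : Measurable fun (g : Fin t → Fin m → ℝ) (i : Fin t) =>
      ∑ j, g i j * (u : EuclideanSpace ℝ (Fin m)) j := by fun_prop
    have a1 := pi_gaussianReal_sum_abs_le_le t
    have a2 := pi_gaussianReal_sum_sq_ge_le t
    rw [← hm, map_measureReal_apply hmeas
      (measurableSet_le (by fun_prop) (by fun_prop))] at a1 a2
    rw [two_mul, ENNReal.ofReal_add (by positivity) (by positivity)]
    refine (measure_union_le _ _).trans (add_le_add ?_ ?_)
    · exact (ENNReal.le_ofReal_iff_toReal_le (measure_ne_top _ _) (by positivity)).2 a1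
    · exact (ENNReal.le_ofReal_iff_toReal_le (measure_ne_top _ _) (by positivity)).2 a2
  refine (Finset.sum_le_sum hbd).trans ?_
  rw [Finset.sum_const, nsmul_eq_mul, ← ENNReal.ofReal_natCast,
    ← ENNReal.ofReal_mul (Nat.cast_nonneg _)]
  refine ENNReal.ofReal_le_ofReal ?_
  -- The net has at most 257^q ≤ 2^{9q} points, each failing with probability at most 2 · 2^{−t};
  -- this is where 9q + ℓ + 1 comes from.
  have hc : (s.card : ℝ) ≤ 2 ^ (9 * q) := by
    refine hs.trans ?_
    calc (1 + 2 / (1 / 128) : ℝ) ^ Module.finrank ℝ V ≤ (2 ^ 9) ^ Module.finrank ℝ V := by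
          gcongr; norm_num
      _ ≤ (2 ^ 9) ^ q := pow_le_pow_right₀ (by norm_num) hV
      _ = 2 ^ (9 * q) := by rw [pow_mul]
  have e : t = 9 * q + 1 + ℓ + (t - (9 * q + ℓ + 1)) := by omega
  have h1 : ((1 : ℝ) / 2) ^ t ≤ (1 / 2) ^ (9 * q + 1 + ℓ) :=
    pow_le_pow_of_le_one (by norm_num) (by norm_num) (by omega)
  calc (s.card : ℝ) * (2 * (1 / 2) ^ t) ≤ 2 ^ (9 * q) * (2 * (1 / 2) ^ (9 * q + 1 + ℓ)) := by
        gcongr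
    _ = (1 / 2) ^ ℓ := by
        rw [pow_add, pow_add, one_div, inv_pow]; field_simp

end Gaussian

/-! ### The sparse embedding -/

section SparseEmbedding

/-- The sign encoded by a Boolean. -/
def boolSign (x : Bool) : ℝ := if x then 1 else -1

theorem boolSign_not (x : Bool) : boolSign (!x) = -boolSign x := by
  cases x <;> simp [boolSign]

theorem boolSign_mul_self (x : Bool) : boolSign x * boolSign x = 1 := by
  cases x <;> simp [boolSign]

instance isProbabilityMeasure_uniformOn_univ {α : Type*} [MeasurableSpace α]
    [MeasurableSingletonClass α] [Finite α] [Nonempty α] :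
    IsProbabilityMeasure (uniformOn (Set.univ : Set α)) :=
  isProbabilityMeasure_uniformOn Set.finite_univ Set.univ_nonempty

theorem measurePreserving_not :
    MeasurePreserving (fun x : Bool => !x) (uniformOn Set.univ) (uniformOn Set.univ) := by
  refine ⟨measurable_of_finite _, ?_⟩
  ext s -
  rw [Measure.map_apply (measurable_of_finite _) (Set.toFinite s).measurableSet, uniformOn_univ,
    uniformOn_univ]
  congr 1
  have : (fun x : Bool => !x) ⁻¹' s = (fun x : Bool => !x) '' s := by
    ext x; simp only [Set.mem_preimage, Set.mem_image]
    exact ⟨fun h => ⟨!x, h, by simp⟩, by rintro ⟨y, hy, rfl⟩; simpa using hy⟩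
  rw [this, Measure.count_injective_image (fun x y h => by simpa using h)]

variable {n t : ℕ}

/-- The uniform distribution of the signs. -/
abbrev signLaw (n : ℕ) : Measure (Fin n → Bool) := Measure.pi fun _ => uniformOn Set.univ

/-- The uniform distribution of the hash functions. -/
abbrev hashLaw (n t : ℕ) : Measure (Fin n → Fin t) := Measure.pi fun _ => uniformOn Set.univ

/-- Flipping one sign preserves the law, so a function odd in that sign has an integral equal to its
own negative. -/
theorem integral_eq_zero_of_flip (f : (Fin n → Bool) → ℝ) (r : Fin n)
    (h : ∀ σ, f (fun j => if j = r then !(σ j) else σ j) = -f σ) :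
    ∫ σ, f σ ∂signLaw n = 0 := by
  have hp : MeasurePreserving
      (fun (σ : Fin n → Bool) j => (if j = r then fun x : Bool => !x else id) (σ j))
      (signLaw n) (signLaw n) := by
    refine measurePreserving_pi (fun _ => uniformOn Set.univ) (fun _ => uniformOn Set.univ)
      fun j => ?_
    by_cases hj : j = r
    · simp only [hj, if_true]; exact measurePreserving_not
    · simp only [hj, if_false]; exact MeasurePreserving.id _
  have h1 : ∫ σ, f σ ∂signLaw n = ∫ σ, -f σ ∂signLaw n := by
    have e := integral_map (μ := signLaw n) hp.measurable.aemeasurable (f := f)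
      (measurable_of_finite _).aestronglyMeasurable
    rw [hp.map_eq] at e
    rw [e]
    refine integral_congr_ae (ae_of_all _ fun σ => ?_)
    simp only
    rw [← h]
    congr 1; ext j; by_cases hj : j = r <;> simp [hj]
  rw [integral_neg] at h1
  linarith

/-- The product of two signs. -/
def pairSign (p : Fin n × Fin n) (σ : Fin n → Bool) : ℝ := boolSign (σ p.1) * boolSign (σ p.2)

/-- If the ordered pairs differ, an index of the first is missing from the second, and flipping its
sign changes the sign of the product. The sign pairs are thus orthonormal. -/
theorem integral_pairSign_mul (p p' : Fin n × Fin n) (hp : p.1 < p.2) (hp' : p'.1 < p'.2) :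
    ∫ σ, pairSign p σ * pairSign p' σ ∂signLaw n = if p = p' then 1 else 0 := by
  by_cases h : p = p'
  · subst h
    have : ∀ σ, pairSign p σ * pairSign p σ = 1 := fun σ => by
      unfold pairSign
      rw [mul_mul_mul_comm, boolSign_mul_self, boolSign_mul_self, one_mul]
    simp [this]
  rw [if_neg h]
  obtain ⟨r, s⟩ := p
  obtain ⟨r', s'⟩ := p'
  simp only at hp hp'
  by_cases h1 : r ≠ r' ∧ r ≠ s'
  · refine integral_eq_zero_of_flip _ r fun σ => ?_
    simp only [pairSign, if_true, if_neg hp.ne', if_neg h1.1.symm, if_neg h1.2.symm, boolSign_not]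
    ring
  by_cases h2 : s ≠ r' ∧ s ≠ s'
  · refine integral_eq_zero_of_flip _ s fun σ => ?_
    simp only [pairSign, if_true, if_neg hp.ne, if_neg h2.1.symm, if_neg h2.2.symm, boolSign_not]
    ring
  -- Both indices of the first pair occur in the second, so the two orderings force the pairs to be
  -- equal.
  exfalso
  apply h
  simp only [Prod.mk.injEq]
  simp only [Fin.ext_iff, Fin.lt_def, not_and_or, not_not, ne_eq] at *
  omega

/-- Sum over the t possible common values, each of probability 1/t² by independence. -/
theorem hashLaw_collision_le [NeZero t] {r s : Fin n} (hrs : r ≠ s) :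
    (hashLaw n t).real {h | h r = h s} ≤ 1 / t := by
  have ht : (0 : ℝ) < t := Nat.cast_pos.2 (NeZero.pos t)
  have hsub : {h : Fin n → Fin t | h r = h s} ⊆
      ⋃ a ∈ (Finset.univ : Finset (Fin t)),
        Set.pi Set.univ fun i => if i = r ∨ i = s then {a} else Set.univ := by
    intro h hh
    simp only [Set.mem_iUnion]
    refine ⟨h r, Finset.mem_univ _, fun i _ => ?_⟩
    by_cases hi : i = r ∨ i = s
    · simp only [hi, if_true]
      rcases hi with rfl | rfl
      · rfl
      · exact (show h r = h i from hh).symm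
    · simp only [hi, if_false]; trivial
  refine (measureReal_mono hsub (measure_ne_top _ _)).trans ((measureReal_biUnion_finset_le _ _).trans ?_)
  have : ∀ a : Fin t, (hashLaw n t).real
      (Set.pi Set.univ fun i => if i = r ∨ i = s then {a} else Set.univ) = 1 / t * (1 / t) := by
    intro a
    rw [measureReal_def, Measure.pi_pi, ENNReal.toReal_prod]
    have e : ∀ i : Fin n, ((uniformOn (Set.univ : Set (Fin t)))
        (if i = r ∨ i = s then {a} else Set.univ)).toReal
        = if i ∈ ({r, s} : Finset (Fin n)) then (1 / t : ℝ) else 1 := fun i => by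
      by_cases hi : i = r ∨ i = s
      · simp only [hi, if_true, Finset.mem_insert, Finset.mem_singleton, uniformOn_univ,
          Measure.count_singleton]
        simp
      · simp [hi]
    simp_rw [e]
    rw [Finset.prod_ite_mem, Finset.univ_inter, Finset.prod_const, Finset.card_pair hrs, sq]
  simp_rw [this]
  simp only [Finset.sum_const, Finset.card_univ, Fintype.card_fin, nsmul_eq_mul]
  field_simp
  exact le_rfl

/-- The action of the sparse embedding with signs `σ` and hash function `h`. -/
def sparseMap (σ : Fin n → Bool) (h : Fin n → Fin t) (u : Fin n → ℝ) (a : Fin t) : ℝ :=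
  ∑ r, (if h r = a then 1 else 0) * (boolSign (σ r) * u r)

/-- The deviation of the sparse embedding from an isometry. -/
def sparseDev (u v : Fin n → ℝ) (p : (Fin n → Bool) × (Fin n → Fin t)) : ℝ :=
  ∑ a, sparseMap p.1 p.2 u a * sparseMap p.1 p.2 v a - ∑ r, u r * v r

theorem sum_sum_eq_diag_add (F : Fin n → Fin n → ℝ) :
    ∑ r, ∑ s, F r s = ∑ r, F r r +
      ∑ p ∈ Finset.univ.filter (fun p : Fin n × Fin n => p.1 < p.2), (F p.1 p.2 + F p.2 p.1) := by
  have h : ∀ r s, F r s = (if r = s then F r s else 0) + (if r < s then F r s else 0)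
      + (if s < r then F r s else 0) := fun r s => by
    rcases lt_trichotomy r s with h | h | h
    · simp [h, h.ne, h.not_gt]
    · simp [h]
    · simp [h, h.ne', h.not_gt]
  rw [Finset.sum_filter, ← Finset.univ_product_univ, Finset.sum_product]
  calc ∑ r, ∑ s, F r s = ∑ r, ∑ s, ((if r = s then F r s else 0) + (if r < s then F r s else 0)
      + (if s < r then F r s else 0)) :=
        Finset.sum_congr rfl fun r _ => Finset.sum_congr rfl fun s _ => h r s
    _ = ∑ r, F r r + (∑ r, ∑ s, (if r < s then F r s else 0)
          + ∑ r, ∑ s, (if s < r then F r s else 0)) := by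
        simp [Finset.sum_add_distrib, add_assoc]
    _ = _ := by
        rw [Finset.sum_comm (f := fun r s => if s < r then F r s else 0), ← Finset.sum_add_distrib]
        congr 1
        refine Finset.sum_congr rfl fun r _ => ?_
        rw [← Finset.sum_add_distrib]
        refine Finset.sum_congr rfl fun s _ => ?_
        by_cases hrs : r < s <;> simp [hrs]

/-- Squares of signs are 1, so the diagonal terms cancel the inner product exactly; what remains
comes from collisions of distinct rows. -/
theorem sparseDev_eq (u v : Fin n → ℝ) (p : (Fin n → Bool) × (Fin n → Fin t)) :
    sparseDev u v p = ∑ e ∈ Finset.univ.filter (fun e : Fin n × Fin n => e.1 < e.2),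
      (u e.1 * v e.2 + u e.2 * v e.1) * (pairSign e p.1 *
        (if p.2 e.1 = p.2 e.2 then 1 else 0)) := by
  have h1 : ∑ a, sparseMap p.1 p.2 u a * sparseMap p.1 p.2 v a
      = ∑ r, ∑ s, (if p.2 r = p.2 s then 1 else 0) *
        (boolSign (p.1 r) * boolSign (p.1 s)) * (u r * v s) := by
    simp only [sparseMap, Finset.sum_mul_sum]
    rw [Finset.sum_comm]
    refine Finset.sum_congr rfl fun r _ => ?_
    rw [Finset.sum_comm]
    refine Finset.sum_congr rfl fun s _ => ?_
    have : ∀ a, (if p.2 r = a then (1 : ℝ) else 0) * (boolSign (p.1 r) * u r) *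
        ((if p.2 s = a then 1 else 0) * (boolSign (p.1 s) * v s))
        = if p.2 r = a then (if p.2 s = a then (boolSign (p.1 r) * boolSign (p.1 s)) * (u r * v s)
          else 0) else 0 := fun a => by
      split_ifs <;> ring
    simp_rw [this]
    simp only [Finset.sum_ite_eq, Finset.mem_univ, if_true]
    by_cases hrs : p.2 r = p.2 s
    · simp [hrs]
    · simp [hrs, Ne.symm hrs]
  rw [sparseDev, h1, sum_sum_eq_diag_add]
  simp only [boolSign_mul_self, if_true, one_mul, mul_one, add_sub_cancel_left]
  refine Finset.sum_congr rfl fun e _ => ?_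
  simp only [pairSign, eq_comm (a := p.2 e.2)]
  ring

/-- Expanding the square, orthogonality of the sign pairs removes all cross terms, and each
remaining term carries a collision probability of at most 1/t. The factor 2 is from (x + y)² ≤ 2(x²
+ y²). -/
theorem integral_sparseDev_sq_le [NeZero t] (u v : Fin n → ℝ) :
    ∫ p, sparseDev u v p ^ 2 ∂(signLaw n).prod (hashLaw n t)
      ≤ 2 / t * ((∑ r, u r ^ 2) * ∑ r, v r ^ 2) := by
  set O := Finset.univ.filter (fun e : Fin n × Fin n => e.1 < e.2) with hO
  let w : Fin n × Fin n → ℝ := fun e => u e.1 * v e.2 + u e.2 * v e.1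
  let J : Fin n × Fin n → (Fin n → Fin t) → ℝ := fun e h => if h e.1 = h e.2 then 1 else 0
  have hJ : ∀ e ∈ O, ∫ h, J e h * J e h ∂hashLaw n t ≤ 1 / t := fun e he => by
    have hlt : e.1 < e.2 := by simpa [hO] using he
    have e1 : (fun h => J e h * J e h) = Set.indicator {h | h e.1 = h e.2} 1 := by
      ext h; by_cases hh : h e.1 = h e.2 <;> simp [J, hh]
    rw [e1, integral_indicator_one (Set.toFinite _).measurableSet]
    exact hashLaw_collision_le hlt.ne
  have h1 : ∀ p, sparseDev u v p ^ 2 = ∑ e ∈ O, ∑ e' ∈ O, (w e * w e') *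
      ((pairSign e p.1 * pairSign e' p.1) * (J e p.2 * J e' p.2)) := fun p => by
    rw [sparseDev_eq, sq, Finset.sum_mul_sum]
    refine Finset.sum_congr rfl fun e _ => Finset.sum_congr rfl fun e' _ => ?_
    simp only [w, J]; ring
  simp_rw [h1]
  rw [integral_finsetSum _ fun _ _ => Integrable.of_finite]
  have h2 : ∀ e ∈ O, ∫ p, ∑ e' ∈ O, (w e * w e') *
      ((pairSign e p.1 * pairSign e' p.1) * (J e p.2 * J e' p.2))
        ∂(signLaw n).prod (hashLaw n t) ≤ w e ^ 2 * (1 / t) := fun e he => by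
    have hlt : e.1 < e.2 := by simpa [hO] using he
    rw [integral_finsetSum _ fun _ _ => Integrable.of_finite]
    rw [Finset.sum_eq_single_of_mem e he]
    · rw [integral_const_mul, integral_prod_mul (fun σ => pairSign e σ * pairSign e σ)
        (fun h => J e h * J e h), integral_pairSign_mul e e hlt hlt, if_pos rfl, one_mul, ← sq]
      exact mul_le_mul_of_nonneg_left (hJ e he) (sq_nonneg _)
    · intro e' he' hne
      have hlt' : e'.1 < e'.2 := by simpa [hO] using he'
      rw [integral_const_mul, integral_prod_mul (fun σ => pairSign e σ * pairSign e' σ)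
        (fun h => J e h * J e' h), integral_pairSign_mul e e' hlt hlt', if_neg hne.symm, zero_mul,
        mul_zero]
  refine (Finset.sum_le_sum h2).trans ?_
  rw [← Finset.sum_mul]
  have h3 : ∑ e ∈ O, w e ^ 2 ≤ 2 * ((∑ r, u r ^ 2) * ∑ r, v r ^ 2) := by
    rw [Finset.sum_mul_sum, sum_sum_eq_diag_add, mul_add, Finset.mul_sum Finset.univ,
      Finset.mul_sum O]
    refine le_add_of_nonneg_of_le (Finset.sum_nonneg fun r _ => by positivity)
      (Finset.sum_le_sum fun e _ => ?_)
    simp only [w]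
    nlinarith [sq_nonneg (u e.1 * v e.2 - u e.2 * v e.1)]
  calc (∑ e ∈ O, w e ^ 2) * (1 / t) ≤ (2 * ((∑ r, u r ^ 2) * ∑ r, v r ^ 2)) * (1 / t) := by gcongr
    _ = _ := by ring

theorem sparseMap_sum {ι : Type*} (s : Finset ι) (σ : Fin n → Bool) (h : Fin n → Fin t)
    (c : ι → ℝ) (f : ι → Fin n → ℝ) (a : Fin t) :
    sparseMap σ h (fun r => ∑ i ∈ s, c i * f i r) a = ∑ i ∈ s, c i * sparseMap σ h (f i) a := by
  simp only [sparseMap, Finset.mul_sum]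
  rw [Finset.sum_comm]
  refine Finset.sum_congr rfl fun i _ => Finset.sum_congr rfl fun r _ => by ring

theorem sparseDev_sum {q : ℕ} (c : Fin q → ℝ) (f : Fin q → Fin n → ℝ)
    (p : (Fin n → Bool) × (Fin n → Fin t)) :
    sparseDev (fun r => ∑ i, c i * f i r) (fun r => ∑ i, c i * f i r) p
      = ∑ e : Fin q × Fin q, (c e.1 * c e.2) * sparseDev (f e.1) (f e.2) p := by
  simp only [sparseDev, sparseMap_sum, Finset.sum_mul_sum]
  simp only [mul_sub, Finset.sum_sub_distrib,
    ← Finset.univ_product_univ, Finset.sum_product, Finset.mul_sum]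
  congr 1
  · rw [Finset.sum_comm]
    refine Finset.sum_congr rfl fun i _ => ?_
    rw [Finset.sum_comm]
    exact Finset.sum_congr rfl fun j _ => Finset.sum_congr rfl fun a _ => by ring
  · rw [Finset.sum_comm]
    refine Finset.sum_congr rfl fun i _ => ?_
    rw [Finset.sum_comm]
    exact Finset.sum_congr rfl fun j _ => Finset.sum_congr rfl fun a _ => by ring

/-- The sparse embedding is nearly isometric on every low dimensional subspace. -/
theorem sparse_embedding [NeZero t] {q : ℕ} (V : Submodule ℝ (EuclideanSpace ℝ (Fin n)))
    (hV : Module.finrank ℝ V ≤ q) :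
    ((signLaw n).prod (hashLaw n t))
      {p | ¬ ∀ v ∈ V, |∑ a, sparseMap p.1 p.2 v a ^ 2 - ‖v‖ ^ 2| ≤ 1 / 2 * ‖v‖ ^ 2}
      ≤ ENNReal.ofReal (8 * (q : ℝ) ^ 2 / t) := by
  let e := stdOrthonormalBasis ℝ V
  let f : Fin (Module.finrank ℝ V) → Fin n → ℝ := fun i => ((e i : V) : EuclideanSpace ℝ (Fin n))
  -- The squared Frobenius norm of the error of the sketched Gram matrix, in an orthonormal basis of
  -- the subspace.
  let Y : (Fin n → Bool) × (Fin n → Fin t) → ℝ := fun p =>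
    ∑ x : Fin (Module.finrank ℝ V) × Fin (Module.finrank ℝ V), sparseDev (f x.1) (f x.2) p ^ 2
  have hf : ∀ i, ∑ r, f i r ^ 2 = 1 := fun i => by
    have h1 : ‖((e i : V) : EuclideanSpace ℝ (Fin n))‖ = 1 := e.orthonormal.1 i
    have := EuclideanSpace.real_norm_sq_eq ((e i : V) : EuclideanSpace ℝ (Fin n))
    rw [h1] at this
    simpa using this.symm
  have hsub : {p | ¬ ∀ v ∈ V, |∑ a, sparseMap p.1 p.2 v a ^ 2 - ‖v‖ ^ 2| ≤ 1 / 2 * ‖v‖ ^ 2} ⊆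
      {p | 1 / 4 ≤ Y p} := by
    intro p hp
    by_contra hY
    simp only [Set.mem_ofPred_eq, not_le] at hY
    apply hp
    intro v hv
    set c : Fin (Module.finrank ℝ V) → ℝ := fun i => e.repr ⟨v, hv⟩ i with hc
    have hvc : (v : Fin n → ℝ) = fun r => ∑ i, c i * f i r := by
      have h1 := congrArg (fun w : V => (w : EuclideanSpace ℝ (Fin n))) (e.sum_repr ⟨v, hv⟩)
      ext r
      have h2 := congrArg (fun w : EuclideanSpace ℝ (Fin n) => w r) h1
      simpa using h2.symm
    have hn : ‖v‖ ^ 2 = ∑ i, c i ^ 2 := by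
      have h1 : ‖v‖ = ‖e.repr ⟨v, hv⟩‖ := by rw [e.repr.norm_map]; rfl
      rw [h1, EuclideanSpace.real_norm_sq_eq]
    have hdev : ∑ a, sparseMap p.1 p.2 v a ^ 2 - ‖v‖ ^ 2 = sparseDev v v p := by
      rw [sparseDev, EuclideanSpace.real_norm_sq_eq]; simp only [sq]
    rw [hdev, hvc, sparseDev_sum]
    -- By Cauchy–Schwarz the quadratic form of the error at v is at most √Y ‖v‖², and √Y < 1/2.
    refine abs_le_of_sq_le_sq ?_ (by positivity)
    refine (Finset.sum_mul_sq_le_sq_mul_sq _ _ _).trans ?_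
    have h3 : ∑ x : Fin (Module.finrank ℝ V) × Fin (Module.finrank ℝ V), (c x.1 * c x.2) ^ 2
        = (‖v‖ ^ 2) ^ 2 := by
      rw [hn, sq (∑ i, c i ^ 2), Finset.sum_mul_sum, ← Finset.univ_product_univ,
        Finset.sum_product]
      simp only [mul_pow]
    rw [h3]
    calc (‖v‖ ^ 2) ^ 2 * Y p ≤ (‖v‖ ^ 2) ^ 2 * (1 / 4) := by gcongr
      _ = (1 / 2 * ‖v‖ ^ 2) ^ 2 := by ring
  refine (measure_mono hsub).trans ?_
  -- Markov's inequality. Each of the at most q² entries has second moment at most 2/t, whence 8q²/t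
  -- and the requirement that t₁ be of order d².
  have hM := mul_meas_ge_le_integral_of_nonneg (μ := (signLaw n).prod (hashLaw n t)) (f := Y)
    (ae_of_all _ fun p => Finset.sum_nonneg fun x _ => sq_nonneg _) Integrable.of_finite (1 / 4)
  have hI : ∫ p, Y p ∂(signLaw n).prod (hashLaw n t) ≤ (q : ℝ) ^ 2 * (2 / t) := by
    rw [integral_finsetSum _ fun _ _ => Integrable.of_finite]
    calc _ ≤ ∑ x : Fin (Module.finrank ℝ V) × Fin (Module.finrank ℝ V), (2 / t : ℝ) := by
          refine Finset.sum_le_sum fun x _ => (integral_sparseDev_sq_le _ _).trans ?_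
          rw [hf, hf]; simp
      _ = (Module.finrank ℝ V : ℝ) ^ 2 * (2 / t) := by simp [sq]
      _ ≤ _ := by gcongr
  rw [ENNReal.le_ofReal_iff_toReal_le (measure_ne_top _ _) (by positivity)]
  change Measure.real _ _ ≤ _
  calc _ ≤ 4 * ((q : ℝ) ^ 2 * (2 / t)) := by linarith
    _ = _ := by ring

end SparseEmbedding

/-! ### Orlicz norms -/

section OrliczNorm

variable {G : ℝ → ℝ}

namespace PropertyP

/-- Convexity together with G(0) = 0. This and its inverse form `mul_map_le` are the only uses of
convexity besides the triangle inequality. -/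
theorem map_mul_le (hG : PropertyP G) {τ x : ℝ} (hτ : 0 ≤ τ) (hτ1 : τ ≤ 1) (hx : 0 ≤ x) :
    G (τ * x) ≤ τ * G x := by
  have h := hG.convexOn.2 (x := 0) (y := x) (by simp) hx (sub_nonneg.2 hτ1) hτ (by ring)
  simpa [hG.map_zero] using h

theorem mul_map_le (hG : PropertyP G) {τ x : ℝ} (hτ : 1 ≤ τ) (hx : 0 ≤ x) :
    τ * G x ≤ G (τ * x) := by
  have h0 : 0 < τ := by linarith
  have h := hG.map_mul_le (τ := τ⁻¹) (x := τ * x) (by positivity) (inv_le_one_of_one_le₀ hτ)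
    (by positivity)
  rw [inv_mul_cancel_left₀ h0.ne', inv_mul_eq_div, le_div_iff₀ h0] at h
  linarith

theorem map_nonneg (hG : PropertyP G) {x : ℝ} (hx : 0 ≤ x) : 0 ≤ G x := by
  have := hG.monotoneOn (a := 0) (b := x) (by simp) hx hx
  rwa [hG.map_zero] at this

theorem map_mono (hG : PropertyP G) {x y : ℝ} (hx : 0 ≤ x) (hxy : x ≤ y) : G x ≤ G y :=
  hG.monotoneOn hx (hx.trans hxy) hxy

theorem map_le_self (hG : PropertyP G) {x : ℝ} (hx : 0 ≤ x) (hx1 : x ≤ 1) : G x ≤ x := by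
  have := hG.map_mul_le hx hx1 zero_le_one
  simpa [hG.map_one] using this

/-- For x > 1, convexity and G(1) = 1 give G(x) ≥ x > 1. Hence the Orlicz norm dominates the sup
norm. -/
theorem le_one_of_map_le (hG : PropertyP G) {x : ℝ} (h : G x ≤ 1) : x ≤ 1 := by
  by_contra! hx
  have := hG.mul_map_le hx.le zero_le_one
  simp only [hG.map_one, mul_one] at this
  linarith

variable {n : ℕ}

theorem sum_le_one_of_le (hG : PropertyP G) {y : Fin n → ℝ} {α β : ℝ} (hα : 0 < α) (hαβ : α ≤ β)
    (h : ∑ r, G (|y r| / α) ≤ 1) : ∑ r, G (|y r| / β) ≤ 1 :=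
  (Finset.sum_le_sum fun r _ => hG.map_mono (div_nonneg (abs_nonneg _) (hα.le.trans hαβ))
    (by gcongr)).trans h

theorem sum_le_one_of_sum_abs_le (hG : PropertyP G) {y : Fin n → ℝ} {α : ℝ} (hα : 0 < α)
    (h : ∑ r, |y r| ≤ α) : ∑ r, G (|y r| / α) ≤ 1 := by
  have h1 : ∀ r, G (|y r| / α) ≤ |y r| / α := fun r =>
    hG.map_le_self (by positivity) ((div_le_one hα).2
      ((Finset.single_le_sum (f := fun r => |y r|) (fun _ _ => abs_nonneg _)
        (Finset.mem_univ r)).trans h))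
  refine (Finset.sum_le_sum fun r _ => h1 r).trans ?_
  rw [← Finset.sum_div, div_le_one hα]
  exact h

end PropertyP

variable {n : ℕ}

theorem orliczNorm_bddBelow (G : ℝ → ℝ) (y : Fin n → ℝ) :
    BddBelow {α : ℝ | 0 < α ∧ ∑ r, G (|y r| / α) ≤ 1} :=
  ⟨0, fun _ h => h.1.le⟩

theorem orliczNorm_le (G : ℝ → ℝ) {y : Fin n → ℝ} {α : ℝ} (hα : 0 < α)
    (h : ∑ r, G (|y r| / α) ≤ 1) : orliczNorm G y ≤ α :=
  csInf_le (orliczNorm_bddBelow G y) ⟨hα, h⟩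

theorem orliczNorm_nonneg (G : ℝ → ℝ) (y : Fin n → ℝ) : 0 ≤ orliczNorm G y :=
  Real.sInf_nonneg fun _ h => h.1.le

namespace PropertyP

theorem orliczNorm_nonempty (hG : PropertyP G) (y : Fin n → ℝ) :
    {α : ℝ | 0 < α ∧ ∑ r, G (|y r| / α) ≤ 1}.Nonempty := by
  have h0 : 0 ≤ ∑ r, |y r| := Finset.sum_nonneg fun _ _ => abs_nonneg _
  exact ⟨∑ r, |y r| + 1, by positivity, hG.sum_le_one_of_sum_abs_le (by positivity) (by linarith)⟩

/-- Monotonicity of G makes the set of admissible α upward closed, so strictly above the infimum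
every value is admissible; that the infimum is attained is not needed. -/
theorem sum_le_one_of_orliczNorm_lt (hG : PropertyP G) {y : Fin n → ℝ} {α : ℝ}
    (h : orliczNorm G y < α) : ∑ r, G (|y r| / α) ≤ 1 := by
  obtain ⟨β, ⟨hβ, hβ1⟩, hβα⟩ := exists_lt_of_csInf_lt (hG.orliczNorm_nonempty y) h
  exact hG.sum_le_one_of_le hβ hβα.le hβ1

theorem one_lt_sum_of_lt_orliczNorm {y : Fin n → ℝ} {α : ℝ} (hα : 0 < α)
    (h : α < orliczNorm G y) : 1 < ∑ r, G (|y r| / α) := by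
  by_contra! hcon
  exact (orliczNorm_le G hα hcon).not_gt h

theorem norm_le_orliczNorm (hG : PropertyP G) (y : Fin n → ℝ) : ‖y‖ ≤ orliczNorm G y := by
  refine le_csInf (hG.orliczNorm_nonempty y) fun α ⟨hα, h⟩ => ?_
  rw [pi_norm_le_iff_of_nonneg hα.le]
  intro r
  have h1 : G (|y r| / α) ≤ 1 := (Finset.single_le_sum (f := fun r => G (|y r| / α))
    (fun r _ => hG.map_nonneg (by positivity)) (Finset.mem_univ r)).trans h
  exact (div_le_one hα).1 (hG.le_one_of_map_le h1)

theorem orliczNorm_le_sum_abs (hG : PropertyP G) (y : Fin n → ℝ) :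
    orliczNorm G y ≤ ∑ r, |y r| := by
  refine le_of_forall_pos_le_add fun ε hε => ?_
  have h0 : 0 ≤ ∑ r, |y r| := Finset.sum_nonneg fun _ _ => abs_nonneg _
  exact orliczNorm_le G (by positivity)
    (hG.sum_le_one_of_sum_abs_le (by positivity) (by linarith))

theorem orliczNorm_le_card_mul_norm (hG : PropertyP G) (y : Fin n → ℝ) :
    orliczNorm G y ≤ n * ‖y‖ := by
  refine (hG.orliczNorm_le_sum_abs y).trans ?_
  calc ∑ r, |y r| ≤ ∑ _r : Fin n, ‖y‖ := Finset.sum_le_sum fun r _ => norm_le_pi_norm y r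
    _ = n * ‖y‖ := by simp

/-- Triangle inequality of a gauge: |x + y|/(α + β) is at most the convex combination of |x|/α and
|y|/β with weights α/(α + β) and β/(α + β). -/
theorem orliczNorm_add_le (hG : PropertyP G) (x y : Fin n → ℝ) :
    orliczNorm G (x + y) ≤ orliczNorm G x + orliczNorm G y := by
  refine le_of_forall_pos_le_add fun ε hε => ?_
  set α := orliczNorm G x + ε / 2 with hα
  set β := orliczNorm G y + ε / 2 with hβ
  have hα0 : 0 < α := by have := orliczNorm_nonneg G x; positivity
  have hβ0 : 0 < β := by have := orliczNorm_nonneg G y; positivity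
  have h1 := hG.sum_le_one_of_orliczNorm_lt (y := x) (α := α) (by linarith)
  have h2 := hG.sum_le_one_of_orliczNorm_lt (y := y) (α := β) (by linarith)
  have h3 : orliczNorm G (x + y) ≤ α + β := by
    refine orliczNorm_le G (by positivity) ?_
    have hp : ∀ r, G (|(x + y) r| / (α + β)) ≤
        α / (α + β) * G (|x r| / α) + β / (α + β) * G (|y r| / β) := fun r => by
      have hx : |x r| / α ∈ Set.Ici (0 : ℝ) := Set.mem_Ici.2 (by positivity)
      have hy : |y r| / β ∈ Set.Ici (0 : ℝ) := Set.mem_Ici.2 (by positivity)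
      have hc := hG.convexOn.2 hx hy
        (show 0 ≤ α / (α + β) by positivity) (show 0 ≤ β / (α + β) by positivity) (by field_simp)
      refine (hG.map_mono (by positivity) ?_).trans hc
      have e : (α / (α + β)) • (|x r| / α) + (β / (α + β)) • (|y r| / β)
          = (|x r| + |y r|) / (α + β) := by simp only [smul_eq_mul]; field_simp
      rw [e]
      gcongr
      exact abs_add_le _ _
    refine (Finset.sum_le_sum fun r _ => hp r).trans ?_
    rw [Finset.sum_add_distrib, ← Finset.mul_sum, ← Finset.mul_sum]
    calc _ ≤ α / (α + β) * 1 + β / (α + β) * 1 := by gcongr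
      _ = 1 := by field_simp
  linarith

theorem orliczNorm_smul_le (hG : PropertyP G) {c : ℝ} (hc : 0 < c) (y : Fin n → ℝ) :
    orliczNorm G (c • y) ≤ c * orliczNorm G y := by
  rw [← div_le_iff₀' hc]
  refine le_csInf (hG.orliczNorm_nonempty y) fun α ⟨hα, h⟩ => ?_
  rw [div_le_iff₀' hc]
  refine orliczNorm_le G (by positivity) ?_
  convert h using 3 with r
  simp only [Pi.smul_apply, smul_eq_mul, abs_mul, abs_of_pos hc]
  rw [mul_div_mul_left _ _ hc.ne']

/-- The norm is Lipschitz with constant n, by the triangle inequality and the comparison with the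
sup norm. Continuity gives minimisers, and measurability through dense subsets. -/
theorem continuous_orliczNorm (hG : PropertyP G) :
    Continuous (orliczNorm G : (Fin n → ℝ) → ℝ) := by
  have h : ∀ x y : Fin n → ℝ, orliczNorm G x ≤ orliczNorm G y + n * dist x y := fun x y => by
    have h1 := hG.orliczNorm_add_le y (x - y)
    have h2 := hG.orliczNorm_le_card_mul_norm (x - y)
    rw [add_sub_cancel] at h1
    rw [dist_eq_norm]; linarith
  refine (LipschitzWith.of_dist_le_mul (K := n) fun x y => ?_).continuous
  rw [Real.dist_eq, abs_sub_le_iff]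
  have h1 := h x y
  have h2 := h y x
  rw [dist_comm y x] at h2
  exact ⟨by simpa using by linarith, by simpa using by linarith⟩

end PropertyP

end OrliczNorm

/-! ### The exponential rescaling -/

section Rescaling

variable {G : ℝ → ℝ} {ν : Measure ℝ} {n : ℕ}

theorem HasOrliczCDF.measure_Iic_le (hν : HasOrliczCDF G ν) {s : ℝ} (hs : 0 ≤ s) :
    ν.real (Set.Iic s) ≤ G s := by
  rw [hν.2 s hs]
  have := Real.add_one_le_exp (-G s)
  linarith

theorem HasOrliczCDF.measure_Ioi (hν : HasOrliczCDF G ν) {s : ℝ} (hs : 0 ≤ s) :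
    ν (Set.Ioi s) = ENNReal.ofReal (Real.exp (-G s)) := by
  have := hν.1
  have h1 : ν.real (Set.Ioi s) = Real.exp (-G s) := by
    rw [← Set.compl_Iic, probReal_compl_eq_one_sub measurableSet_Iic, hν.2 s hs]; ring
  rw [← h1, ofReal_measureReal]

theorem HasOrliczCDF.measureReal_coord_le (hν : HasOrliczCDF G ν) {s : ℝ} (hs : 0 ≤ s)
    (r : Fin n) : (Measure.pi fun _ : Fin n => ν).real {D | D r ≤ s} ≤ G s := by
  have := hν.1
  have h1 : (Measure.pi fun _ : Fin n => ν).real {D | D r ≤ s} = ν.real (Set.Iic s) := by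
    have hp := measurePreserving_eval (fun _ : Fin n => ν) r
    rw [measureReal_def, measureReal_def, ← hp.measure_preimage measurableSet_Iic.nullMeasurableSet]
    rfl
  rw [h1]
  exact hν.measure_Iic_le hs

/-- The reason for this choice of law: tails of independent coordinates multiply to the exponential
of the very sum that defines the Orlicz norm. -/
theorem HasOrliczCDF.measure_forall_lt (hν : HasOrliczCDF G ν) {s : Fin n → ℝ}
    (hs : ∀ r, 0 ≤ s r) : (Measure.pi fun _ : Fin n => ν) {D | ∀ r, s r < D r}
      = ENNReal.ofReal (Real.exp (-∑ r, G (s r))) := by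
  have := hν.1
  have e : {D : Fin n → ℝ | ∀ r, s r < D r} = Set.pi Set.univ fun r => Set.Ioi (s r) := by
    ext D; simp
  rw [e, Measure.pi_pi, ← Finset.sum_neg_distrib, Real.exp_sum,
    ENNReal.ofReal_prod_of_nonneg fun _ _ => (Real.exp_pos _).le]
  exact Finset.prod_congr rfl fun r _ => hν.measure_Ioi (hs r)

/-- Below the infimum, at half the norm, the defining sum exceeds 1; enlarging the arguments by l ≥
1 multiplies it by at least l. In the event every |u_r|/D_r is below ‖u‖_G/(2l). -/
theorem HasOrliczCDF.measureReal_rescaled_small_le (hG : PropertyP G) (hν : HasOrliczCDF G ν)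
    {u : Fin n → ℝ} (hu : 0 < orliczNorm G u) {l : ℝ} (hl : 1 ≤ l) :
    (Measure.pi fun _ : Fin n => ν).real {D | ∀ r, 2 * l * |u r| / orliczNorm G u < D r}
      ≤ Real.exp (-l) := by
  have := hν.1
  rw [measureReal_def, hν.measure_forall_lt (fun r => by positivity),
    ENNReal.toReal_ofReal (Real.exp_pos _).le, Real.exp_le_exp, neg_le_neg_iff]
  have h1 := PropertyP.one_lt_sum_of_lt_orliczNorm (G := G) (y := u) (α := orliczNorm G u / 2)
    (by positivity) (by linarith)
  calc l ≤ l * ∑ r, G (|u r| / (orliczNorm G u / 2)) := by nlinarith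
    _ ≤ ∑ r, G (2 * l * |u r| / orliczNorm G u) := by
      rw [Finset.mul_sum]
      refine Finset.sum_le_sum fun r _ => (hG.mul_map_le hl (by positivity)).trans (le_of_eq ?_)
      congr 1; field_simp

/-- Supplies an exponent a, depending only on δ and c, such that m^a beats the constants for every m
≥ 2. -/
theorem exists_nat_mul_le_mul_two_pow {δ : ℝ} (hδ : 0 < δ) (c : ℕ) :
    ∃ a : ℕ, 1 ≤ a ∧ (c : ℝ) * a ≤ δ * 2 ^ a := by
  have h := tendsto_pow_const_div_const_pow_of_one_lt 1 (r := (2 : ℝ)) (by norm_num)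
  have h2 := (h.const_mul (c : ℝ)).eventually_le_const (u := δ) (by simpa using hδ)
  obtain ⟨a, ha, ha1⟩ := (h2.and (eventually_ge_atTop 1)).exists
  refine ⟨a, ha1, ?_⟩
  rwa [pow_one, ← mul_div_assoc, div_le_iff₀ (by positivity)] at ha

/-- Rescaling by the exponential variables does not shrink any vector of a low dimensional
subspace too much. -/
theorem rescaling_lower {δ : ℝ} (hδ : 0 < δ) :
    ∃ C : ℝ, 0 < C ∧ ∀ (G : ℝ → ℝ) (ν : Measure ℝ), PropertyP G → HasOrliczCDF G ν →
      ∀ (n m q : ℕ), n ≤ m → 2 ≤ m → 1 ≤ q → ∀ V : Submodule ℝ (Fin n → ℝ),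
        Module.finrank ℝ V ≤ q →
        (Measure.pi fun _ : Fin n => ν) {D | ¬ ∀ v ∈ V,
          orliczNorm G v ≤ C * q * Real.log m * ‖fun r => (D r)⁻¹ * v r‖} ≤ ENNReal.ofReal δ := by
  obtain ⟨ℓ, hℓ⟩ := exists_pow_lt_of_lt_one (half_pos hδ) (by norm_num : (1 / 2 : ℝ) < 1)
  obtain ⟨a, ha1, ha⟩ := exists_nat_mul_le_mul_two_pow hδ (64 * (3 + ℓ))
  -- The net below has at most m^{(a+5)q'} points and each fails with probability m^{−bq'}; the
  -- surplus ℓ leaves at most 2^{−ℓ} < δ/2.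
  set b : ℕ := a + 3 + 2 + ℓ with hb
  refine ⟨8 * b, by positivity, ?_⟩
  intro G ν hG hν n m q hnm hm hq V hV
  have := hν.1
  set f := Module.finrank ℝ V with hf
  have hfn : f ≤ n := by
    have := Submodule.finrank_le V
    simpa using this
  -- The true dimension, unlike q, is at most m, so l is at most polynomial in m. The maximum with 1
  -- covers the zero subspace.
  set q' : ℕ := max 1 f with hq'
  have hm0 : (0 : ℝ) < m := by positivity
  have hm2 : (2 : ℝ) ≤ m := by exact_mod_cast hm
  have hlog : Real.log 2 ≤ Real.log m := Real.log_le_log (by norm_num) hm2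
  have hlog2 := Real.log_two_gt_d9
  set l : ℝ := b * q' * Real.log m with hl
  have hb5 : (5 : ℝ) ≤ b := by
    have : 5 ≤ b := by omega
    exact_mod_cast this
  have hq1 : (1 : ℝ) ≤ q' := by exact_mod_cast le_max_left 1 f
  have hl1 : 1 ≤ l := by
    rw [hl]
    nlinarith [mul_le_mul hb5 hq1 zero_le_one (by positivity)]
  -- With probability at least 1 − δ/2 no D_r falls below s: the union bound gives n · G(s) ≤ m · s
  -- = δ/2 if s ≤ 1.
  set s : ℝ := δ / (2 * m) with hs
  -- The mesh must survive division by D_r, which may be as small as s: γ/s ≤ 1/(4l) is ensured by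
  -- 8b ≤ δ m^a.
  set γ : ℝ := ((m : ℝ) ^ (a + 3))⁻¹ with hγ
  have hs0 : 0 < s := by positivity
  have hγ0 : 0 < γ := by positivity
  obtain ⟨net, hcard, hunit, hnet⟩ := exists_unitSphere_net (E := V) hγ0
  have hγs : γ / s ≤ 1 / (4 * l) := by
    have hlm : l ≤ b * m ^ 2 := by
      have h1 : Real.log m ≤ m := (Real.log_le_sub_one_of_pos hm0).trans (by linarith)
      have h2 : (q' : ℝ) ≤ m := by
        have : q' ≤ m := max_le (by omega) (hfn.trans hnm)
        exact_mod_cast this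
      rw [hl, mul_assoc, sq]
      have : 0 ≤ Real.log m := by linarith
      gcongr
    have h3 : (8 : ℝ) * b ≤ δ * m ^ a := by
      have h4 : (8 : ℝ) * b ≤ 64 * (3 + ℓ) * a := by
        have : 8 * b ≤ 64 * (3 + ℓ) * a := by
          rw [hb]; nlinarith [Nat.zero_le ℓ, Nat.mul_le_mul_left ℓ ha1]
        exact_mod_cast this
      refine h4.trans ((by exact_mod_cast ha : (64 : ℝ) * (3 + ℓ) * a ≤ δ * 2 ^ a).trans ?_)
      gcongr
    rw [div_le_div_iff₀ hs0 (by positivity), one_mul, hγ, hs, inv_mul_eq_div,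
      div_le_div_iff₀ (by positivity) (by positivity)]
    calc 4 * l * (2 * m) ≤ 4 * (b * m ^ 2) * (2 * m) := by gcongr
      _ = (8 * b) * m ^ 3 := by ring
      _ ≤ (δ * m ^ a) * m ^ 3 := by gcongr
      _ = δ * m ^ (a + 3) := by rw [pow_add]; ring
  have hnγ : n * γ ≤ 1 := by
    rw [hγ, ← div_eq_mul_inv, div_le_one (by positivity)]
    calc (n : ℝ) ≤ m := by exact_mod_cast hnm
      _ = m ^ 1 := (pow_one _).symm
      _ ≤ m ^ (a + 3) := pow_le_pow_right₀ (by linarith) (by omega)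
  have hsub : {D : Fin n → ℝ | ¬ ∀ v ∈ V,
      orliczNorm G v ≤ 8 * b * q * Real.log m * ‖fun r => (D r)⁻¹ * v r‖} ⊆
      (⋃ r ∈ Finset.univ, {D : Fin n → ℝ | D r ≤ s}) ∪
        ⋃ u ∈ net, {D | ∀ r, 2 * l * |(u : Fin n → ℝ) r| / orliczNorm G (u : Fin n → ℝ) < D r} := by
    intro D hD
    by_contra hcon
    simp only [Set.mem_union, Set.mem_iUnion, Set.mem_ofPred_eq, not_or, not_exists, not_le,
      not_forall, not_lt, Finset.mem_univ, forall_const] at hcon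
    obtain ⟨hDs, hDu⟩ := hcon
    apply hD
    have key : ∀ v : V, ‖v‖ = 1 →
        orliczNorm G (v : Fin n → ℝ) ≤ 8 * l * ‖fun r => (D r)⁻¹ * (v : Fin n → ℝ) r‖ := by
      intro v hv
      obtain ⟨u, hu, huv⟩ := hnet v hv
      set N := orliczNorm G (u : Fin n → ℝ) with hN
      have hN1 : 1 ≤ N := by
        have := hG.norm_le_orliczNorm (u : Fin n → ℝ)
        have h2 : ‖(u : Fin n → ℝ)‖ = 1 := hunit u hu
        linarith
      have huv' : ‖(v : Fin n → ℝ) - (u : Fin n → ℝ)‖ ≤ γ := huv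
      have hNv : orliczNorm G (v : Fin n → ℝ) ≤ 2 * N := by
        have h1 := hG.orliczNorm_add_le (u : Fin n → ℝ) ((v : Fin n → ℝ) - (u : Fin n → ℝ))
        have h2 := hG.orliczNorm_le_card_mul_norm ((v : Fin n → ℝ) - (u : Fin n → ℝ))
        rw [add_sub_cancel] at h1
        have h3 : (n : ℝ) * ‖(v : Fin n → ℝ) - (u : Fin n → ℝ)‖ ≤ n * γ := by gcongr
        linarith
      -- A single coordinate of D⁻¹u that is at least ‖u‖_G/(2l). Replacing u by v costs 1/(4l), at
      -- most half of it because ‖u‖_G ≥ 1.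
      obtain ⟨r, hr⟩ := hDu u hu
      have hDr : 0 < D r := hs0.trans (hDs r)
      have h1 : N / (2 * l) ≤ (D r)⁻¹ * |(u : Fin n → ℝ) r| := by
        rw [div_le_iff₀ (by positivity), inv_mul_eq_div, div_mul_eq_mul_div, le_div_iff₀ hDr]
        rw [le_div_iff₀ (by positivity)] at hr
        linarith
      have h2 : (D r)⁻¹ * |(v : Fin n → ℝ) r - (u : Fin n → ℝ) r| ≤ 1 / (4 * l) := by
        refine le_trans ?_ hγs
        rw [inv_mul_eq_div]
        have : |(v : Fin n → ℝ) r - (u : Fin n → ℝ) r| ≤ γ :=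
          (norm_le_pi_norm ((v : Fin n → ℝ) - (u : Fin n → ℝ)) r).trans huv'
        have h3 := (hDs r).le
        gcongr
      have h3 : |(u : Fin n → ℝ) r| ≤ |(v : Fin n → ℝ) r|
          + |(v : Fin n → ℝ) r - (u : Fin n → ℝ) r| := by
        have := abs_sub_abs_le_abs_sub ((u : Fin n → ℝ) r) ((v : Fin n → ℝ) r)
        rw [abs_sub_comm] at this
        linarith
      have h4 : (D r)⁻¹ * |(v : Fin n → ℝ) r| ≤ ‖fun r => (D r)⁻¹ * (v : Fin n → ℝ) r‖ := by
        have := norm_le_pi_norm (fun r => (D r)⁻¹ * (v : Fin n → ℝ) r) r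
        rwa [Real.norm_eq_abs, abs_mul, abs_of_pos (inv_pos.2 hDr)] at this
      have h5 : N / (4 * l) ≤ ‖fun r => (D r)⁻¹ * (v : Fin n → ℝ) r‖ := by
        have h6 := mul_le_mul_of_nonneg_left h3 (inv_pos.2 hDr).le
        have h7 : 1 / (4 * l) ≤ N / (4 * l) := by gcongr
        have h8 : N / (2 * l) = N / (4 * l) + N / (4 * l) := by field_simp; norm_num
        linarith [mul_add (D r)⁻¹ |(v : Fin n → ℝ) r| |(v : Fin n → ℝ) r - (u : Fin n → ℝ) r|]
      rw [div_le_iff₀ (by positivity)] at h5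
      linarith
    intro v hv
    rcases eq_or_ne v 0 with rfl | hv0
    · have h1 := hG.orliczNorm_le_card_mul_norm (0 : Fin n → ℝ)
      rw [norm_zero, mul_zero] at h1
      have h2 : 0 ≤ Real.log m := by linarith
      exact h1.trans (by positivity)
    have hvn : 0 < ‖v‖ := norm_pos_iff.2 hv0
    have h1 := key (‖v‖⁻¹ • (⟨v, hv⟩ : V)) (by
      rw [norm_smul, norm_inv, norm_norm]; exact inv_mul_cancel₀ hvn.ne')
    have e1 : ((‖v‖⁻¹ • (⟨v, hv⟩ : V) : V) : Fin n → ℝ) = ‖v‖⁻¹ • v := rfl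
    rw [e1] at h1
    have e2 : (fun r => (D r)⁻¹ * (‖v‖⁻¹ • v) r) = ‖v‖⁻¹ • fun r => (D r)⁻¹ * v r := by
      ext r; simp only [Pi.smul_apply, smul_eq_mul]; ring
    rw [e2, norm_smul, norm_inv, norm_norm] at h1
    have h2 := hG.orliczNorm_smul_le hvn (‖v‖⁻¹ • v)
    rw [smul_smul, mul_inv_cancel₀ hvn.ne', one_smul] at h2
    have h3 : f ⊔ 1 ≤ q := sup_le hV hq
    have h4 : (q' : ℝ) ≤ q := by
      have : q' ≤ q := max_le hq hV
      exact_mod_cast this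
    have h5 : l ≤ b * q * Real.log m := by
      have : 0 ≤ Real.log m := by linarith
      rw [hl]; gcongr
    calc orliczNorm G v ≤ ‖v‖ * orliczNorm G (‖v‖⁻¹ • v) := h2
      _ ≤ ‖v‖ * (8 * l * (‖v‖⁻¹ * ‖fun r => (D r)⁻¹ * v r‖)) := by gcongr
      _ = 8 * l * ‖fun r => (D r)⁻¹ * v r‖ := by field_simp
      _ ≤ 8 * (b * q * Real.log m) * ‖fun r => (D r)⁻¹ * v r‖ := by gcongr
      _ = _ := by ring
  refine (measure_mono hsub).trans ((measure_union_le _ _).trans ?_)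
  rw [← add_halves δ, ENNReal.ofReal_add (by positivity) (by positivity)]
  refine add_le_add ?_ ?_
  · rw [ENNReal.le_ofReal_iff_toReal_le (measure_ne_top _ _) (by positivity)]
    change Measure.real _ _ ≤ _
    -- If s > 1 then δ/2 > 1, and there is nothing to prove.
    by_cases hs1 : s ≤ 1
    · refine (measureReal_biUnion_finset_le _ _).trans ?_
      calc ∑ r : Fin n, (Measure.pi fun _ : Fin n => ν).real {D | D r ≤ s}
          ≤ ∑ _r : Fin n, s := Finset.sum_le_sum fun r _ =>
            (hν.measureReal_coord_le hs0.le r).trans (hG.map_le_self hs0.le hs1)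
        _ = n * s := by simp
        _ ≤ m * s := by gcongr
        _ = δ / 2 := by rw [hs]; field_simp
    · refine measureReal_le_one.trans ?_
      rw [hs, not_le, lt_div_iff₀ (by positivity)] at hs1
      linarith
  · rw [ENNReal.le_ofReal_iff_toReal_le (measure_ne_top _ _) (by positivity)]
    change Measure.real _ _ ≤ _
    refine (measureReal_biUnion_finset_le _ _).trans ?_
    have h1 : ∀ u ∈ net, (Measure.pi fun _ : Fin n => ν).real
        {D | ∀ r, 2 * l * |(u : Fin n → ℝ) r| / orliczNorm G (u : Fin n → ℝ) < D r}
        ≤ Real.exp (-l) := fun u hu => by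
      refine HasOrliczCDF.measureReal_rescaled_small_le hG hν ?_ hl1
      have := hG.norm_le_orliczNorm (u : Fin n → ℝ)
      have h2 : ‖(u : Fin n → ℝ)‖ = 1 := hunit u hu
      linarith
    refine (Finset.sum_le_sum h1).trans ?_
    rw [Finset.sum_const, nsmul_eq_mul]
    -- Since l = b q' log m, the failure probability is a power of m, which can be compared with the
    -- size of the net.
    have h2 : Real.exp (-l) = ((m : ℝ) ^ (b * q'))⁻¹ := by
      rw [hl, Real.exp_neg, ← Real.exp_log (pow_pos hm0 (b * q')), Real.log_pow]
      push_cast; rfl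
    have h3 : (net.card : ℝ) ≤ (m : ℝ) ^ ((a + 5) * q') := by
      refine hcard.trans ?_
      have h4 : 1 + 2 / γ ≤ (m : ℝ) ^ (a + 5) := by
        rw [hγ, div_inv_eq_mul]
        have h5 : (1 : ℝ) ≤ m ^ (a + 3) := one_le_pow₀ (by linarith)
        have h6 : (m : ℝ) ^ (a + 5) = m ^ (a + 3) * (m * m) := by ring
        nlinarith [mul_le_mul hm2 hm2 (by norm_num) (by positivity)]
      have h7 : (1 : ℝ) ≤ m ^ (a + 5) := one_le_pow₀ (by linarith)
      calc (1 + 2 / γ) ^ f ≤ ((m : ℝ) ^ (a + 5)) ^ f := by gcongr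
        _ ≤ ((m : ℝ) ^ (a + 5)) ^ q' := pow_le_pow_right₀ h7 (le_max_right _ _)
        _ = _ := by rw [pow_mul]
    have h8 : (m : ℝ) ^ (b * q') = m ^ ((a + 5) * q') * m ^ (ℓ * q') := by
      rw [← pow_add]; congr 1; rw [hb]; ring
    calc (net.card : ℝ) * Real.exp (-l) ≤ m ^ ((a + 5) * q') * ((m : ℝ) ^ (b * q'))⁻¹ := by
          rw [h2]; gcongr
      _ = ((m : ℝ) ^ (ℓ * q'))⁻¹ := by rw [h8]; field_simp
      _ ≤ ((m : ℝ) ^ ℓ)⁻¹ := by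
          refine inv_anti₀ (by positivity) (pow_le_pow_right₀ (by linarith) ?_)
          exact Nat.le_mul_of_pos_right _ (by omega)
      _ ≤ ((2 : ℝ) ^ ℓ)⁻¹ := by
          refine inv_anti₀ (by positivity) ?_
          gcongr
      _ ≤ δ / 2 := by
          rw [one_div, inv_pow] at hℓ; exact hℓ.le

/-- A discrete layer-cake bound: the largest dyadic threshold M/2^{j+1} not above X contributes
(M/2^j)² ≥ X². If X lies below all thresholds, the first term suffices. -/
theorem sq_le_dyadic {M X : ℝ} (hX : 0 ≤ X) (hXM : X ≤ M) (K : ℕ) :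
    X ^ 2 ≤ (M / 2 ^ K) ^ 2 +
      ∑ j ∈ Finset.range K, if M / 2 ^ (j + 1) ≤ X then (M / 2 ^ j) ^ 2 else 0 := by
  induction K with
  | zero => simpa using pow_le_pow_left₀ hX hXM 2
  | succ K ih =>
    rw [Finset.sum_range_succ]
    have h0 : 0 ≤ ∑ j ∈ Finset.range K, if M / 2 ^ (j + 1) ≤ X then (M / 2 ^ j) ^ 2 else 0 :=
      Finset.sum_nonneg fun j _ => by split_ifs <;> positivity
    split_ifs with h
    · have : 0 ≤ (M / 2 ^ (K + 1)) ^ 2 := by positivity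
      linarith
    · have : X ^ 2 ≤ (M / 2 ^ (K + 1)) ^ 2 := pow_le_pow_left₀ hX (not_le.1 h).le 2
      linarith

/-- Rescaling by the exponential variables does not stretch a fixed vector too much. -/
theorem rescaling_upper {G : ℝ → ℝ} (hG : PropertyP G) {δ : ℝ} (hδ : 0 < δ) :
    ∃ C : ℝ, 0 < C ∧ ∀ ν : Measure ℝ, HasOrliczCDF G ν → ∀ (n m : ℕ), n ≤ m → 2 ≤ m →
      ∀ y : Fin n → ℝ, (Measure.pi fun _ : Fin n => ν) {D | ¬
          ∑ r, ((D r)⁻¹ * y r) ^ 2 ≤ C * Real.log m * orliczNorm G y ^ 2} ≤ ENNReal.ofReal δ := by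
  -- Ensures that the truncation level M = 2/δ is at least 1.
  wlog hδ1 : δ ≤ 1 generalizing δ
  · obtain ⟨C, hC, h⟩ := this one_pos le_rfl
    exact ⟨C, hC, fun ν hν n m hnm hm y => (h ν hν n m hnm hm y).trans
      (ENNReal.ofReal_le_ofReal (by linarith))⟩
  obtain ⟨c, hc, hgrow⟩ := hG.growth
  set M : ℝ := 2 / δ with hM
  have hM0 : 0 < M := by positivity
  have hM1 : 1 ≤ M := by rw [hM, le_div_iff₀ hδ]; linarith
  refine ⟨4 * (M ^ 2 * 2 + M * (4 * c * M ^ 2 * 5)), by positivity, ?_⟩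
  intro ν hν n m hnm hm y
  have := hν.1
  have hm2 : (2 : ℝ) ≤ m := by exact_mod_cast hm
  have hm0 : (0 : ℝ) < m := by linarith
  have hlog : Real.log 2 ≤ Real.log m := Real.log_le_log (by norm_num) hm2
  have hlog2 := Real.log_two_gt_d9
  set N := orliczNorm G y with hN
  have hN0 : 0 ≤ N := orliczNorm_nonneg G y
  rcases hN0.eq_or_lt with hN00 | hNpos
  · have hy : y = 0 := by
      have := hG.norm_le_orliczNorm y
      rw [← hN, ← hN00] at this
      exact norm_le_zero_iff.1 this
    have e : {D : Fin n → ℝ | ¬ ∑ r, ((D r)⁻¹ * y r) ^ 2 ≤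
        4 * (M ^ 2 * 2 + M * (4 * c * M ^ 2 * 5)) * Real.log m * N ^ 2} = ∅ := by
      ext D; simp [hy, ← hN00]
    rw [e, measure_empty]; exact zero_le
  -- Dividing by 2N instead of N stays strictly above the infimum, so that ∑ G(w_r) ≤ 1.
  set w : Fin n → ℝ := fun r => |y r| / (2 * N) with hw
  have hw0 : ∀ r, 0 ≤ w r := fun r => by positivity
  have hsum : ∑ r, G (w r) ≤ 1 := hG.sum_le_one_of_orliczNorm_lt (by linarith)
  -- Enough scales that 2^K ≥ m, so that the entries below the last scale contribute at most
  -- n(M/2^K)² ≤ M²; still K = O(log m).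
  set K : ℕ := Nat.clog 2 m + 1 with hK
  have hKm : (m : ℝ) ≤ 2 ^ K := by
    have h1 : m ≤ 2 ^ Nat.clog 2 m := Nat.le_pow_clog (by norm_num) m
    have h2 : m ≤ 2 ^ K := h1.trans (Nat.pow_le_pow_right (by norm_num) (by omega))
    exact_mod_cast h2
  have hKlog : (K : ℝ) ≤ 5 * Real.log m := by
    have h1 : 2 ^ (Nat.clog 2 m).pred < m := Nat.pow_pred_clog_lt_self (by norm_num) (by omega)
    have h2 : ((Nat.clog 2 m).pred : ℝ) * Real.log 2 ≤ Real.log m := by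
      rw [← Real.log_pow]
      refine Real.log_le_log (by positivity) ?_
      exact_mod_cast h1.le
    have h3 : (K : ℝ) ≤ (Nat.clog 2 m).pred + 2 := by
      have : K ≤ (Nat.clog 2 m).pred + 2 := by rw [hK, Nat.pred_eq_sub_one]; omega
      exact_mod_cast this
    have h4 : (0 : ℝ) ≤ ((Nat.clog 2 m).pred : ℝ) := Nat.cast_nonneg _
    nlinarith
  -- For D_r > 0 the event D_r ≤ thr r j is w_r/D_r ≥ M/2^{j+1}. `Z` below is thus the dyadic
  -- majorant of the sum of (w_r/D_r)², truncated at M.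
  set thr : Fin n → ℕ → ℝ := fun r j => w r * 2 ^ (j + 1) / M with hthr
  have hthr0 : ∀ r j, 0 ≤ thr r j := fun r j => by have := hw0 r; positivity
  let Z : (Fin n → ℝ) → ℝ := fun D => ∑ r, ∑ j ∈ Finset.range K,
    Set.indicator {D : Fin n → ℝ | D r ≤ thr r j} (fun _ => (M / 2 ^ j) ^ 2) D
  have hmeas : ∀ r j, MeasurableSet {D : Fin n → ℝ | D r ≤ thr r j} := fun r j =>
    measurableSet_le (by fun_prop) (by fun_prop)
  have hint : ∀ r j, Integrable (Set.indicator {D : Fin n → ℝ | D r ≤ thr r j}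
      fun _ => (M / 2 ^ j) ^ 2) (Measure.pi fun _ : Fin n => ν) := fun r j =>
    (integrable_const _).indicator (hmeas r j)
  have hZint : Integrable Z (Measure.pi fun _ : Fin n => ν) :=
    integrable_finsetSum _ fun r _ => integrable_finsetSum _ fun j _ => hint r j
  have hZ : ∫ D, Z D ∂(Measure.pi fun _ : Fin n => ν) ≤ 4 * c * M ^ 2 * K := by
    rw [integral_finsetSum _ fun r _ => integrable_finsetSum _ fun j _ => hint r j]
    have h1 : ∀ r, ∫ D, ∑ j ∈ Finset.range K, Set.indicator {D : Fin n → ℝ | D r ≤ thr r j}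
        (fun _ => (M / 2 ^ j) ^ 2) D ∂(Measure.pi fun _ : Fin n => ν)
        ≤ 4 * c * M ^ 2 * K * G (w r) := fun r => by
      rw [integral_finsetSum _ fun j _ => hint r j]
      have h2 : ∀ j ∈ Finset.range K, ∫ D, Set.indicator {D : Fin n → ℝ | D r ≤ thr r j}
          (fun _ => (M / 2 ^ j) ^ 2) D ∂(Measure.pi fun _ : Fin n => ν)
          ≤ 4 * c * M ^ 2 * G (w r) := fun j _ => by
        rw [integral_indicator_const _ (hmeas r j), smul_eq_mul]
        -- The growth condition enters here: level j has probability at most c · 4^{j+1} G(w_r),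
        -- which exactly compensates its weight (M/2^j)². All K scales contribute equally, hence the
        -- factor log m.
        have h3 : G (thr r j) ≤ c * (2 ^ (j + 1)) ^ 2 * G (w r) := by
          rcases (hw0 r).eq_or_lt with h0 | hpos
          · simp [hthr, ← h0, hG.map_zero]
          · have h4 : G (thr r j) ≤ G (w r * 2 ^ (j + 1)) :=
              hG.map_mono (hthr0 r j) (div_le_self (by positivity) hM1)
            have h5 := hgrow (w r) (w r * 2 ^ (j + 1)) hpos
              (lt_mul_of_one_lt_right hpos (one_lt_pow₀ (by norm_num) (by omega)))
            rw [mul_div_cancel_left₀ _ hpos.ne'] at h5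
            exact h4.trans h5
        calc _ ≤ (c * (2 ^ (j + 1)) ^ 2 * G (w r)) * (M / 2 ^ j) ^ 2 := by
              gcongr
              exact (hν.measureReal_coord_le (hthr0 r j) r).trans h3
          _ = 4 * c * M ^ 2 * G (w r) := by field_simp; ring
      refine (Finset.sum_le_sum h2).trans (le_of_eq ?_)
      rw [Finset.sum_const, Finset.card_range, nsmul_eq_mul]; ring
    refine (Finset.sum_le_sum fun r _ => h1 r).trans ?_
    rw [← Finset.mul_sum]
    exact mul_le_of_le_one_right (by positivity) hsum
  set I : ℝ := 4 * c * M ^ 2 * K with hI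
  have hI0 : 0 < I := by rw [hI, hK]; positivity
  have hsub : {D : Fin n → ℝ | ¬ ∑ r, ((D r)⁻¹ * y r) ^ 2 ≤
        4 * (M ^ 2 * 2 + M * (4 * c * M ^ 2 * 5)) * Real.log m * N ^ 2} ⊆
      (⋃ r ∈ Finset.univ, {D : Fin n → ℝ | D r ≤ w r / M}) ∪ {D | M * I ≤ Z D} := by
    intro D hD
    by_contra hcon
    simp only [Set.mem_union, Set.mem_iUnion, Set.mem_ofPred_eq, not_or, not_exists, not_le,
      Finset.mem_univ, forall_const] at hcon
    obtain ⟨h1, h2⟩ := hcon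
    apply hD
    have hDpos : ∀ r, 0 < D r := fun r => (div_nonneg (hw0 r) hM0.le).trans_lt (h1 r)
    have hX : ∀ r, (w r / D r) ^ 2 ≤ (M / 2 ^ K) ^ 2 + ∑ j ∈ Finset.range K,
        Set.indicator {D : Fin n → ℝ | D r ≤ thr r j} (fun _ => (M / 2 ^ j) ^ 2) D := fun r => by
      have hd := hDpos r
      have h3 : w r / D r ≤ M := by
        have := h1 r
        rw [div_lt_iff₀ hM0] at this
        rw [div_le_iff₀ hd]; linarith
      refine (sq_le_dyadic (div_nonneg (hw0 r) hd.le) h3 K).trans ?_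
      gcongr with j hj
      have : M / 2 ^ (j + 1) ≤ w r / D r ↔ D r ≤ thr r j := by
        rw [div_le_div_iff₀ (by positivity) hd, hthr, le_div_iff₀ hM0, mul_comm]
      simp only [this, Set.indicator_apply, Set.mem_ofPred_eq]
      exact le_rfl
    have hsq : ∀ r, ((D r)⁻¹ * y r) ^ 2 = 4 * N ^ 2 * (w r / D r) ^ 2 := fun r => by
      rw [hw]
      simp only [div_pow, sq_abs, mul_pow, inv_pow]
      have := (hDpos r).ne'
      field_simp; norm_num
    have h4 : ∑ r : Fin n, (M / 2 ^ K) ^ 2 ≤ M ^ 2 := by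
      rw [Finset.sum_const, Finset.card_univ, Fintype.card_fin, nsmul_eq_mul, div_pow,
        mul_div_assoc', div_le_iff₀ (by positivity), mul_comm]
      have h5 : (n : ℝ) ≤ m := by exact_mod_cast hnm
      have h6 : (1 : ℝ) ≤ 2 ^ K := one_le_pow₀ (by norm_num)
      refine mul_le_mul_of_nonneg_left ?_ (by positivity)
      nlinarith
    have h7 : ∑ r, (w r / D r) ^ 2 ≤ M ^ 2 + M * I :=
      calc ∑ r, (w r / D r) ^ 2 ≤ ∑ r : Fin n, (M / 2 ^ K) ^ 2 + Z D := by
            rw [← Finset.sum_add_distrib]; exact Finset.sum_le_sum fun r _ => hX r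
        _ ≤ M ^ 2 + M * I := add_le_add h4 h2.le
    have h8 : M ^ 2 + M * I ≤ (M ^ 2 * 2 + M * (4 * c * M ^ 2 * 5)) * Real.log m := by
      rw [add_mul]
      refine add_le_add ?_ ?_
      · rw [mul_assoc]
        exact le_mul_of_one_le_right (by positivity) (by linarith)
      · rw [hI, mul_assoc M]
        refine mul_le_mul_of_nonneg_left ?_ hM0.le
        rw [mul_assoc _ (5 : ℝ)]
        exact mul_le_mul_of_nonneg_left hKlog (by positivity)
    simp_rw [hsq]
    rw [← Finset.mul_sum]
    calc 4 * N ^ 2 * ∑ r, (w r / D r) ^ 2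
        ≤ 4 * N ^ 2 * ((M ^ 2 * 2 + M * (4 * c * M ^ 2 * 5)) * Real.log m) := by
          gcongr; exact h7.trans h8
      _ = _ := by ring
  refine (measure_mono hsub).trans ((measure_union_le _ _).trans ?_)
  rw [← add_halves δ, ENNReal.ofReal_add (by positivity) (by positivity)]
  refine add_le_add ?_ ?_
  · rw [ENNReal.le_ofReal_iff_toReal_le (measure_ne_top _ _) (by positivity)]
    refine (measureReal_biUnion_finset_le _ _).trans ?_
    -- The truncation fails with probability at most ∑ G(w_r/M) ≤ 1/M = δ/2, by convexity; Markov's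
    -- inequality for `Z` takes the other half.
    have h1 : ∀ r, (Measure.pi fun _ : Fin n => ν).real {D | D r ≤ w r / M} ≤ M⁻¹ * G (w r) :=
      fun r => by
        have h2 := hG.map_mul_le (inv_nonneg.2 hM0.le) (inv_le_one_of_one_le₀ hM1) (hw0 r)
        rw [inv_mul_eq_div] at h2
        exact (hν.measureReal_coord_le (div_nonneg (hw0 r) hM0.le) r).trans h2
    refine (Finset.sum_le_sum fun r _ => h1 r).trans ?_
    rw [← Finset.mul_sum]
    refine (mul_le_of_le_one_right (by positivity) hsum).trans (le_of_eq ?_)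
    rw [hM, inv_div]
  · rw [ENNReal.le_ofReal_iff_toReal_le (measure_ne_top _ _) (by positivity)]
    have h1 := mul_meas_ge_le_integral_of_nonneg (μ := Measure.pi fun _ : Fin n => ν) (f := Z)
      (ae_of_all _ fun D => Finset.sum_nonneg fun r _ => Finset.sum_nonneg fun j _ =>
        Set.indicator_nonneg (fun _ _ => by positivity) _) hZint (M * I)
    have h2 := h1.trans hZ
    change (Measure.pi fun _ : Fin n => ν).real {D | M * I ≤ Z D} ≤ _
    rw [mul_comm M I, mul_assoc] at h2
    have h3 : M * (Measure.pi fun _ : Fin n => ν).real {D | I * M ≤ Z D} ≤ 1 := by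
      by_contra! hcon
      nlinarith
    rw [mul_comm M I]
    have h4 : δ / 2 = 1 / M := by rw [hM, one_div, inv_div]
    rw [h4, le_div_iff₀ hM0]; linarith

end Rescaling

/-! ### Existence of minimizers -/

section Minimizers

/-- The minimisation is done over the range of M: in x itself the objective need not be coercive, as
M may have a kernel. -/
theorem exists_forall_le_of_norm_le {ι : Type*} [Fintype ι] {d : ℕ} {F : (ι → ℝ) → ℝ}
    (hF : Continuous F) (hle : ∀ y, ‖y‖ ≤ F y) (M : Matrix ι (Fin d) ℝ) (c : ι → ℝ) :
    ∃ x, ∀ x', F (M *ᵥ x - c) ≤ F (M *ᵥ x' - c) := by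
  let K : Submodule ℝ (ι → ℝ) := LinearMap.range M.mulVecLin
  have hcont : Continuous fun w : K => F ((w : ι → ℝ) - c) :=
    hF.comp (continuous_subtype_val.sub continuous_const)
  have hlim : Tendsto (fun w : K => F ((w : ι → ℝ) - c)) (cocompact K) atTop := by
    have h1 : Tendsto (fun w : K => ‖w‖ - ‖c‖) (cocompact K) atTop :=
      tendsto_atTop_add_const_right _ _ (tendsto_norm_cocompact_atTop)
    refine tendsto_atTop_mono (fun w => ?_) h1
    exact (norm_sub_norm_le (w : ι → ℝ) c).trans (hle _)
  obtain ⟨⟨_, x, rfl⟩, hx⟩ := hcont.exists_forall_le hlim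
  exact ⟨x, fun x' => hx ⟨_, x', rfl⟩⟩

theorem norm_le_sum_abs {ι : Type*} [Fintype ι] (y : ι → ℝ) : ‖y‖ ≤ ∑ i, |y i| := by
  rw [pi_norm_le_iff_of_nonneg (Finset.sum_nonneg fun _ _ => abs_nonneg _)]
  exact fun i => Finset.single_le_sum (f := fun i => |y i|) (fun _ _ => abs_nonneg _)
    (Finset.mem_univ i)

variable {k d : ℕ} {n : Fin k → ℕ} {t₁ t₂ t₃ : ℕ}

theorem exists_minimizer_sketchedLoss (ω : Draw n t₁ t₂ t₃)
    (A : (i : Fin k) → Matrix (Fin (n i)) (Fin d) ℝ) (b : (i : Fin k) → Fin (n i) → ℝ) :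
    ∃ xhat, ∀ x, sketchedLoss ω A b xhat ≤ sketchedLoss ω A b x := by
  obtain ⟨x, hx⟩ := exists_forall_le_of_norm_le (F := fun y => ∑ p, |y p|) (by fun_prop)
    norm_le_sum_abs (sketch ω * stack A) (sketch ω *ᵥ stackVec b)
  refine ⟨x, fun x' => ?_⟩
  simp only [sketchedLoss, mulVec_sub, mulVec_mulVec]
  exact hx x'

theorem exists_minimizer_loss {G : Fin k → ℝ → ℝ} (hG : ∀ i, PropertyP (G i))
    (A : (i : Fin k) → Matrix (Fin (n i)) (Fin d) ℝ) (b : (i : Fin k) → Fin (n i) → ℝ) :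
    ∃ xhat, ∀ x, loss G A b xhat ≤ loss G A b x := by
  let F : ((Σ i : Fin k, Fin (n i)) → ℝ) → ℝ := fun y => ∑ i, orliczNorm (G i) fun r => y ⟨i, r⟩
  have hF : Continuous F := continuous_finsetSum _ fun i _ =>
    (hG i).continuous_orliczNorm.comp (continuous_pi fun r => continuous_apply _)
  have hle : ∀ y, ‖y‖ ≤ F y := fun y => by
    rw [pi_norm_le_iff_of_nonneg (Finset.sum_nonneg fun _ _ => orliczNorm_nonneg _ _)]
    rintro ⟨i, r⟩
    refine (norm_le_pi_norm (fun r => y ⟨i, r⟩) r).trans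
      (((hG i).norm_le_orliczNorm _).trans ?_)
    exact Finset.single_le_sum (f := fun i => orliczNorm (G i) fun r => y ⟨i, r⟩)
      (fun _ _ => orliczNorm_nonneg _ _) (Finset.mem_univ i)
  exact exists_forall_le_of_norm_le hF hle (stack A) (stackVec b)

end Minimizers

/-! ### The sketch of one block -/

section Block

variable {n t₁ t₂ t₃ : ℕ}

/-- The sketch of one block as a matrix. -/
def BlockDraw.matrix (ω : BlockDraw n t₁ t₂ t₃) : Matrix (Fin t₃) (Fin n) ℝ :=
  ω.B * ω.Pi2 * ω.Pi1 * ω.Dinv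

theorem BlockDraw.sparseMap_apply (ω : BlockDraw n t₁ t₂ t₃) (z : Fin n → ℝ) (a : Fin t₁) :
    (ω.Pi1 *ᵥ z) a = sparseMap ω.2.1 ω.2.2.1 z a := by
  rw [BlockDraw.Pi1, ← mulVec_mulVec, mulVec, dotProduct, sparseMap]
  refine Finset.sum_congr rfl fun r _ => ?_
  rw [mulVec_diagonal]
  rfl

theorem BlockDraw.matrix_mulVec_apply (ω : BlockDraw n t₁ t₂ t₃) (y : Fin n → ℝ) (u : Fin t₃) :
    (ω.matrix *ᵥ y) u = √(Real.pi / 2) / t₃ * ∑ v, ω.2.2.2.2 u v * (1 / √t₂ *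
      ∑ a, ω.2.2.2.1 v a * sparseMap ω.2.1 ω.2.2.1 (fun r => (ω.1 r)⁻¹ * y r) a) := by
  have hB : ∀ w, (ω.B *ᵥ w) u = √(Real.pi / 2) / t₃ * ∑ v, ω.2.2.2.2 u v * w v := fun w => by
    rw [BlockDraw.B, smul_mulVec, Pi.smul_apply, smul_eq_mul]; rfl
  have hP : ∀ w v, (ω.Pi2 *ᵥ w) v = 1 / √t₂ * ∑ a, ω.2.2.2.1 v a * w a := fun w v => by
    rw [BlockDraw.Pi2, smul_mulVec, Pi.smul_apply, smul_eq_mul]; rfl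
  have hD : ω.Dinv *ᵥ y = fun r => (ω.1 r)⁻¹ * y r := by
    ext r; rw [BlockDraw.Dinv, mulVec_diagonal]; rfl
  simp only [BlockDraw.matrix, ← mulVec_mulVec, hB, hP, BlockDraw.sparseMap_apply, hD]

theorem sketch_eq {k : ℕ} {n : Fin k → ℕ} (ω : Draw n t₁ t₂ t₃) :
    sketch ω = blockDiagonal' fun i => (ω i).matrix := by
  simp only [sketch, BlockDraw.matrix, blockDiagonal'_mul]

theorem sketch_mulVec_apply {k : ℕ} {n : Fin k → ℕ} (ω : Draw n t₁ t₂ t₃)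
    (y : (Σ i : Fin k, Fin (n i)) → ℝ) (i : Fin k) (u : Fin t₃) :
    (sketch ω *ᵥ y) ⟨i, u⟩ = ((ω i).matrix *ᵥ fun r => y ⟨i, r⟩) u := by
  rw [sketch_eq, mulVec, dotProduct, Fintype.sum_sigma, Finset.sum_eq_single i]
  · simp only [blockDiagonal'_apply_eq]; rfl
  · intro j _ hj
    exact Finset.sum_eq_zero fun r _ => by rw [blockDiagonal'_apply_ne _ _ _ hj.symm, zero_mul]
  · simp

theorem sketchedLoss_eq {k d : ℕ} {n : Fin k → ℕ} (ω : Draw n t₁ t₂ t₃)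
    (A : (i : Fin k) → Matrix (Fin (n i)) (Fin d) ℝ) (b : (i : Fin k) → Fin (n i) → ℝ)
    (x : Fin d → ℝ) :
    sketchedLoss ω A b x = ∑ i, ∑ u, |((ω i).matrix *ᵥ (A i *ᵥ x - b i)) u| := by
  rw [sketchedLoss, Fintype.sum_sigma]
  refine Finset.sum_congr rfl fun i _ => Finset.sum_congr rfl fun u _ => ?_
  rw [sketch_mulVec_apply]
  rfl

theorem measurable_matrix_mulVec_apply (y : Fin n → ℝ) (u : Fin t₃) :
    Measurable fun ω : BlockDraw n t₁ t₂ t₃ => (ω.matrix *ᵥ y) u := by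
  simp only [BlockDraw.matrix_mulVec_apply, sparseMap]
  refine Measurable.const_mul (Finset.measurable_sum _ fun v _ => Measurable.mul (by fun_prop)
    (Measurable.const_mul (Finset.measurable_sum _ fun a _ => Measurable.mul (by fun_prop)
      (Finset.measurable_sum _ fun r _ => Measurable.mul ?_ (Measurable.mul ?_ ?_))) _)) _
  · have h : Measurable fun x : Fin t₁ => if x = a then (1 : ℝ) else 0 := measurable_of_finite _
    exact h.comp (by fun_prop : Measurable fun ω : BlockDraw n t₁ t₂ t₃ => ω.2.2.1 r)
  · have h : Measurable boolSign := measurable_of_finite _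
    exact h.comp (by fun_prop : Measurable fun ω : BlockDraw n t₁ t₂ t₃ => ω.2.1 r)
  · exact Measurable.mul_const (Measurable.inv (by fun_prop)) _

/-- By continuity the inequality need only be checked on a countable dense set. This makes the bad
events, which quantify over a subspace, measurable. -/
theorem measurableSet_forall_le {X Ω : Type*} [TopologicalSpace X]
    [TopologicalSpace.SeparableSpace X] [MeasurableSpace Ω] {f g : Ω → X → ℝ}
    (hf : ∀ x, Measurable fun ω => f ω x) (hg : ∀ x, Measurable fun ω => g ω x)
    (hf' : ∀ ω, Continuous (f ω)) (hg' : ∀ ω, Continuous (g ω)) :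
    MeasurableSet {ω | ∀ x, f ω x ≤ g ω x} := by
  obtain ⟨s, hs, hd⟩ := TopologicalSpace.exists_countable_dense X
  have e : {ω | ∀ x, f ω x ≤ g ω x} = ⋂ x ∈ s, {ω | f ω x ≤ g ω x} := by
    ext ω
    simp only [Set.mem_ofPred_eq, Set.mem_iInter]
    refine ⟨fun h x _ => h x, fun h x => ?_⟩
    have hc : IsClosed {x | f ω x ≤ g ω x} := isClosed_le (hf' ω) (hg' ω)
    have := hc.closure_subset_iff.2 (fun x hx => h x hx : s ⊆ _)
    rw [hd.closure_eq] at this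
    exact this (Set.mem_univ x)
  rw [e]
  exact MeasurableSet.biInter hs fun x _ => measurableSet_le (hf x) (hg x)

/-- The draws for which the sketch of the block distorts the range of `M` or the vector `y` too
much. -/
def badBlock (G : ℝ → ℝ) {q : ℕ} (M : Matrix (Fin n) (Fin q) ℝ) (y : Fin n → ℝ) (κ₁ κ₂ : ℝ) :
    Set (BlockDraw n t₁ t₂ t₃) :=
  {ω | ¬ ((∀ c, orliczNorm G (M *ᵥ c) ≤ κ₁ * ∑ u, |(ω.matrix *ᵥ (M *ᵥ c)) u|) ∧
    ∑ u, |(ω.matrix *ᵥ y) u| ≤ κ₂ * orliczNorm G y)}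

theorem measurableSet_badBlock {G : ℝ → ℝ} (hG : PropertyP G) {q : ℕ}
    (M : Matrix (Fin n) (Fin q) ℝ) (y : Fin n → ℝ) (κ₁ κ₂ : ℝ) :
    MeasurableSet (badBlock G M y κ₁ κ₂ : Set (BlockDraw n t₁ t₂ t₃)) := by
  have h1 : ∀ y : Fin n → ℝ,
      Measurable fun ω : BlockDraw n t₁ t₂ t₃ => ∑ u, |(ω.matrix *ᵥ y) u| := fun y =>
    Finset.measurable_sum _ fun u _ => (measurable_matrix_mulVec_apply y u).abs
  have hM : Continuous fun c : Fin q → ℝ => M *ᵥ c := Continuous.matrix_mulVec (by fun_prop)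
    (by fun_prop)
  refine MeasurableSet.compl (MeasurableSet.inter ?_ ?_)
  · refine measurableSet_forall_le (fun c => measurable_const) (fun c => (h1 _).const_mul _)
      (fun ω => hG.continuous_orliczNorm.comp hM) fun ω => ?_
    refine continuous_const.mul (continuous_finsetSum _ fun u _ => ?_)
    have : Continuous fun c : Fin q → ℝ => ω.matrix *ᵥ (M *ᵥ c) :=
      Continuous.matrix_mulVec (by fun_prop) hM
    exact ((continuous_apply u).comp this).abs
  · exact measurableSet_le (h1 y) measurable_const

/-- A union bound that reveals one factor first: off an exceptional set of the first coordinate all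
fibres are small. The exceptional set may be nonmeasurable and is replaced by its measurable hull.
-/
theorem measure_prod_le_of_fiber {α β : Type*} [MeasurableSpace α] [MeasurableSpace β]
    {μ : Measure α} {ν : Measure β} [IsProbabilityMeasure μ] [IsProbabilityMeasure ν]
    {s : Set (α × β)} (hs : MeasurableSet s) {A : Set α} {δ₁ δ₂ : ENNReal} (hA : μ A ≤ δ₁)
    (h : ∀ a ∉ A, ν (Prod.mk a ⁻¹' s) ≤ δ₂) : (μ.prod ν) s ≤ δ₁ + δ₂ := by
  rw [Measure.prod_apply hs]
  have h1 : ∀ a, ν (Prod.mk a ⁻¹' s) ≤ (toMeasurable μ A).indicator (fun _ => 1) a + δ₂ := by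
    intro a
    by_cases ha : a ∈ toMeasurable μ A
    · rw [Set.indicator_of_mem ha]
      exact prob_le_one.trans le_self_add
    · rw [Set.indicator_of_notMem ha, zero_add]
      exact h a fun hA => ha (subset_toMeasurable μ A hA)
  refine (lintegral_mono h1).trans ?_
  rw [lintegral_add_right _ measurable_const, lintegral_indicator_const
    (measurableSet_toMeasurable _ _), measure_toMeasurable, lintegral_const, measure_univ]
  rw [one_mul, mul_one]
  exact add_le_add hA le_rfl

theorem measure_prod_prod_le_of_fiber {α β γ : Type*} [MeasurableSpace α] [MeasurableSpace β]
    [MeasurableSpace γ] {μ : Measure α} {ν : Measure β} {ρ : Measure γ} [IsProbabilityMeasure μ]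
    [IsProbabilityMeasure ν] [IsProbabilityMeasure ρ] {s : Set (α × β × γ)}
    (hs : MeasurableSet s) {A : Set (α × β)} {δ₁ δ₂ : ENNReal} (hA : (μ.prod ν) A ≤ δ₁)
    (h : ∀ a ∉ A, ρ {c | (a.1, a.2, c) ∈ s} ≤ δ₂) : (μ.prod (ν.prod ρ)) s ≤ δ₁ + δ₂ := by
  have hp := measurePreserving_prodAssoc μ ν ρ
  rw [← hp.measure_preimage hs.nullMeasurableSet]
  exact measure_prod_le_of_fiber (hp.measurable hs) hA fun a ha => h a ha

theorem norm_toLp_sq (z : Fin n → ℝ) : ‖(WithLp.toLp 2 z : EuclideanSpace ℝ (Fin n))‖ ^ 2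
    = ∑ r, z r ^ 2 := by
  rw [EuclideanSpace.real_norm_sq_eq]

/-- The range of a linear map, as a subspace of Euclidean space. -/
def euclideanRange {q : ℕ} (f : (Fin q → ℝ) →ₗ[ℝ] (Fin n → ℝ)) :
    Submodule ℝ (EuclideanSpace ℝ (Fin n)) :=
  LinearMap.range ((WithLp.linearEquiv 2 ℝ (Fin n → ℝ)).symm.toLinearMap ∘ₗ f)

theorem finrank_euclideanRange_le {q : ℕ} (f : (Fin q → ℝ) →ₗ[ℝ] (Fin n → ℝ)) :
    Module.finrank ℝ (euclideanRange f) ≤ q := by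
  have := LinearMap.finrank_range_le ((WithLp.linearEquiv 2 ℝ (Fin n → ℝ)).symm.toLinearMap ∘ₗ f)
  rw [Module.finrank_fin_fun] at this
  exact this

theorem toLp_mem_euclideanRange {q : ℕ} (f : (Fin q → ℝ) →ₗ[ℝ] (Fin n → ℝ)) (c : Fin q → ℝ) :
    (WithLp.toLp 2 (f c) : EuclideanSpace ℝ (Fin n)) ∈ euclideanRange f :=
  ⟨c, rfl⟩

end Block

/-! ### Distortion of the sketch -/

section Distortion

variable {n t₁ t₂ t₃ : ℕ}

/-- The sparse embedding as a linear map. -/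
def sparseLin (σ : Fin n → Bool) (h : Fin n → Fin t₁) : (Fin n → ℝ) →ₗ[ℝ] (Fin t₁ → ℝ) where
  toFun := sparseMap σ h
  map_add' u v := by
    ext a; simp [sparseMap, mul_add, Finset.sum_add_distrib]
  map_smul' c v := by
    ext a
    simp only [sparseMap, Pi.smul_apply, smul_eq_mul, RingHom.id_apply, Finset.mul_sum]
    exact Finset.sum_congr rfl fun r _ => by ring

/-- The rescaled matrix `D⁻¹ M` as a linear map. -/
def rescaledLin {q : ℕ} (D : Fin n → ℝ) (M : Matrix (Fin n) (Fin q) ℝ) :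
    (Fin q → ℝ) →ₗ[ℝ] (Fin n → ℝ) :=
  (diagonal (fun r => (D r)⁻¹) * M).mulVecLin

theorem rescaledLin_apply {q : ℕ} (D : Fin n → ℝ) (M : Matrix (Fin n) (Fin q) ℝ)
    (c : Fin q → ℝ) : rescaledLin D M c = fun r => (D r)⁻¹ * (M *ᵥ c) r := by
  ext r
  rw [rescaledLin, mulVecLin_apply, ← mulVec_mulVec, mulVec_diagonal]

theorem one_le_sqrt_pi_div_two : 1 ≤ √(Real.pi / 2) := by
  rw [Real.one_le_sqrt]; linarith [Real.pi_gt_three]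

theorem sqrt_pi_div_two_le_two : √(Real.pi / 2) ≤ 2 := by
  rw [Real.sqrt_le_left (by norm_num)]; linarith [Real.pi_lt_four]

theorem sum_abs_sq_le {t : ℕ} (f : Fin t → ℝ) : (∑ i, |f i|) ^ 2 ≤ t * ∑ i, f i ^ 2 := by
  have := sq_sum_le_card_mul_sum_sq (s := Finset.univ) (f := fun i => |f i|)
  simpa using this

/-- The deterministic part: Π₁ distorts norms by at most 2, Π₂ by factors between 1/16 and 8, and B,
with √(π/2) in [1, 2], by factors between 1/16 and 16. Thus 512 = 2·16·16 and 256 = 2·8·16. -/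
theorem sketch_distortion (ω : BlockDraw n t₁ t₂ t₃) (ht₂ : 0 < t₂) (ht₃ : 0 < t₃)
    (y : Fin n → ℝ) (z : EuclideanSpace ℝ (Fin n)) (hz : z = WithLp.toLp 2 fun r => (ω.1 r)⁻¹ * y r)
    (h₁ : |∑ a, sparseMap ω.2.1 ω.2.2.1 z a ^ 2 - ‖z‖ ^ 2| ≤ 1 / 2 * ‖z‖ ^ 2)
    (w : EuclideanSpace ℝ (Fin t₁)) (hw : w = WithLp.toLp 2 (sparseMap ω.2.1 ω.2.2.1 z))
    (h₂ : (t₂ : ℝ) / 16 * ‖w‖ ≤ ∑ i, |∑ j, ω.2.2.2.1 i j * w j| ∧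
        ∑ i, (∑ j, ω.2.2.2.1 i j * w j) ^ 2 ≤ 64 * t₂ * ‖w‖ ^ 2)
    (h₃ : ∀ v : EuclideanSpace ℝ (Fin t₂), (t₃ : ℝ) / 16 * ‖v‖ ≤ ∑ i, |∑ j, ω.2.2.2.2 i j * v j| ∧
        ∑ i, (∑ j, ω.2.2.2.2 i j * v j) ^ 2 ≤ 64 * t₃ * ‖v‖ ^ 2) :
    ‖z‖ ≤ 512 * ∑ u, |(ω.matrix *ᵥ y) u| ∧ ∑ u, |(ω.matrix *ᵥ y) u| ≤ 256 * ‖z‖ := by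
  have ht₂' : (0 : ℝ) < t₂ := Nat.cast_pos.2 ht₂
  have ht₃' : (0 : ℝ) < t₃ := Nat.cast_pos.2 ht₃
  have hwn : ‖w‖ ^ 2 = ∑ a, sparseMap ω.2.1 ω.2.2.1 z a ^ 2 := by rw [hw, norm_toLp_sq]
  rw [← hwn, abs_le] at h₁
  have hzw : ‖z‖ ≤ 2 * ‖w‖ := by
    refine (abs_le_of_sq_le_sq' ?_ (by positivity)).2
    nlinarith [sq_nonneg ‖z‖]
  have hwz : ‖w‖ ≤ 2 * ‖z‖ := by
    refine (abs_le_of_sq_le_sq' ?_ (by positivity)).2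
    nlinarith [sq_nonneg ‖z‖]
  set x : EuclideanSpace ℝ (Fin t₂) :=
    WithLp.toLp 2 fun v => 1 / √t₂ * ∑ a, ω.2.2.2.1 v a * w a with hx
  have hxn : t₂ * ‖x‖ ^ 2 = ∑ i, (∑ j, ω.2.2.2.1 i j * w j) ^ 2 := by
    rw [hx, norm_toLp_sq, Finset.mul_sum]
    refine Finset.sum_congr rfl fun v _ => ?_
    rw [mul_pow, div_pow, Real.sq_sqrt ht₂'.le]
    field_simp
  have hxw : ‖x‖ ≤ 8 * ‖w‖ := by
    refine (abs_le_of_sq_le_sq' ?_ (by positivity)).2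
    refine le_of_mul_le_mul_left ?_ ht₂'
    rw [hxn]; linarith [h₂.2]
  -- The ℓ₁ lower bound for the Gaussian matrix yields an ℓ₂ lower bound through Cauchy–Schwarz.
  have hwx : ‖w‖ ≤ 16 * ‖x‖ := by
    have h4 := pow_le_pow_left₀ (by positivity) h₂.1 2
    have h5 := h4.trans (sum_abs_sq_le _)
    rw [← hxn] at h5
    refine (abs_le_of_sq_le_sq' ?_ (by positivity)).2
    refine le_of_mul_le_mul_left ?_ (mul_pos ht₂' ht₂')
    nlinarith
  have hs : ∑ u, |(ω.matrix *ᵥ y) u| = √(Real.pi / 2) / t₃ * ∑ i, |∑ j, ω.2.2.2.2 i j * x j| := by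
    rw [Finset.mul_sum]
    refine Finset.sum_congr rfl fun u _ => ?_
    rw [BlockDraw.matrix_mulVec_apply, abs_mul, abs_of_nonneg (by positivity), hx, hw, hz]
  have hπ1 := one_le_sqrt_pi_div_two
  have hπ2 := sqrt_pi_div_two_le_two
  obtain ⟨h6, h7⟩ := h₃ x
  constructor
  · have h8 : ‖x‖ ≤ 16 * ∑ u, |(ω.matrix *ᵥ y) u| := by
      rw [hs, div_mul_eq_mul_div, mul_div_assoc', le_div_iff₀ ht₃']
      nlinarith [norm_nonneg x, mul_nonneg ht₃'.le (norm_nonneg x)]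
    linarith
  · have h8 : ∑ i, |∑ j, ω.2.2.2.2 i j * x j| ≤ 8 * t₃ * ‖x‖ := by
      refine (abs_le_of_sq_le_sq' ((sum_abs_sq_le _).trans ?_) (by positivity)).2
      nlinarith
    have h9 : ∑ u, |(ω.matrix *ᵥ y) u| ≤ 16 * ‖x‖ := by
      rw [hs, div_mul_eq_mul_div, div_le_iff₀ ht₃']
      calc √(Real.pi / 2) * ∑ i, |∑ j, ω.2.2.2.2 i j * x j| ≤ 2 * (8 * t₃ * ‖x‖) := by gcongr
        _ = 16 * ‖x‖ * t₃ := by ring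
    linarith

theorem isProbabilityMeasure_blockLaw {ν : Measure ℝ} [IsProbabilityMeasure ν] [NeZero t₁] :
    IsProbabilityMeasure (blockLaw ν n t₁ t₂ t₃) := by
  unfold blockLaw; infer_instance

/-- The draws are revealed in turn, so each embedding acts on a subspace fixed by the earlier ones.
The five δ's are two for D and one each for the signs and hash values, Π₂ and B. C₁ and ℓ are chosen
before G, so the sketch sizes do not depend on G; only C₂ does. -/
theorem measure_badBlock_le {δ : ℝ} (hδ : 0 < δ) :
    ∃ C₁ : ℝ, 0 < C₁ ∧ ∃ ℓ : ℕ, ∀ G : ℝ → ℝ, PropertyP G → ∃ C₂ : ℝ, 0 < C₂ ∧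
      ∀ ν : Measure ℝ, HasOrliczCDF G ν → ∀ n m q t₁ t₂ t₃ : ℕ, n ≤ m → 2 ≤ m → 1 ≤ q →
        8 * (q : ℝ) ^ 2 ≤ δ * t₁ → 9 * q + ℓ + 1 ≤ t₂ → 9 * t₂ + ℓ + 1 ≤ t₃ →
        ∀ (M : Matrix (Fin n) (Fin q) ℝ) (c₀ : Fin q → ℝ),
          blockLaw ν n t₁ t₂ t₃ (badBlock G M (M *ᵥ c₀) (C₁ * q * Real.log m) (C₂ * Real.log m))
            ≤ ENNReal.ofReal (5 * δ) := by
  obtain ⟨C₁, hC₁, hlow⟩ := rescaling_lower hδ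
  obtain ⟨ℓ, hℓ⟩ := exists_pow_lt_of_lt_one hδ (by norm_num : (1 / 2 : ℝ) < 1)
  refine ⟨512 * C₁, by positivity, ℓ, fun G hG => ?_⟩
  obtain ⟨C₂, hC₂, hupp⟩ := rescaling_upper hG hδ
  refine ⟨256 * √(2 * C₂), by positivity, ?_⟩
  intro ν hν n m q t₁ t₂ t₃ hnm hm hq ht₁ ht₂ ht₃ M c₀
  have := hν.1
  have ht₁' : (0 : ℝ) < t₁ := by
    have : (1 : ℝ) ≤ q := by exact_mod_cast hq
    by_contra! h
    nlinarith
  have : NeZero t₁ := ⟨fun h => by simp [h] at ht₁'⟩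
  have hlog : Real.log 2 ≤ Real.log m := Real.log_le_log (by norm_num) (by exact_mod_cast hm)
  have hlog2 := Real.log_two_gt_d9
  have hmeas := measurableSet_badBlock (t₁ := t₁) (t₂ := t₂) (t₃ := t₃) hG M (M *ᵥ c₀)
    (512 * C₁ * q * Real.log m) (256 * √(2 * C₂) * Real.log m)
  set bad : Set (BlockDraw n t₁ t₂ t₃) := badBlock G M (M *ᵥ c₀)
    (512 * C₁ * q * Real.log m) (256 * √(2 * C₂) * Real.log m) with hbad
  have e5 : ENNReal.ofReal (5 * δ) = (ENNReal.ofReal δ + ENNReal.ofReal δ) +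
      (ENNReal.ofReal δ + (ENNReal.ofReal δ + ENNReal.ofReal δ)) := by
    rw [← ENNReal.ofReal_add hδ.le hδ.le, ← ENNReal.ofReal_add hδ.le (by positivity),
      ← ENNReal.ofReal_add (by positivity) (by positivity)]
    congr 1; ring
  rw [e5]
  have hhalf : ENNReal.ofReal ((1 / 2) ^ ℓ) ≤ ENNReal.ofReal δ := ENNReal.ofReal_le_ofReal hℓ.le
  have hrank : Module.finrank ℝ (LinearMap.range M.mulVecLin) ≤ q := by
    have := LinearMap.finrank_range_le M.mulVecLin
    rw [Module.finrank_fin_fun] at this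
    exact this
  refine measure_prod_le_of_fiber hmeas ((measure_union_le _ _).trans (add_le_add
    (hlow G ν hG hν n m q hnm hm hq (LinearMap.range M.mulVecLin) hrank)
    (hupp ν hν n m hnm hm (M *ᵥ c₀)))) fun D hD => ?_
  simp only [Set.mem_union, not_or, Set.mem_ofPred_eq, not_not] at hD
  refine measure_prod_prod_le_of_fiber (measurable_prodMk_left hmeas)
    ((sparse_embedding (t := t₁) (euclideanRange (rescaledLin D M))
      (finrank_euclideanRange_le _)).trans (ENNReal.ofReal_le_ofReal
        ((div_le_iff₀ ht₁').2 ht₁))) fun p hp => ?_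
  simp only [Set.mem_ofPred_eq, not_not] at hp
  have hmeas₂ : MeasurableSet {c | (p.1, p.2, c) ∈ Prod.mk D ⁻¹' bad} :=
    (measurable_prodMk_left (x := p.2)) ((measurable_prodMk_left (x := p.1))
      ((measurable_prodMk_left (x := D)) hmeas))
  refine measure_prod_le_of_fiber hmeas₂ ((gaussian_embedding (ℓ := ℓ) (t := t₂)
    (euclideanRange (sparseLin p.1 p.2 ∘ₗ rescaledLin D M))
    (finrank_euclideanRange_le _) ht₂).trans hhalf) fun g hg => ?_
  simp only [Set.mem_ofPred_eq, not_not] at hg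
  -- B is required to embed all of ℝ^{t₂}, which has dimension only t₂; hence the condition t₃ ≥ 9t₂
  -- + ℓ + 1.
  refine le_trans (measure_mono ?_) ((gaussian_embedding (ℓ := ℓ) (t := t₃) (q := t₂)
    (⊤ : Submodule ℝ (EuclideanSpace ℝ (Fin t₂))) (by simp) ht₃).trans hhalf)
  intro Q hQ hQ'
  refine hQ ?_
  have key : ∀ c, ‖rescaledLin D M c‖ ≤
        512 * ∑ u, |((show BlockDraw n t₁ t₂ t₃ from (D, p.1, p.2, g, Q)).matrix *ᵥ (M *ᵥ c)) u| ∧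
      ∑ u, |((show BlockDraw n t₁ t₂ t₃ from (D, p.1, p.2, g, Q)).matrix *ᵥ (M *ᵥ c)) u| ≤
        256 * √(∑ r, ((D r)⁻¹ * (M *ᵥ c) r) ^ 2) := fun c => by
    have h := sketch_distortion (show BlockDraw n t₁ t₂ t₃ from (D, p.1, p.2, g, Q)) (by omega)
      (by omega) (M *ᵥ c) (WithLp.toLp 2 (rescaledLin D M c)) (by rw [rescaledLin_apply])
      (hp _ (toLp_mem_euclideanRange _ c)) _ rfl (hg _ (toLp_mem_euclideanRange
        (sparseLin p.1 p.2 ∘ₗ rescaledLin D M) c)) fun v => hQ' v trivial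
    refine ⟨le_trans ?_ h.1, h.2.trans (le_of_eq ?_)⟩
    · rw [pi_norm_le_iff_of_nonneg (norm_nonneg _)]
      intro r
      exact PiLp.norm_apply_le (WithLp.toLp 2 (rescaledLin D M c) : EuclideanSpace ℝ (Fin n)) r
    · congr 1
      refine (Real.sqrt_eq_iff_mul_self_eq (by positivity) (norm_nonneg _)).2 ?_ |>.symm
      rw [← sq, norm_toLp_sq, rescaledLin_apply]
  constructor
  · intro c
    have h1 := hD.1 (M *ᵥ c) ⟨c, rfl⟩
    have h2 := (key c).1
    rw [rescaledLin_apply] at h2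
    refine h1.trans ?_
    have h3 : 0 ≤ C₁ * q * Real.log m := by
      have : 0 ≤ Real.log m := by linarith
      positivity
    calc _ ≤ C₁ * q * Real.log m * _ := mul_le_mul_of_nonneg_left h2 h3
      _ = _ := by ring
  · refine (key c₀).2.trans ?_
    have h1 : √(∑ r, ((D r)⁻¹ * (M *ᵥ c₀) r) ^ 2)
        ≤ √(2 * C₂) * Real.log m * orliczNorm G (M *ᵥ c₀) := by
      rw [Real.sqrt_le_left (mul_nonneg (mul_nonneg (by positivity) (by linarith))
        (orliczNorm_nonneg _ _)), mul_pow, mul_pow, Real.sq_sqrt (by positivity)]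
      refine hD.2.trans ?_
      refine mul_le_mul_of_nonneg_right ?_ (sq_nonneg _)
      -- The rescaling gives the factor √(C₂ log m), and log m ≥ 1/2 turns it into √(2C₂) log m.
      have : (1 / 2 : ℝ) ≤ Real.log m := by linarith
      have h4 : 0 ≤ C₂ * Real.log m := by nlinarith
      nlinarith
    linarith

end Distortion

/-! ### The good event -/

section GoodEvent

/-- All residuals lie in the span of the d + 1 columns of [A b], so a linear subspace estimate
covers the affine problem. -/
theorem augment_mulVec {n d : ℕ} (A : Matrix (Fin n) (Fin d) ℝ) (b : Fin n → ℝ) (x : Fin d → ℝ) :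
    augment A b *ᵥ (Fin.snoc x (-1) : Fin (d + 1) → ℝ) = A *ᵥ x - b := by
  ext r
  simp only [augment, mulVec, dotProduct, Fin.sum_univ_castSucc, of_apply, Fin.snoc_castSucc,
    Fin.snoc_last, Pi.sub_apply]
  ring

/-- Sandwich between the lower estimate for every residual and the upper estimate for one optimal
residual. The factor 2 in the hypothesis admits exact minimisers and (1 + ε)-approximate ones with ε
≤ 1 alike. -/
theorem exists_good_event {k : ℕ} (hk : 0 < k) :
    ∃ c : ℝ, 0 < c ∧ ∀ G : Fin k → ℝ → ℝ, (∀ i, PropertyP (G i)) → ∃ β : ℝ, 0 < β ∧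
      ∀ (d : ℕ) (n : Fin k → ℕ), 1 ≤ d → 2 ≤ ∑ i, n i →
      ∀ (A : (i : Fin k) → Matrix (Fin (n i)) (Fin d) ℝ) (b : (i : Fin k) → Fin (n i) → ℝ)
        (t₁ t₂ t₃ : ℕ),
      c * (d : ℝ) ^ 2 ≤ t₁ → c * (d : ℝ) ≤ t₂ → c * (t₂ * Real.log t₂) ≤ t₃ →
      ∀ ν : Fin k → Measure ℝ, (∀ i, HasOrliczCDF (G i) (ν i)) →
      ∃ E : Set (Draw n t₁ t₂ t₃), MeasurableSet E ∧ 0.7 ≤ (drawLaw ν n t₁ t₂ t₃).real E ∧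
        ∀ ω ∈ E, ∀ xhat, (∀ x, sketchedLoss ω A b xhat ≤ 2 * sketchedLoss ω A b x) →
          ∀ x, loss G A b xhat
            ≤ β * d * Real.log ((∑ i, n i : ℕ) : ℝ) ^ 2 * loss G A b x := by
  have hk' : (0 : ℝ) < k := Nat.cast_pos.2 hk
  -- Chosen so that k blocks, each failing with probability at most 5δ, give k · 5δ = 0.3.
  set δ : ℝ := 3 / (50 * k) with hδ
  have hδ0 : 0 < δ := by positivity
  obtain ⟨C₁, hC₁, ℓ, hblock⟩ := measure_badBlock_le hδ0
  -- The term 32/δ serves t₁, as 8(d + 1)² ≤ 32d². The rest serves t₂ ≥ 9(d + 1) + ℓ + 1 and t₃ ≥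
  -- 9t₂ + ℓ + 1, where log t₂ ≥ 1/2 costs another factor 2.
  refine ⟨32 / δ + 40 + 2 * ℓ, by positivity, fun G hG => ?_⟩
  choose C₂ hC₂ hbl using fun i => hblock (G i) (hG i)
  have hC₂pos : 0 < ∑ i, C₂ i := Finset.sum_pos (fun i _ => hC₂ i) ⟨⟨0, hk⟩, Finset.mem_univ _⟩
  refine ⟨4 * C₁ * ∑ i, C₂ i, by positivity, ?_⟩
  intro d n hd hn A b t₁ t₂ t₃ ht₁ ht₂ ht₃ ν hν
  set m := ∑ i, n i with hm
  have hd' : (1 : ℝ) ≤ d := by exact_mod_cast hd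
  have hℓ0 : (0 : ℝ) ≤ ℓ := Nat.cast_nonneg ℓ
  have hδinv : 0 < 32 / δ := by positivity
  have h1 : 8 * ((d + 1 : ℕ) : ℝ) ^ 2 ≤ δ * t₁ := by
    have h2 : 32 / δ * (d : ℝ) ^ 2 ≤ t₁ := by nlinarith [sq_nonneg (d : ℝ)]
    rw [div_mul_eq_mul_div, div_le_iff₀ hδ0] at h2
    push_cast
    nlinarith
  have h2 : 9 * (d + 1) + ℓ + 1 ≤ t₂ := by
    have : ((9 * (d + 1) + ℓ + 1 : ℕ) : ℝ) ≤ t₂ := by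
      push_cast
      nlinarith [mul_nonneg hℓ0 (by linarith : (0 : ℝ) ≤ d - 1)]
    exact_mod_cast this
  have h3 : 9 * t₂ + ℓ + 1 ≤ t₃ := by
    have ht2 : (2 : ℝ) ≤ t₂ := by
      have : 2 ≤ t₂ := by omega
      exact_mod_cast this
    have hl : (1 / 2 : ℝ) ≤ Real.log t₂ := by
      have h4 := Real.log_le_log (by norm_num) ht2
      have h5 := Real.log_two_gt_d9
      linarith
    have : ((9 * t₂ + ℓ + 1 : ℕ) : ℝ) ≤ t₃ := by
      push_cast
      have h6 : (t₂ : ℝ) * (1 / 2) ≤ t₂ * Real.log t₂ := by gcongr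
      nlinarith [mul_nonneg hℓ0 (by linarith : (0 : ℝ) ≤ (t₂ : ℝ) - 1)]
    exact_mod_cast this
  have hlog : 0 < Real.log m := Real.log_pos (by exact_mod_cast (by omega : 1 < m))
  -- The minimiser is fixed before the draws, so the upper estimate is needed for a deterministic
  -- vector only.
  obtain ⟨xs, hxs⟩ := exists_minimizer_loss hG A b
  let κ₁ : ℝ := C₁ * (d + 1 : ℕ) * Real.log m
  let bad : (i : Fin k) → Set (BlockDraw (n i) t₁ t₂ t₃) := fun i =>
    badBlock (G i) (augment (A i) (b i))
      (augment (A i) (b i) *ᵥ (Fin.snoc xs (-1) : Fin (d + 1) → ℝ)) κ₁ (C₂ i * Real.log m)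
  have hbadm : ∀ i, MeasurableSet (bad i) := fun i => measurableSet_badBlock (hG i) _ _ _ _
  have hP : ∀ i, blockLaw (ν i) (n i) t₁ t₂ t₃ (bad i) ≤ ENNReal.ofReal (5 * δ) := fun i =>
    hbl i (ν i) (hν i) (n i) m (d + 1) t₁ t₂ t₃
      (Finset.single_le_sum (f := n) (fun _ _ => Nat.zero_le _) (Finset.mem_univ i)) hn (by omega)
      h1 h2 h3 _ _
  have : ∀ i, IsProbabilityMeasure (ν i) := fun i => (hν i).1
  have : NeZero t₁ := ⟨fun h => by
    rw [h] at h1; push_cast at h1; nlinarith⟩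
  have : ∀ i, IsProbabilityMeasure (blockLaw (ν i) (n i) t₁ t₂ t₃) := fun i =>
    isProbabilityMeasure_blockLaw
  have : IsProbabilityMeasure (drawLaw ν n t₁ t₂ t₃) := by unfold drawLaw; infer_instance
  let Ebad : Set (Draw n t₁ t₂ t₃) := ⋃ i ∈ Finset.univ, {ω | ω i ∈ bad i}
  have hEm : MeasurableSet Ebad :=
    Finset.measurableSet_biUnion _ fun i _ => measurable_pi_apply i (hbadm i)
  refine ⟨Ebadᶜ, hEm.compl, ?_, ?_⟩
  · rw [probReal_compl_eq_one_sub hEm]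
    have h4 : (drawLaw ν n t₁ t₂ t₃).real Ebad ≤ ∑ _i : Fin k, 5 * δ := by
      refine (measureReal_biUnion_finset_le _ _).trans (Finset.sum_le_sum fun i _ => ?_)
      have hp := measurePreserving_eval (fun i => blockLaw (ν i) (n i) t₁ t₂ t₃) i
      have h5 : (drawLaw ν n t₁ t₂ t₃) {ω | ω i ∈ bad i} = blockLaw (ν i) (n i) t₁ t₂ t₃ (bad i) := by
        rw [← hp.measure_preimage (hbadm i).nullMeasurableSet]; rfl
      rw [measureReal_def, h5]
      exact (ENNReal.le_ofReal_iff_toReal_le (measure_ne_top _ _) (by positivity)).1 (hP i)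
    have h6 : ∑ _i : Fin k, 5 * δ = 0.3 := by
      rw [Finset.sum_const, Finset.card_univ, Fintype.card_fin, nsmul_eq_mul, hδ]
      field_simp; norm_num
    rw [h6] at h4
    norm_num at h4 ⊢
    linarith
  · intro ω hω xhat hxhat x
    have hgood : ∀ i, (∀ c, orliczNorm (G i) (augment (A i) (b i) *ᵥ c)
          ≤ κ₁ * ∑ u, |((ω i).matrix *ᵥ (augment (A i) (b i) *ᵥ c)) u|) ∧
        ∑ u, |((ω i).matrix *ᵥ (A i *ᵥ xs - b i)) u|
          ≤ C₂ i * Real.log m * orliczNorm (G i) (A i *ᵥ xs - b i) := fun i => by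
      by_contra hcon
      refine hω (Set.mem_biUnion (Finset.mem_univ i) ?_)
      rw [← augment_mulVec] at hcon
      exact hcon
    have hκ₁ : 0 ≤ κ₁ := by positivity
    have hup : loss G A b xhat ≤ κ₁ * sketchedLoss ω A b xhat := by
      rw [sketchedLoss_eq, Finset.mul_sum, loss]
      refine Finset.sum_le_sum fun i _ => ?_
      have := (hgood i).1 (Fin.snoc xhat (-1))
      rwa [augment_mulVec] at this
    have hlo : sketchedLoss ω A b xs ≤ (∑ i, C₂ i) * Real.log m * loss G A b xs := by
      rw [sketchedLoss_eq, Finset.sum_mul, loss, Finset.mul_sum]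
      refine Finset.sum_le_sum fun i _ => (hgood i).2.trans ?_
      refine mul_le_mul_of_nonneg_right ?_ (orliczNorm_nonneg _ _)
      rw [← Finset.sum_mul]
      refine mul_le_mul_of_nonneg_right ?_ hlog.le
      exact Finset.single_le_sum (f := C₂) (fun i _ => (hC₂ i).le) (Finset.mem_univ i)
    have hκ : κ₁ ≤ 2 * C₁ * d * Real.log m := by
      simp only [κ₁]; push_cast
      refine mul_le_mul_of_nonneg_right ?_ hlog.le
      nlinarith
    have hl0 : 0 ≤ loss G A b xs := Finset.sum_nonneg fun i _ => orliczNorm_nonneg _ _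
    have hD0 : 0 ≤ (∑ i, C₂ i) * Real.log m := by positivity
    calc loss G A b xhat ≤ κ₁ * sketchedLoss ω A b xhat := hup
      _ ≤ κ₁ * (2 * sketchedLoss ω A b xs) := by gcongr; exact hxhat xs
      _ ≤ κ₁ * (2 * ((∑ i, C₂ i) * Real.log m * loss G A b xs)) := by gcongr
      _ ≤ (2 * C₁ * d * Real.log m) * (2 * ((∑ i, C₂ i) * Real.log m * loss G A b xs)) := by
        gcongr
      _ = 4 * C₁ * (∑ i, C₂ i) * d * Real.log m ^ 2 * loss G A b xs := by ring
      _ ≤ 4 * C₁ * (∑ i, C₂ i) * d * Real.log m ^ 2 * loss G A b x := by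
        gcongr; exact hxs x

end GoodEvent

/-! ### Orthonormalisation -/

section GramSchmidt

variable {ι : Type*} [Fintype ι] {d : ℕ}

/-- The state of the Gram–Schmidt process for the columns of `A` after `j` steps: the columns of
`U = A R` are orthogonal, of norm `0` or `1`, and span the first `j` columns of `A`. -/
structure GramSchmidt (A : ι → Fin d → ℝ) (j : ℕ) (U : ι → Fin d → ℝ) (R : Fin d → Fin d → ℝ) :
    Prop where
  eq_mul : ∀ p l, U p l = ∑ q, A p q * R q l
  orthogonal : ∀ l l', l ≠ l' → ∑ p, U p l * U p l' = 0
  norm : ∀ l, ∑ p, U p l * U p l = 0 ∨ ∑ p, U p l * U p l = 1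
  span : ∀ l : Fin d, l.val < j → ∃ T : Fin d → ℝ, ∀ p, A p l = ∑ m, U p m * T m
  zero : ∀ l : Fin d, j ≤ l.val → ∀ p, U p l = 0
  zero' : ∀ l : Fin d, j ≤ l.val → ∀ q, R q l = 0

theorem GramSchmidt.init (A : ι → Fin d → ℝ) : GramSchmidt A 0 (fun _ _ => 0) (fun _ _ => 0) where
  eq_mul := by simp
  orthogonal := by simp
  norm := by simp
  span := by simp
  zero := by simp
  zero' := by simp

theorem sum_mul_eq_zero_of_sum_mul_self {U : ι → ℝ} (h : ∑ p, U p * U p = 0) (p : ι) : U p = 0 := by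
  have := (Finset.sum_eq_zero_iff_of_nonneg (fun p _ => mul_self_nonneg (U p))).1 h p
    (Finset.mem_univ p)
  exact mul_self_eq_zero.1 this

variable {A : ι → Fin d → ℝ} {j : ℕ} {U : ι → Fin d → ℝ} {R : Fin d → Fin d → ℝ}

/-- Subtracting the projection makes a vector orthogonal to the columns of `U`. -/
theorem GramSchmidt.residual_orthogonal (h : GramSchmidt A j U R) (y : ι → ℝ) (l : Fin d) :
    ∑ p, U p l * (y p - ∑ m, U p m * ∑ p', U p' m * y p') = 0 := by
  have h1 : ∑ p, U p l * ∑ m, U p m * ∑ p', U p' m * y p' = ∑ p', U p' l * y p' := by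
    simp only [Finset.mul_sum Finset.univ (fun m => U _ m * _), ← mul_assoc]
    rw [Finset.sum_comm]
    simp only [← Finset.sum_mul]
    rw [Finset.sum_eq_single l]
    · rcases h.norm l with h0 | h1
      · have := sum_mul_eq_zero_of_sum_mul_self h0
        simp [this]
      · rw [h1, one_mul]
    · intro m _ hm
      rw [h.orthogonal l m hm.symm, zero_mul]
    · simp
  simp only [mul_sub, Finset.sum_sub_distrib, h1, sub_self]

/-- For a column depending on the earlier ones, the residual and N vanish, and division by zero
makes the new column of U zero. No rank assumption or pivoting is needed; this is why norms 0 are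
allowed. -/
theorem GramSchmidt.step (h : GramSchmidt A j U R) (hj : j < d) {c : Fin d → ℝ} {v : ι → ℝ}
    {w : Fin d → ℝ} {N : ℝ}
    (hc : ∀ l, c l = ∑ p, U p l * A p ⟨j, hj⟩) (hv : ∀ p, v p = A p ⟨j, hj⟩ - ∑ l, U p l * c l)
    (hw : ∀ q, w q = (if q = ⟨j, hj⟩ then 1 else 0) - ∑ l, R q l * c l)
    (hN : N = √(∑ p, v p * v p)) {U' : ι → Fin d → ℝ} {R' : Fin d → Fin d → ℝ}
    (hU' : ∀ p l, U' p l = if l = ⟨j, hj⟩ then v p / N else U p l)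
    (hR' : ∀ q l, R' q l = if l = ⟨j, hj⟩ then w q / N else R q l) :
    GramSchmidt A (j + 1) U' R' := by
  have hU0 : ∀ p, U p ⟨j, hj⟩ = 0 := h.zero ⟨j, hj⟩ le_rfl
  have horth : ∀ l, ∑ p, U p l * v p = 0 := fun l => by
    have := h.residual_orthogonal (fun p => A p ⟨j, hj⟩) l
    simp only [← hc] at this
    simp only [hv]; exact this
  have hN0 : N = 0 → ∀ p, v p = 0 := fun h0 => by
    rw [hN, Real.sqrt_eq_zero (Finset.sum_nonneg fun p _ => mul_self_nonneg _)] at h0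
    exact sum_mul_eq_zero_of_sum_mul_self h0
  -- Holds for N = 0 as well, since then v = 0.
  have hvN : ∀ p, N * (v p / N) = v p := fun p => by
    by_cases h0 : N = 0
    · simp [h0, hN0 h0 p]
    · field_simp
  have hUeq : ∀ p m, m ≠ ⟨j, hj⟩ → U' p m = U p m := fun p m hm => by rw [hU', if_neg hm]
  have hUj : ∀ p, U' p ⟨j, hj⟩ = v p / N := fun p => by rw [hU', if_pos rfl]
  refine ⟨?_, ?_, ?_, ?_, ?_, ?_⟩
  · intro p l
    by_cases hl : l = ⟨j, hj⟩
    · subst hl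
      simp only [hU', hR', if_true]
      rw [hv]
      simp only [hw, mul_div_assoc', ← Finset.sum_div]
      congr 1
      simp only [mul_sub, Finset.sum_sub_distrib]
      simp only [mul_ite, mul_one, mul_zero, Finset.sum_ite_eq', Finset.mem_univ, if_true]
      congr 1
      simp only [h.eq_mul, Finset.sum_mul, Finset.mul_sum]
      rw [Finset.sum_comm]
      exact Finset.sum_congr rfl fun _ _ => Finset.sum_congr rfl fun _ _ => by ring
    · simp only [hU', hR', if_neg hl, h.eq_mul]
  · intro l l' hll
    by_cases hl : l = ⟨j, hj⟩
    · have hl' : l' ≠ ⟨j, hj⟩ := fun e => hll (hl.trans e.symm)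
      simp only [hU', if_pos hl, if_neg hl', div_mul_eq_mul_div, ← Finset.sum_div]
      rw [div_eq_zero_iff]; left
      rw [← horth l']
      exact Finset.sum_congr rfl fun p _ => mul_comm _ _
    · by_cases hl' : l' = ⟨j, hj⟩
      · simp only [hU', if_neg hl, if_pos hl', mul_div_assoc', ← Finset.sum_div, horth, zero_div]
      · simp only [hU', if_neg hl, if_neg hl']; exact h.orthogonal l l' hll
  · intro l
    by_cases hl : l = ⟨j, hj⟩
    · simp only [hU', if_pos hl, div_mul_div_comm, ← Finset.sum_div]
      have hNN : N * N = ∑ p, v p * v p := by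
        rw [hN, Real.mul_self_sqrt (Finset.sum_nonneg fun p _ => mul_self_nonneg _)]
      rw [← hNN]
      by_cases h0 : N = 0
      · left; simp [h0]
      · right; field_simp
    · simp only [hU', if_neg hl]; exact h.norm l
  · intro l hl
    by_cases hlj : l = ⟨j, hj⟩
    -- The new column of A is N times the new column of U plus the projection with coefficients c.
    · refine ⟨fun m => if m = ⟨j, hj⟩ then N else c m, fun p => ?_⟩
      have e1 : ∀ m, U' p m * (if m = ⟨j, hj⟩ then N else c m)
          = (if m = ⟨j, hj⟩ then v p else 0) + U p m * c m := fun m => by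
        by_cases hm : m = ⟨j, hj⟩
        · rw [if_pos hm, if_pos hm, hm, hUj, hU0, mul_comm, hvN]; ring
        · rw [if_neg hm, if_neg hm, hUeq p m hm, zero_add]
      simp only [e1, Finset.sum_add_distrib, Finset.sum_ite_eq', Finset.mem_univ, if_true]
      rw [hlj, hv]; ring
    · have : l.val < j := by
        have : l.val ≠ j := fun e => hlj (Fin.ext e)
        omega
      obtain ⟨T, hT⟩ := h.span l this
      refine ⟨fun m => if m = ⟨j, hj⟩ then 0 else T m, fun p => ?_⟩
      rw [hT]
      refine Finset.sum_congr rfl fun m _ => ?_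
      dsimp only
      by_cases hm : m = ⟨j, hj⟩
      · rw [if_pos hm, hm, hU0]; ring
      · rw [if_neg hm, hUeq p m hm]
  · intro l hl p
    have hlj : l ≠ ⟨j, hj⟩ := fun e => by rw [e] at hl; simp at hl
    rw [hUeq p l hlj]; exact h.zero l (by omega) p
  · intro l hl q
    have hlj : l ≠ ⟨j, hj⟩ := fun e => by rw [e] at hl; simp at hl
    rw [hR', if_neg hlj]; exact h.zero' l (by omega) q

/-- The range of `A` is parametrised by `U`. -/
theorem GramSchmidt.exists_coord (h : GramSchmidt A d U R) (x : Fin d → ℝ) :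
    ∃ z : Fin d → ℝ, ∀ p, ∑ l, A p l * x l = ∑ l, U p l * z l := by
  choose T hT using fun l : Fin d => h.span l l.2
  refine ⟨fun m => ∑ l, T l m * x l, fun p => ?_⟩
  simp only [hT, Finset.sum_mul, Finset.mul_sum]
  rw [Finset.sum_comm]
  exact Finset.sum_congr rfl fun _ _ => Finset.sum_congr rfl fun _ _ => by ring

theorem GramSchmidt.mul_eq (h : GramSchmidt A j U R) (z : Fin d → ℝ) (p : ι) :
    ∑ q, A p q * ∑ l, R q l * z l = ∑ l, U p l * z l := by
  simp only [h.eq_mul, Finset.sum_mul, Finset.mul_sum]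
  rw [Finset.sum_comm]
  exact Finset.sum_congr rfl fun _ _ => Finset.sum_congr rfl fun _ _ => by ring

end GramSchmidt

/-! ### The ellipsoid method for `ℓ₁` regression -/

section Ellipsoid

variable {ι : Type*} [Fintype ι] {d : ℕ}

/-- The objective `‖U z - r‖₁`. -/
def l1Loss (U : ι → Fin d → ℝ) (r : ι → ℝ) (z : Fin d → ℝ) : ℝ :=
  ∑ p, |∑ l, U p l * z l - r p|

/-- The columns of `U` are orthogonal of norm `0` or `1`, and orthogonal to `r`. -/
structure OrthoPair (U : ι → Fin d → ℝ) (r : ι → ℝ) : Prop where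
  orthogonal : ∀ l l', l ≠ l' → ∑ p, U p l * U p l' = 0
  norm : ∀ l, ∑ p, U p l * U p l = 0 ∨ ∑ p, U p l * U p l = 1
  residual : ∀ l, ∑ p, U p l * r p = 0

variable {U : ι → Fin d → ℝ} {r : ι → ℝ}

theorem l1Loss_nonneg (z : Fin d → ℝ) : 0 ≤ l1Loss U r z := Finset.sum_nonneg fun _ _ => abs_nonneg _

theorem l1Loss_zero : l1Loss U r 0 = ∑ p, |r p| := by simp [l1Loss]

theorem sum_sq_le_sq_sum_abs (y : ι → ℝ) : ∑ p, y p ^ 2 ≤ (∑ p, |y p|) ^ 2 := by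
  have := Finset.sum_sq_le_sq_sum_of_nonneg (s := Finset.univ) (f := fun p => |y p|)
    (fun p _ => abs_nonneg _)
  simpa using this

theorem sq_sum_abs_le (y : ι → ℝ) : (∑ p, |y p|) ^ 2 ≤ Fintype.card ι * ∑ p, y p ^ 2 := by
  have := sq_sum_le_card_mul_sum_sq (s := Finset.univ) (f := fun p => |y p|)
  simpa using this

namespace OrthoPair


theorem sum_sq (h : OrthoPair U r) (z : Fin d → ℝ) :
    ∑ p, (∑ l, U p l * z l) ^ 2 = ∑ l, (∑ p, U p l * U p l) * z l ^ 2 := by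
  simp only [sq, Finset.sum_mul_sum]
  rw [Finset.sum_comm]
  refine Finset.sum_congr rfl fun l _ => ?_
  rw [Finset.sum_comm, Finset.sum_eq_single l]
  · rw [Finset.sum_mul]; exact Finset.sum_congr rfl fun p _ => by ring
  · intro l' _ hl'
    have := h.orthogonal l l' hl'.symm
    calc _ = (∑ p, U p l * U p l') * (z l * z l') := by
          rw [Finset.sum_mul]; exact Finset.sum_congr rfl fun p _ => by ring
      _ = 0 := by rw [this, zero_mul]
  · simp

theorem sum_sq_le (h : OrthoPair U r) (z : Fin d → ℝ) :
    ∑ p, (∑ l, U p l * z l) ^ 2 ≤ ∑ l, z l ^ 2 := by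
  rw [h.sum_sq]
  refine Finset.sum_le_sum fun l _ => ?_
  rcases h.norm l with h0 | h0 <;> rw [h0]
  · rw [zero_mul]; positivity
  · rw [one_mul]

theorem pythagoras (h : OrthoPair U r) (z : Fin d → ℝ) :
    ∑ p, (∑ l, U p l * z l - r p) ^ 2 = ∑ p, (∑ l, U p l * z l) ^ 2 + ∑ p, r p ^ 2 := by
  have h1 : ∑ p, (∑ l, U p l * z l) * r p = 0 := by
    simp only [Finset.sum_mul]
    rw [Finset.sum_comm]
    refine Finset.sum_eq_zero fun l _ => ?_
    calc _ = z l * ∑ p, U p l * r p := by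
          rw [Finset.mul_sum]; exact Finset.sum_congr rfl fun p _ => by ring
      _ = 0 := by rw [h.residual, mul_zero]
  have h2 : ∀ p, (∑ l, U p l * z l - r p) ^ 2
      = (∑ l, U p l * z l) ^ 2 + r p ^ 2 - 2 * ((∑ l, U p l * z l) * r p) := fun p => by ring
  simp only [h2, Finset.sum_sub_distrib, Finset.sum_add_distrib, ← Finset.mul_sum, h1]
  ring

theorem sum_sq_le_l1Loss (h : OrthoPair U r) (z : Fin d → ℝ) :
    ∑ p, (∑ l, U p l * z l) ^ 2 + ∑ p, r p ^ 2 ≤ l1Loss U r z ^ 2 := by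
  rw [← h.pythagoras]; exact sum_sq_le_sq_sum_abs _

/-- Coordinates at zero columns of U do not matter and are set to 0; then the length of z' is ‖Uz‖₂,
which orthogonality of r bounds by ‖Uz − r‖₂. Competitors may therefore be taken in a bounded ball.
-/
theorem exists_short (h : OrthoPair U r) (z : Fin d → ℝ) :
    ∃ z' : Fin d → ℝ, l1Loss U r z' = l1Loss U r z ∧ ∑ l, z' l ^ 2 ≤ l1Loss U r z ^ 2 := by
  refine ⟨fun l => (∑ p, U p l * U p l) * z l, ?_, ?_⟩
  · unfold l1Loss
    refine Finset.sum_congr rfl fun p _ => ?_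
    congr 2
    refine Finset.sum_congr rfl fun l _ => ?_
    rcases h.norm l with h0 | h0
    · have : U p l = 0 := sum_mul_eq_zero_of_sum_mul_self (U := fun p => U p l) h0 p
      simp [this]
    · simp only [h0, one_mul]
  · have h1 := h.sum_sq_le_l1Loss z
    rw [h.sum_sq] at h1
    have h2 : ∀ l, ((∑ p, U p l * U p l) * z l) ^ 2 = (∑ p, U p l * U p l) * z l ^ 2 := fun l => by
      rcases h.norm l with h0 | h0 <;> rw [h0] <;> ring
    simp only [h2]
    have : 0 ≤ ∑ p, r p ^ 2 := Finset.sum_nonneg fun p _ => sq_nonneg _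
    linarith

/-- The point 0 is the least squares solution, so it is optimal for ℓ₁ up to √N. This makes the
initial radius comparable to the optimum regardless of conditioning. -/
theorem sum_abs_residual_le (h : OrthoPair U r) (z : Fin d → ℝ) :
    ∑ p, |r p| ≤ √(Fintype.card ι) * l1Loss U r z := by
  have h1 := sq_sum_abs_le r
  have h2 := h.sum_sq_le_l1Loss z
  refine (abs_le_of_sq_le_sq' ?_ (mul_nonneg (Real.sqrt_nonneg _) (l1Loss_nonneg z))).2
  rw [mul_pow, Real.sq_sqrt (Nat.cast_nonneg _)]
  refine h1.trans (mul_le_mul_of_nonneg_left ?_ (Nat.cast_nonneg _))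
  have : 0 ≤ ∑ p, (∑ l, U p l * z l) ^ 2 := Finset.sum_nonneg fun p _ => sq_nonneg _
  linarith

theorem l1Loss_le (h : OrthoPair U r) {z : Fin d → ℝ} {ρ : ℝ} (hρ : 0 ≤ ρ)
    (hz : ∑ l, z l ^ 2 ≤ ρ ^ 2) :
    l1Loss U r z ≤ √(Fintype.card ι) * ρ + ∑ p, |r p| := by
  have h1 : ∑ p, |∑ l, U p l * z l| ≤ √(Fintype.card ι) * ρ := by
    refine (abs_le_of_sq_le_sq' ((sq_sum_abs_le _).trans ?_) (by positivity)).2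
    rw [mul_pow, Real.sq_sqrt (Nat.cast_nonneg _)]
    gcongr
    exact (h.sum_sq_le z).trans hz
  refine le_trans ?_ (add_le_add h1 le_rfl)
  rw [← Finset.sum_add_distrib]
  exact Finset.sum_le_sum fun p _ => abs_sub _ _

/-- Points of a small ball near a competitor `z` are nearly as good as `z`. -/
theorem l1Loss_near_le (h : OrthoPair U r) {z w : Fin d → ℝ} {δ ε : ℝ} (hδ : 0 ≤ δ) (hδ1 : δ ≤ 1)
    (hδε : δ * (2 * Fintype.card ι) ≤ ε) (hw : ∑ l, w l ^ 2 ≤ (∑ p, |r p|) ^ 2) :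
    l1Loss U r (fun l => (1 - δ) * z l + δ * w l) ≤ (1 + ε) * l1Loss U r z := by
  have h1 : l1Loss U r (fun l => (1 - δ) * z l + δ * w l)
      ≤ (1 - δ) * l1Loss U r z + δ * l1Loss U r w := by
    unfold l1Loss
    rw [Finset.mul_sum, Finset.mul_sum, ← Finset.sum_add_distrib]
    refine Finset.sum_le_sum fun p _ => ?_
    have e : ∑ l, U p l * ((1 - δ) * z l + δ * w l) - r p
        = (1 - δ) * (∑ l, U p l * z l - r p) + δ * (∑ l, U p l * w l - r p) := by
      simp only [mul_sub, Finset.mul_sum, mul_add, Finset.sum_add_distrib]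
      have e1 : ∀ l, U p l * ((1 - δ) * z l) = (1 - δ) * (U p l * z l) := fun l => by ring
      have e2 : ∀ l, U p l * (δ * w l) = δ * (U p l * w l) := fun l => by ring
      simp only [e1, e2]; ring
    rw [e]
    refine (abs_add_le _ _).trans (le_of_eq ?_)
    rw [abs_mul, abs_mul, abs_of_nonneg hδ, abs_of_nonneg (by linarith : (0 : ℝ) ≤ 1 - δ)]
  have hR0 : 0 ≤ ∑ p, |r p| := Finset.sum_nonneg fun _ _ => abs_nonneg _
  have h2 := h.l1Loss_le hR0 hw
  have h3 := h.sum_abs_residual_le z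
  have hf := l1Loss_nonneg (U := U) (r := r) z
  set N : ℝ := (Fintype.card ι : ℝ) with hN
  rcases isEmpty_or_nonempty ι with hι | hι
  · simp [l1Loss]
  have hN1 : 1 ≤ N := by rw [hN]; exact_mod_cast Fintype.card_pos
  have hs1 : 1 ≤ √N := Real.one_le_sqrt.2 hN1
  have hss : √N * √N = N := Real.mul_self_sqrt (by linarith)
  -- Points w of the initial ball satisfy loss(w) ≤ (√N + 1)‖r‖₁ ≤ 2√N · √N loss(z). A fraction δ of
  -- it costs at most ε loss(z).
  have h4 : l1Loss U r w ≤ 2 * N * l1Loss U r z := by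
    have h5 : l1Loss U r w ≤ 2 * √N * ∑ p, |r p| := by nlinarith
    calc l1Loss U r w ≤ 2 * √N * ∑ p, |r p| := h5
      _ ≤ 2 * √N * (√N * l1Loss U r z) := by gcongr
      _ = 2 * (√N * √N) * l1Loss U r z := by ring
      _ = _ := by rw [hss]
  have h6 : δ * l1Loss U r w ≤ ε * l1Loss U r z := by
    calc δ * l1Loss U r w ≤ δ * (2 * N * l1Loss U r z) := by gcongr
      _ = δ * (2 * N) * l1Loss U r z := by ring
      _ ≤ ε * l1Loss U r z := by gcongr
  nlinarith

end OrthoPair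

/-- A subgradient of the objective. -/
def subgrad (U : ι → Fin d → ℝ) (r : ι → ℝ) (c : Fin d → ℝ) (l : Fin d) : ℝ :=
  ∑ p, (∑ m, U p m * c m - r p) / √((∑ m, U p m * c m - r p) * (∑ m, U p m * c m - r p)) * U p l

/-- Termwise sign(y)(x − y) ≤ |x| − |y|. The sign is y/√(y²), and its value 0/0 = 0 at y = 0 is also
a valid subgradient. -/
theorem subgrad_le (c z : Fin d → ℝ) :
    ∑ l, subgrad U r c l * (z l - c l) ≤ l1Loss U r z - l1Loss U r c := by
  have e : ∑ l, subgrad U r c l * (z l - c l) = ∑ p, (∑ m, U p m * c m - r p) /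
      √((∑ m, U p m * c m - r p) * (∑ m, U p m * c m - r p)) *
      ((∑ m, U p m * z m - r p) - (∑ m, U p m * c m - r p)) := by
    simp only [subgrad, Finset.sum_mul]
    rw [Finset.sum_comm]
    refine Finset.sum_congr rfl fun p _ => ?_
    have : (∑ m, U p m * z m - r p) - (∑ m, U p m * c m - r p) = ∑ l, U p l * (z l - c l) := by
      simp only [mul_sub, Finset.sum_sub_distrib]; ring
    rw [this, Finset.mul_sum]
    exact Finset.sum_congr rfl fun l _ => by ring
  rw [e]
  unfold l1Loss
  rw [← Finset.sum_sub_distrib]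
  refine Finset.sum_le_sum fun p _ => ?_
  generalize ∑ m, U p m * c m - r p = y
  generalize ∑ m, U p m * z m - r p = x
  rw [Real.sqrt_mul_self_eq_abs]
  rcases lt_trichotomy y 0 with hy | hy | hy
  · rw [abs_of_neg hy, div_neg, div_self hy.ne]
    have := neg_abs_le x
    linarith
  · subst hy; simp
  · rw [abs_of_pos hy, div_self hy.ne']
    have := le_abs_self x
    linarith

/-- The relative length of the ellipsoid step. -/
def stepShift (d : ℕ) : ℝ := 1 / (d + 2)

/-- The scaling of the ellipsoid orthogonally to the step. -/
def stepScale (d : ℕ) : ℝ := (d + 1) / √(d * (d + 2))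

/-- The additional change of the scaling in the direction of the step. -/
def stepRank (d : ℕ) : ℝ := 1 - stepShift d - stepScale d

/-- The factor by which the volume bound decreases (per dimension). -/
def stepRate (d : ℕ) : ℝ := 1 - 1 / (4 * ((d + 2) * (d + 2)))

theorem exp_neg_two_mul_le {x : ℝ} (h0 : 0 ≤ x) (h1 : x ≤ 1 / 2) : Real.exp (-(2 * x)) ≤ 1 - x := by
  rw [Real.exp_neg]
  have h2 := Real.add_one_le_exp (2 * x)
  rw [inv_le_comm₀ (Real.exp_pos _) (by linarith)]
  refine le_trans ?_ h2
  rw [inv_le_comm₀ (by linarith) (by linarith), ← one_div, div_le_iff₀ (by linarith)]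
  nlinarith

theorem stepScale_pos {d : ℕ} (hd : 1 ≤ d) : 0 < stepScale d := by
  have : (0 : ℝ) < d := by exact_mod_cast hd
  unfold stepScale; positivity

theorem stepScale_sq {d : ℕ} (hd : 1 ≤ d) : stepScale d ^ 2 = (d + 1) ^ 2 / (d * (d + 2)) := by
  have : (0 : ℝ) < d := by exact_mod_cast hd
  rw [stepScale, div_pow, Real.sq_sqrt (by positivity)]

/-- The volume factor is at most exp((d − 1)/(2d(d + 2)) − 1/(d + 2)) ≤ exp(−1/(2(d + 2))). With 1 −
x ≥ e^{−2x}, x = 1/(4(d + 2)²), this is at most the d-th power of the rate; a per-dimension rate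
spares the program powers and roots. -/
theorem step_volume_le {d : ℕ} (hd : 1 ≤ d) :
    stepScale d ^ (d - 1) * (1 - stepShift d) ≤ stepRate d ^ d := by
  have hd' : (1 : ℝ) ≤ d := by exact_mod_cast hd
  have hα := stepScale_pos hd
  have h1 : stepScale d ≤ Real.exp (1 / (2 * (d * (d + 2)))) := by
    refine (abs_le_of_sq_le_sq' ?_ (Real.exp_pos _).le).2
    rw [stepScale_sq hd, ← Real.exp_nat_mul]
    have h2 := Real.add_one_le_exp (1 / ((d : ℝ) * (d + 2)))
    have e : ((2 : ℕ) : ℝ) * (1 / (2 * (d * (d + 2)))) = 1 / ((d : ℝ) * (d + 2)) := by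
      push_cast; field_simp
    rw [e]
    refine le_trans (le_of_eq ?_) h2
    field_simp; ring
  have h2 : 1 - stepShift d ≤ Real.exp (-(1 / (d + 2))) := by
    have := Real.add_one_le_exp (-(1 / ((d : ℝ) + 2)))
    rw [stepShift]; linarith
  have h3 : 0 ≤ 1 - stepShift d := by
    rw [stepShift, sub_nonneg, div_le_one (by positivity)]; linarith
  have h4 : Real.exp (-(1 / (2 * (d + 2)))) ≤ stepRate d ^ d := by
    have hx := exp_neg_two_mul_le (x := 1 / (4 * (((d : ℝ) + 2) * (d + 2)))) (by positivity) (by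
      rw [div_le_iff₀ (by positivity)]; nlinarith)
    calc Real.exp (-(1 / (2 * (d + 2))))
        ≤ Real.exp (d * -(2 * (1 / (4 * (((d : ℝ) + 2) * (d + 2)))))) := by
          rw [Real.exp_le_exp]
          have : (d : ℝ) * (2 * (1 / (4 * (((d : ℝ) + 2) * (d + 2))))) ≤ 1 / (2 * (d + 2)) := by
            rw [le_div_iff₀ (by positivity)]
            field_simp
            nlinarith
          linarith
      _ = Real.exp (-(2 * (1 / (4 * (((d : ℝ) + 2) * (d + 2)))))) ^ d := by
          rw [Real.exp_nat_mul]
      _ ≤ stepRate d ^ d := pow_le_pow_left₀ (Real.exp_pos _).le hx d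
  refine le_trans ?_ h4
  calc stepScale d ^ (d - 1) * (1 - stepShift d)
      ≤ Real.exp (1 / (2 * (d * (d + 2)))) ^ (d - 1) * Real.exp (-(1 / (d + 2))) := by gcongr
    _ = Real.exp ((d - 1) * (1 / (2 * (d * (d + 2)))) + -(1 / (d + 2))) := by
        rw [← Real.exp_nat_mul, Nat.cast_sub hd, Nat.cast_one, Real.exp_add]
    _ ≤ Real.exp (-(1 / (2 * (d + 2)))) := by
        rw [Real.exp_le_exp]
        have e : ((d : ℝ) - 1) * (1 / (2 * (d * (d + 2)))) + -(1 / (d + 2)) + 1 / (2 * (d + 2))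
            = -(1 / (2 * (d * (d + 2)))) := by field_simp; ring
        have : 0 ≤ 1 / (2 * ((d : ℝ) * (d + 2))) := by positivity
        linarith

/-- The ellipsoid with centre `c` and factor `L`. -/
def ellipsoid (c : Fin d → ℝ) (L : Matrix (Fin d) (Fin d) ℝ) : Set (Fin d → ℝ) :=
  {z | ∃ x : Fin d → ℝ, ∑ l, x l ^ 2 ≤ 1 ∧ z = c + L *ᵥ x}

/-- After pulling back by L, the claim is that the half {u·x < 0} of the unit ball lies in an
ellipsoid centred at −τu. Shift and axes are those of the classical central cut in dimension d + 1,
where the formulas make sense for d = 1 too. A point strictly inside the cut also forces the pulled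
back gradient to be nonzero, so |u| = 1. -/
theorem mem_ellipsoid_step (hd : 1 ≤ d) {c z g h u : Fin d → ℝ} {L : Matrix (Fin d) (Fin d) ℝ}
    (hz : z ∈ ellipsoid c L) (hg : ∑ l, g l * (z l - c l) < 0) (hh : h = Lᵀ *ᵥ g)
    (hu : ∀ l, u l = h l / √(∑ l, h l * h l)) :
    z ∈ ellipsoid (c - stepShift d • (L *ᵥ u))
        (L * (stepScale d • (1 : Matrix (Fin d) (Fin d) ℝ) + stepRank d • vecMulVec u u)) ∧
      ∑ l, u l ^ 2 = 1 := by
  obtain ⟨x, hx, rfl⟩ := hz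
  have h1 : ∑ l, h l * x l < 0 := by
    have e : ∑ l, g l * ((c + L *ᵥ x) l - c l) = h ⬝ᵥ x := by
      rw [hh, mulVec_transpose, ← dotProduct_mulVec]
      simp [dotProduct]
    rw [e] at hg; exact hg
  set H : ℝ := √(∑ l, h l * h l) with hH
  have hHH : H * H = ∑ l, h l * h l :=
    Real.mul_self_sqrt (Finset.sum_nonneg fun l _ => mul_self_nonneg _)
  have hH0 : 0 < H := by
    rcases (Real.sqrt_nonneg _ : 0 ≤ H).eq_or_lt with h0 | h0
    · exfalso
      have hHH' : (0 : ℝ) = ∑ l, h l * h l := by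
        rw [← hHH, hH, ← h0, mul_zero]
      have := sum_mul_eq_zero_of_sum_mul_self hHH'.symm
      simp [this] at h1
    · exact h0
  have huu : ∑ l, u l ^ 2 = 1 := by
    have e : ∀ l, u l ^ 2 = h l * h l / (H * H) := fun l => by rw [hu, sq, div_mul_div_comm]
    simp only [e, ← Finset.sum_div]
    rw [← hHH]; field_simp
  refine ⟨?_, huu⟩
  set s : ℝ := ∑ l, u l * x l with hs
  have hs0 : s < 0 := by
    have : s = (∑ l, h l * x l) / H := by
      rw [hs, Finset.sum_div]; exact Finset.sum_congr rfl fun l _ => by rw [hu]; ring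
    rw [this]; exact div_neg_of_neg_of_pos h1 hH0
  have hs1 : -1 ≤ s := by
    have h2 := Finset.sum_mul_sq_le_sq_mul_sq Finset.univ u x
    rw [huu, one_mul] at h2
    exact (abs_le_of_sq_le_sq' (by rw [one_pow]; exact h2.trans hx) zero_le_one).1
  have hα := stepScale_pos hd
  have hα2 := stepScale_sq hd
  set α := stepScale d with hαdef
  set τ := stepShift d with hτ
  have hd' : (1 : ℝ) ≤ d := by exact_mod_cast hd
  have hb : 1 - τ = (d + 1) / (d + 2) := by rw [hτ, stepShift]; field_simp; ring
  have hb0 : 0 < 1 - τ := by rw [hb]; positivity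
  -- The preimage: the part of x orthogonal to u is divided by α, and the part along u, measured
  -- from the new centre, by 1 − τ.
  refine ⟨fun l => (x l - s * u l) / α + (s + τ) / (1 - τ) * u l, ?_, ?_⟩
  · have e : ∀ l, ((x l - s * u l) / α + (s + τ) / (1 - τ) * u l) ^ 2
        = (x l ^ 2 - 2 * s * (u l * x l) + s ^ 2 * u l ^ 2) / α ^ 2
          + 2 * ((s + τ) / (1 - τ)) / α * (u l * x l - s * u l ^ 2)
          + ((s + τ) / (1 - τ)) ^ 2 * u l ^ 2 := fun l => by field_simp; ring
    simp only [e, Finset.sum_add_distrib, ← Finset.sum_div, ← Finset.mul_sum,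
      Finset.sum_sub_distrib, huu, ← hs]
    have hτ' : τ = 1 / (d + 2) := rfl
    have h3 : (∑ l, x l ^ 2 - 2 * s * s + s ^ 2 * 1) / α ^ 2
        ≤ (1 - s ^ 2) * (d * (d + 2)) / (d + 1) ^ 2 := by
      rw [hα2, div_div_eq_mul_div]
      have : ∑ l, x l ^ 2 - 2 * s * s + s ^ 2 * 1 ≤ 1 - s ^ 2 := by nlinarith
      gcongr
    have h4 : ((s + τ) / (1 - τ)) ^ 2 * 1 = (s * (d + 2) + 1) ^ 2 / (d + 1) ^ 2 := by
      rw [hb, hτ']; field_simp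
    -- Left minus right is 2(d + 2)s(s + 1)/(d + 1)², which is nonpositive because −1 ≤ s < 0.
    have h5 : (1 - s ^ 2) * (d * (d + 2)) / (d + 1) ^ 2 + (s * (d + 2) + 1) ^ 2 / (d + 1) ^ 2
        ≤ 1 := by
      rw [← add_div, div_le_one (by positivity)]
      nlinarith [mul_nonneg (neg_nonneg.2 hs0.le) (by linarith : 0 ≤ s + 1),
        mul_nonneg (mul_nonneg (neg_nonneg.2 hs0.le) (by linarith : 0 ≤ s + 1))
          (by linarith : (0 : ℝ) ≤ d)]
    rw [h4]
    have e2 : s - s * 1 = 0 := by ring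
    rw [e2, mul_zero, add_zero]
    linarith
  · have hux : u ⬝ᵥ (fun l => (x l - s * u l) / α + (s + τ) / (1 - τ) * u l)
        = (s + τ) / (1 - τ) := by
      have e : ∀ l, u l * ((x l - s * u l) / α + (s + τ) / (1 - τ) * u l)
          = (u l * x l - s * u l ^ 2) / α + (s + τ) / (1 - τ) * u l ^ 2 := fun l => by ring
      simp only [dotProduct, e, Finset.sum_add_distrib, ← Finset.sum_div, ← Finset.mul_sum,
        Finset.sum_sub_distrib, huu, ← hs]
      ring
    have hy : (α • (1 : Matrix (Fin d) (Fin d) ℝ) + stepRank d • vecMulVec u u) *ᵥ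
        (fun l => (x l - s * u l) / α + (s + τ) / (1 - τ) * u l) = x + τ • u := by
      rw [add_mulVec, smul_mulVec, one_mulVec, smul_mulVec, vecMulVec_mulVec, hux]
      ext l
      have hr : stepRank d = 1 - τ - α := rfl
      simp only [Pi.add_apply, Pi.smul_apply, smul_eq_mul, MulOpposite.smul_eq_mul_unop,
        MulOpposite.unop_op, hr]
      field_simp
      ring
    rw [← mulVec_mulVec, hy, mulVec_add, mulVec_smul]
    abel

/-- The update is α times a rank one perturbation of the identity; the matrix determinant lemma
gives α^{d−1}(1 − τ). -/
theorem det_step (hd : 1 ≤ d) {u : Fin d → ℝ} (hu : ∑ l, u l ^ 2 = 1)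
    (L : Matrix (Fin d) (Fin d) ℝ) :
    |(L * (stepScale d • (1 : Matrix (Fin d) (Fin d) ℝ) + stepRank d • vecMulVec u u)).det|
      ≤ |L.det| * stepRate d ^ d := by
  have hα := stepScale_pos hd
  have h1 : (stepScale d • (1 : Matrix (Fin d) (Fin d) ℝ) + stepRank d • vecMulVec u u).det
      = stepScale d ^ (d - 1) * (1 - stepShift d) := by
    have e : stepScale d • (1 : Matrix (Fin d) (Fin d) ℝ) + stepRank d • vecMulVec u u
        = stepScale d • (1 + replicateCol Unit ((stepRank d / stepScale d) • u) *
          replicateRow Unit u) := by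
      ext a b
      simp only [Matrix.add_apply, Matrix.smul_apply, vecMulVec_apply, smul_eq_mul, Matrix.mul_apply,
        replicateCol_apply, replicateRow_apply, Finset.univ_unique, Finset.sum_singleton,
        Pi.smul_apply]
      field_simp
    rw [e, det_smul, det_one_add_replicateCol_mul_replicateRow, dotProduct_smul, Fintype.card_fin]
    have huu : u ⬝ᵥ u = 1 := by rw [← hu]; simp [dotProduct, sq]
    rw [huu]
    obtain ⟨m, rfl⟩ : ∃ m, d = m + 1 := ⟨d - 1, by omega⟩
    simp only [stepRank, smul_eq_mul, mul_one, Nat.add_sub_cancel, pow_succ]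
    field_simp
    ring
  have h0 : 0 ≤ 1 - stepShift d := by
    rw [stepShift, sub_nonneg, div_le_one (by positivity)]
    linarith [Nat.cast_nonneg (α := ℝ) d]
  rw [det_mul, h1, abs_mul, abs_of_nonneg (mul_nonneg (pow_nonneg hα.le _) h0)]
  exact mul_le_mul_of_nonneg_left (step_volume_le hd) (abs_nonneg _)

open scoped Pointwise in
/-- An ellipsoid that contains a ball of radius `ρ` has volume at least that of the ball. -/
theorem pow_le_abs_det {c a : Fin d → ℝ} {L : Matrix (Fin d) (Fin d) ℝ} {ρ : ℝ} (hρ : 0 ≤ ρ)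
    (h : ∀ w : Fin d → ℝ, ∑ l, w l ^ 2 ≤ 1 → a + ρ • w ∈ ellipsoid c L) : ρ ^ d ≤ |L.det| := by
  let B : Set (Fin d → ℝ) := {w | ∑ l, w l ^ 2 ≤ 1}
  have hB0 : volume B ≠ 0 := by
    have ho : IsOpen {w : Fin d → ℝ | ∑ l, w l ^ 2 < 1} :=
      isOpen_lt (by fun_prop) continuous_const
    have h1 := ho.measure_pos volume ⟨0, by simp⟩
    exact (h1.trans_le (measure_mono fun w (hw : ∑ l, w l ^ 2 < 1) => hw.le)).ne'
  have hBt : volume B ≠ ⊤ := by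
    refine ((Metric.isBounded_closedBall (x := (0 : Fin d → ℝ)) (r := 1)).subset ?_).measure_lt_top.ne
    intro w hw
    rw [mem_closedBall_zero_iff, pi_norm_le_iff_of_nonneg zero_le_one]
    intro l
    refine abs_le_of_sq_le_sq ?_ zero_le_one
    rw [one_pow]
    exact (Finset.single_le_sum (f := fun l => w l ^ 2) (fun _ _ => sq_nonneg _)
      (Finset.mem_univ l)).trans hw
  have h1 : volume ((fun w => a + w) '' (ρ • B)) ≤ volume ((fun w => c + w) '' (toLin' L '' B)) := by
    refine measure_mono ?_
    rintro _ ⟨_, ⟨w, hw, rfl⟩, rfl⟩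
    obtain ⟨x, hx, hxe⟩ := h w hw
    exact ⟨_, ⟨x, hx, rfl⟩, hxe.symm⟩
  -- Translations do not matter. The volumes are ρ^d and |det L| times that of the unit ball, which
  -- cancels as it is positive and finite.
  rw [Set.image_add_left, Set.image_add_left, measure_preimage_add, measure_preimage_add,
    Measure.addHaar_smul, Measure.addHaar_image_linearMap, LinearMap.det_toLin',
    Module.finrank_fin_fun, ENNReal.mul_le_mul_iff_left hB0 hBt,
    ENNReal.ofReal_le_ofReal_iff (abs_nonneg _), abs_of_nonneg (pow_nonneg hρ d)] at h1
  exact h1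

/-- The invariant of the ellipsoid method: centre `c`, factor `L`, volume bound `v`, best value
`F` so far. -/
def EllipsoidInv (U : ι → Fin d → ℝ) (r : ι → ℝ) (ε δ : ℝ) (c : Fin d → ℝ)
    (L : Matrix (Fin d) (Fin d) ℝ) (v F : ℝ) : Prop :=
  F ≤ l1Loss U r 0 ∧ 0 ≤ v ∧ ∀ z : Fin d → ℝ, ∑ l, z l ^ 2 ≤ l1Loss U r z ^ 2 →
    (1 + ε) * l1Loss U r z < F →
    |L.det| ≤ (l1Loss U r 0 * v) ^ d ∧ ∀ w : Fin d → ℝ, ∑ l, w l ^ 2 ≤ l1Loss U r 0 ^ 2 →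
      (fun l => (1 - δ) * z l + δ * w l) ∈ ellipsoid c L

/-- A competitor better than the value at 0 satisfies ‖z‖₂ ≤ loss(z) < ‖r‖₁, so the initial ball
contains it and all convex combinations with points w of the ball. -/
theorem EllipsoidInv.init {ε δ : ℝ} (hε : 0 ≤ ε) (hδ : 0 ≤ δ) (hδ1 : δ ≤ 1) :
    EllipsoidInv U r ε δ 0 (l1Loss U r 0 • (1 : Matrix (Fin d) (Fin d) ℝ)) 1 (l1Loss U r 0) := by
  refine ⟨le_rfl, zero_le_one, fun z hz hzF => ⟨?_, fun w hw => ?_⟩⟩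
  · rw [det_smul, det_one, Fintype.card_fin, mul_one, mul_one, abs_of_nonneg
      (pow_nonneg (l1Loss_nonneg 0) d)]
  · have hf := l1Loss_nonneg (U := U) (r := r) z
    set ρ := l1Loss U r 0 with hρ
    have hzρ : l1Loss U r z < ρ := lt_of_le_of_lt (by nlinarith) hzF
    have hρ0 : 0 < ρ := hf.trans_lt hzρ
    have hz' : ∑ l, z l ^ 2 ≤ ρ ^ 2 := hz.trans (by gcongr)
    refine ⟨fun l => ((1 - δ) * z l + δ * w l) / ρ, ?_, ?_⟩
    · simp only [div_pow, ← Finset.sum_div]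
      rw [div_le_one (by positivity)]
      have : ∀ l, ((1 - δ) * z l + δ * w l) ^ 2 ≤ (1 - δ) * z l ^ 2 + δ * w l ^ 2 := fun l => by
        nlinarith [mul_nonneg (mul_nonneg hδ (sub_nonneg.2 hδ1)) (sq_nonneg (z l - w l))]
      refine (Finset.sum_le_sum fun l _ => this l).trans ?_
      rw [Finset.sum_add_distrib, ← Finset.mul_sum, ← Finset.mul_sum]
      nlinarith [mul_le_mul_of_nonneg_left hz' (sub_nonneg.2 hδ1), mul_le_mul_of_nonneg_left hw hδ]
    · rw [smul_mulVec, one_mulVec, zero_add]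
      ext l
      simp only [Pi.smul_apply, smul_eq_mul]
      field_simp

theorem stepRate_nonneg (d : ℕ) : 0 ≤ stepRate d := by
  have h0 : (0 : ℝ) ≤ d := Nat.cast_nonneg d
  rw [stepRate, sub_nonneg, div_le_one (by positivity)]
  nlinarith

/-- If z beats the best value by more than 1 + ε, the whole small ball near z has loss below that at
the centre, so the subgradient cut at the centre keeps it. Otherwise the invariant claims nothing.
-/
theorem EllipsoidInv.step (hd : 1 ≤ d) (ho : OrthoPair U r) {ε δ : ℝ} (hδ : 0 ≤ δ) (hδ1 : δ ≤ 1)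
    (hδε : δ * (2 * Fintype.card ι) ≤ ε) {c : Fin d → ℝ} {L : Matrix (Fin d) (Fin d) ℝ} {v F F' : ℝ}
    (hI : EllipsoidInv U r ε δ c L v F) (hF' : F' ≤ F) (hF'' : F' ≤ l1Loss U r c)
    {h u c' : Fin d → ℝ} {L' : Matrix (Fin d) (Fin d) ℝ}
    (hh : h = Lᵀ *ᵥ subgrad U r c) (hu : ∀ l, u l = h l / √(∑ l, h l * h l))
    (hc' : c' = c - stepShift d • (L *ᵥ u))
    (hL' : L' = L * (stepScale d • (1 : Matrix (Fin d) (Fin d) ℝ) + stepRank d • vecMulVec u u)) :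
    EllipsoidInv U r ε δ c' L' (v * stepRate d) F' := by
  refine ⟨hF'.trans hI.1, mul_nonneg hI.2.1 (stepRate_nonneg d), fun z hz hzF => ?_⟩
  obtain ⟨hdet, hball⟩ := hI.2.2 z hz (hzF.trans_le hF')
  have key : ∀ w : Fin d → ℝ, ∑ l, w l ^ 2 ≤ l1Loss U r 0 ^ 2 →
      (fun l => (1 - δ) * z l + δ * w l) ∈ ellipsoid c' L' ∧ ∑ l, u l ^ 2 = 1 := fun w hw => by
    rw [hc', hL']
    refine mem_ellipsoid_step hd (hball w hw) ?_ hh hu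
    refine (subgrad_le c _).trans_lt ?_
    have := ho.l1Loss_near_le (z := z) hδ hδ1 hδε (by rwa [l1Loss_zero] at hw)
    linarith
  refine ⟨?_, fun w hw => (key w hw).1⟩
  -- That u is a unit vector is known only because some point is kept by the cut; w = 0 provides
  -- one.
  have hu1 := (key 0 (by simp; positivity)).2
  rw [hL']
  refine (det_step hd hu1 L).trans ?_
  rw [← mul_assoc, mul_pow]
  exact mul_le_mul_of_nonneg_right hdet (pow_nonneg (stepRate_nonneg d) d)

/-- A better competitor would put a ball of radius δρ inside an ellipsoid with |det L| ≤ (ρv)^d <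
(δρ)^d. -/
theorem EllipsoidInv.final (hd : 1 ≤ d) (ho : OrthoPair U r) {ε δ : ℝ} (hε : 0 ≤ ε) (hδ : 0 ≤ δ)
    {c : Fin d → ℝ} {L : Matrix (Fin d) (Fin d) ℝ} {v F : ℝ}
    (hI : EllipsoidInv U r ε δ c L v F) (hv : v < δ) (z : Fin d → ℝ) :
    F ≤ (1 + ε) * l1Loss U r z := by
  obtain ⟨z', hz', hzn⟩ := ho.exists_short z
  rw [← hz'] at hzn ⊢
  by_contra! hcon
  obtain ⟨hdet, hball⟩ := hI.2.2 z' hzn hcon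
  set ρ := l1Loss U r 0 with hρ
  have hρ0 : 0 < ρ := by
    have := l1Loss_nonneg (U := U) (r := r) z'
    have h1 := hI.1
    nlinarith
  have h1 : (δ * ρ) ^ d ≤ |L.det| := by
    refine pow_le_abs_det (c := c) (a := fun l => (1 - δ) * z' l) (by positivity) fun w hw => ?_
    have h2 := hball (ρ • w) (by
      simp only [Pi.smul_apply, smul_eq_mul, mul_pow, ← Finset.mul_sum]
      exact mul_le_of_le_one_right (by positivity) hw)
    convert h2 using 1
    ext l
    simp only [Pi.add_apply, Pi.smul_apply, smul_eq_mul]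
    ring
  have h2 : (ρ * v) ^ d < (δ * ρ) ^ d := by
    refine pow_lt_pow_left₀ ?_ (mul_nonneg hρ0.le hI.2.1) (by omega)
    nlinarith
  linarith

end Ellipsoid


/-! ### Reasoning about programs -/

/-- The program `p`, started in `s`, halts within `T` steps in a memory satisfying `Q`. -/
def Ends (p : Program) (s : Memory) (T : ℕ) (Q : Memory → Prop) : Prop :=
  ∃ s' T', Runs p s s' T' ∧ T' ≤ T ∧ Q s'

theorem Ends.mono {p : Program} {s : Memory} {T T' : ℕ} {Q Q' : Memory → Prop}
    (h : Ends p s T Q) (hT : T ≤ T') (hQ : ∀ s, Q s → Q' s) : Ends p s T' Q' := by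
  obtain ⟨s', t, hr, ht, hq⟩ := h
  exact ⟨s', t, hr, ht.trans hT, hQ _ hq⟩

theorem Ends.seq {p q : Program} {s : Memory} {T T' : ℕ} {Q : Memory → Prop}
    (h : Ends p s T fun s' => Ends q s' T' Q) : Ends (.seq p q) s (T + T') Q := by
  obtain ⟨s', t, hr, ht, s'', t', hr', ht', hq⟩ := h
  exact ⟨s'', t + t', .seq hr hr', by omega, hq⟩

theorem Ends.skip {s : Memory} {Q : Memory → Prop} (h : Q s) : Ends .skip s 1 Q :=
  ⟨s, 1, .skip s, le_rfl, h⟩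

theorem Ends.setInt {s : Memory} {a : ℕ} {i j l e : IntExpr} {Q : Memory → Prop}
    (h : Q (s.setInt a (i.eval s) (j.eval s) (l.eval s) (e.eval s))) :
    Ends (.setInt a i j l e) s 1 Q :=
  ⟨_, 1, .setInt s a i j l e, le_rfl, h⟩

theorem Ends.setReal {s : Memory} {a : ℕ} {i j l : IntExpr} {e : RealExpr} {Q : Memory → Prop}
    (h : Q (s.setReal a (i.eval s) (j.eval s) (l.eval s) (e.eval s))) :
    Ends (.setReal a i j l e) s 1 Q :=
  ⟨_, 1, .setReal s a i j l e, le_rfl, h⟩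

theorem Ends.ite {c : Test} {p q : Program} {s : Memory} {T : ℕ} {Q : Memory → Prop}
    (h : c.Holds s → Ends p s T Q) (h' : ¬ c.Holds s → Ends q s T Q) :
    Ends (.ite c p q) s (T + 1) Q := by
  by_cases hc : c.Holds s
  · obtain ⟨s', t, hr, ht, hq⟩ := h hc
    exact ⟨s', t + 1, .iteTrue hc hr, by omega, hq⟩
  · obtain ⟨s', t, hr, ht, hq⟩ := h' hc
    exact ⟨s', t + 1, .iteFalse hc hr, by omega, hq⟩

/-- A loop with invariant `I j` before the `j`-th pass which ends after exactly `N` passes. -/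
theorem Ends.loop {c : Test} {p : Program} {s : Memory} {B : ℕ} (N : ℕ) (I : ℕ → Memory → Prop)
    (h0 : I 0 s) (hc : ∀ j < N, ∀ s, I j s → c.Holds s) (hN : ∀ s, I N s → ¬ c.Holds s)
    (hb : ∀ j < N, ∀ s, I j s → Ends p s B (I (j + 1))) :
    Ends (.loop c p) s (N * (B + 1) + 1) (I N) := by
  suffices H : ∀ m j, j + m = N → ∀ s, I j s → Ends (.loop c p) s (m * (B + 1) + 1) (I N) from
    H N 0 (by omega) s h0
  intro m
  induction m with
  | zero =>
    intro j hj s hs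
    obtain rfl : j = N := by omega
    exact ⟨s, 1, .loopStop (hN s hs), by omega, hs⟩
  | succ m ih =>
    intro j hj s hs
    obtain ⟨s', t, hr, ht, hq⟩ := hb j (by omega) s hs
    obtain ⟨s'', t', hr', ht', hq'⟩ := ih (j + 1) (by omega) s' hq
    refine ⟨s'', t + t' + 1, .loopStep (hc j (by omega) s hs) hr hr', ?_, hq'⟩
    rw [Nat.succ_mul]
    omega

/-! ### Counters

The integer array `10` holds loop counters, the real array `9` an accumulator. -/

/-- The `q`-th loop counter. -/
def counter (q : ℕ) : IntExpr := .get 10 (.const q) (.const 0) (.const 0)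

/-- `for counter q < bound do p`. -/
def countLoop (q : ℕ) (bound : IntExpr) (p : Program) : Program :=
  .seq (.setInt 10 (.const q) (.const 0) (.const 0) (.const 0))
    (.loop (.intLt (counter q) bound)
      (.seq p (.setInt 10 (.const q) (.const 0) (.const 0) (.succ (counter q)))))

/-- Whether an expression is the counter with number below `q`, given by its indices. -/
def isCounter (q : ℕ) : IntExpr → IntExpr → IntExpr → Bool
  | .const r, .const 0, .const 0 => decide (r < q)
  | _, _, _ => false

/-- The expression reads no counters except those with numbers below `q`. -/
def IntExpr.ok (q : ℕ) : IntExpr → Bool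
  | .const _ => true
  | .get a i j l => if a = 10 then isCounter q i j l else i.ok q && j.ok q && l.ok q
  | .succ e => e.ok q

/-- The expression reads no counters except those with numbers below `q`, and neither the
accumulator nor the real array `w`. -/
def RealExpr.ok (q w : ℕ) : RealExpr → Bool
  | .const _ => true
  | .pi => true
  | .ofInt e => e.ok q
  | .get a i j l => decide (a ≠ 9) && decide (a ≠ w) && i.ok q && j.ok q && l.ok q
  | .add e f => e.ok q w && f.ok q w
  | .sub e f => e.ok q w && f.ok q w
  | .mul e f => e.ok q w && f.ok q w
  | .div e f => e.ok q w && f.ok q w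
  | .sqrt e => e.ok q w

theorem isCounter_eq {q : ℕ} {i j l : IntExpr} (h : isCounter q i j l = true) :
    ∃ r < q, i = .const r ∧ j = .const 0 ∧ l = .const 0 := by
  unfold isCounter at h
  split at h
  · exact ⟨_, of_decide_eq_true h, rfl, rfl, rfl⟩
  · simp at h

/-- A frame rule: the syntactic check `ok` bounds what the expression can read, so changes elsewhere
in memory are harmless. -/
theorem IntExpr.eval_congr {q : ℕ} {m m' : Memory} (hi : ∀ a, a ≠ 10 → m.int a = m'.int a)
    (hc : ∀ r < q, m.int 10 r 0 0 = m'.int 10 r 0 0) (e : IntExpr) (he : e.ok q = true) :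
    e.eval m = e.eval m' := by
  induction e with
  | const => rfl
  | get a i j l ihi ihj ihl =>
    rw [IntExpr.ok] at he
    split_ifs at he with ha
    · obtain ⟨r, hr, rfl, rfl, rfl⟩ := isCounter_eq he
      subst ha
      exact hc r hr
    · simp only [Bool.and_eq_true] at he
      simp only [IntExpr.eval, ihi he.1.1, ihj he.1.2, ihl he.2, hi a ha]
  | succ e ih => simp only [IntExpr.eval, ih he]

theorem RealExpr.eval_congr {q w : ℕ} {m m' : Memory} (hi : ∀ a, a ≠ 10 → m.int a = m'.int a)
    (hc : ∀ r < q, m.int 10 r 0 0 = m'.int 10 r 0 0)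
    (hr : ∀ a, a ≠ 9 → a ≠ w → m.real a = m'.real a) (e : RealExpr) (he : e.ok q w = true) :
    e.eval m = e.eval m' := by
  induction e with
  | const => rfl
  | pi => rfl
  | ofInt e => simp only [RealExpr.eval, e.eval_congr hi hc he]
  | get a i j l =>
    simp only [RealExpr.ok, Bool.and_eq_true, decide_eq_true_eq] at he
    simp only [RealExpr.eval, i.eval_congr hi hc he.1.1.2, j.eval_congr hi hc he.1.2,
      l.eval_congr hi hc he.2, hr a he.1.1.1.1 he.1.1.1.2]
  | sqrt e ih => simp only [RealExpr.eval, ih he]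
  | _ e f ihe ihf =>
    simp only [RealExpr.ok, Bool.and_eq_true] at he
    simp only [RealExpr.eval, ihe he.1, ihf he.2]

/-- The memory `s` with prescribed loop counters. -/
def Memory.withCounters (s : Memory) (c : ℕ → ℕ) : Memory :=
  { s with int := fun a i j l => if a = 10 then c i else s.int a i j l }

theorem IntExpr.eval_withCounters (e : IntExpr) (he : e.ok 0 = true) {s : Memory} {c : ℕ → ℕ} :
    e.eval (s.withCounters c) = e.eval s :=
  e.eval_congr (q := 0) (fun a ha => by ext; simp [Memory.withCounters, ha]) (by simp) he

theorem IntExpr.ok_of_ok_zero (e : IntExpr) (he : e.ok 0 = true) {q : ℕ} : e.ok q = true := by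
  induction e with
  | const => rfl
  | get a i j l ihi ihj ihl =>
    rw [IntExpr.ok] at he ⊢
    split_ifs at he ⊢ with ha
    · obtain ⟨r, hr, -⟩ := isCounter_eq he
      simp at hr
    · simp only [Bool.and_eq_true] at he ⊢
      exact ⟨⟨ihi he.1.1, ihj he.1.2⟩, ihl he.2⟩
  | succ e ih => exact ih he

/-- Memory `m` inside nested loops: it is `s`, except that the array `w` holds `f`, the first `q`
counters are `c`, and the accumulator holds `x` (if specified). -/
structure Inside (s : Memory) (w : ℕ) (f : ℕ → ℕ → ℕ → ℝ) (x : Option ℝ) (q : ℕ) (c : ℕ → ℕ)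
    (m : Memory) : Prop where
  int : ∀ a, a ≠ 10 → m.int a = s.int a
  counter : ∀ r < q, m.int 10 r 0 0 = c r
  real : ∀ a, a ≠ 9 → a ≠ w → m.real a = s.real a
  buffer : m.real w = f
  acc : ∀ y ∈ x, m.real 9 0 0 0 = y

namespace Inside

variable {s m : Memory} {w q : ℕ} {f : ℕ → ℕ → ℕ → ℝ} {x : Option ℝ} {c : ℕ → ℕ}

theorem intEval (h : Inside s w f x q c m) (e : IntExpr) (he : e.ok q = true) :
    e.eval m = e.eval (s.withCounters c) :=
  e.eval_congr (fun a ha => by ext; simp [h.int a ha, Memory.withCounters, ha])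
    (fun r hr => by simp [h.counter r hr, Memory.withCounters]) he

theorem realEval (h : Inside s w f x q c m) (e : RealExpr) (he : e.ok q w = true) :
    e.eval m = e.eval (s.withCounters c) :=
  e.eval_congr (fun a ha => by ext; simp [h.int a ha, Memory.withCounters, ha])
    (fun r hr => by simp [h.counter r hr, Memory.withCounters])
    (fun a ha hw => by rw [h.real a ha hw]; rfl) he

theorem weaken (h : Inside s w f x q c m) : Inside s w f none q c m :=
  ⟨h.int, h.counter, h.real, h.buffer, by simp⟩

theorem setCounter (h : Inside s w f x q c m) (j : ℕ) {c' : ℕ → ℕ} (hq : c' q = j)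
    (hc : ∀ r < q, c' r = c r) : Inside s w f x (q + 1) c' (m.setInt 10 q 0 0 j) where
  int a ha := by ext; simp [Memory.setInt, ha, h.int a ha]
  counter r hr := by
    rcases Nat.lt_succ_iff_lt_or_eq.1 hr with hr | rfl
    · simp [Memory.setInt, hr.ne, h.counter r hr, hc r hr]
    · simp [Memory.setInt, hq]
  real := h.real
  buffer := h.buffer
  acc := h.acc

theorem dropCounter {c' : ℕ → ℕ} (h : Inside s w f x (q + 1) c' m) (hc : ∀ r < q, c' r = c r) :
    Inside s w f x q c m :=
  ⟨h.int, fun r hr => (h.counter r (by omega)).trans (hc r hr), h.real, h.buffer, h.acc⟩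

theorem setAcc (h : Inside s w f x q c m) (hw : w ≠ 9) (y : ℝ) :
    Inside s w f (some y) q c (m.setReal 9 0 0 0 y) where
  int := h.int
  counter := h.counter
  real a ha haw := by rw [← h.real a ha haw]; ext; simp [Memory.setReal, ha]
  buffer := by rw [← h.buffer]; ext; simp [Memory.setReal, hw]
  acc := by simp [Memory.setReal]

theorem setBuffer (h : Inside s w f x q c m) (hw : w ≠ 9) (i j l : ℕ) (y : ℝ) :
    Inside s w (fun i' j' l' => if i' = i ∧ j' = j ∧ l' = l then y else f i' j' l') x q c
      (m.setReal w i j l y) where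
  int := h.int
  counter := h.counter
  real a ha haw := by rw [← h.real a ha haw]; ext; simp [Memory.setReal, haw]
  buffer := by rw [← h.buffer]; ext; simp [Memory.setReal]
  acc y hy := by rw [← h.acc y hy]; simp [Memory.setReal, hw.symm]

/-- A counting loop whose `j`-th pass takes the data `(f j, x j)` to `(f (j + 1), x (j + 1))`. -/
theorem countLoop {bound : IntExpr} {p : Program} {B : ℕ} (N : ℕ)
    (f : ℕ → ℕ → ℕ → ℕ → ℝ) (x : ℕ → Option ℝ) (c' : ℕ → ℕ → ℕ)
    (hq : ∀ j, c' j q = j) (hc : ∀ j, ∀ r < q, c' j r = c r)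
    (h : Inside s w (f 0) (x 0) q c m)
    (hbound : bound.ok q = true) (hN : bound.eval (s.withCounters c) = N)
    (hb : ∀ j < N, ∀ m, Inside s w (f j) (x j) (q + 1) (c' j) m →
      Ends p m B (Inside s w (f (j + 1)) (x (j + 1)) (q + 1) (c' j))) :
    Ends (OrliczRegression.countLoop q bound p) m ((N + 1) * (B + 2))
      (Inside s w (f N) (x N) q c) := by
  refine Ends.mono (T := 1 + (N * ((B + 1) + 1) + 1)) (.seq (.setInt ?_)) (by nlinarith)
    fun m hm => hm
  refine Ends.mono (Ends.loop (B := B + 1) N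
    (fun j => Inside s w (f j) (x j) (q + 1) (c' j)) ?_ ?_ ?_ ?_) le_rfl
    fun m hm => hm.dropCounter (hc N)
  · exact h.setCounter 0 (hq 0) (hc 0)
  · intro j hj m hm
    have h1 : m.int 10 q 0 0 = j := (hm.counter q (by omega)).trans (hq j)
    have h2 := (hm.dropCounter (hc j)).intEval bound hbound
    simp only [Test.Holds, OrliczRegression.counter, IntExpr.eval, h1, h2, hN, hj]
  · intro m hm
    have h1 : m.int 10 q 0 0 = N := (hm.counter q (by omega)).trans (hq N)
    have h2 := (hm.dropCounter (hc N)).intEval bound hbound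
    simp only [Test.Holds, OrliczRegression.counter, IntExpr.eval, h1, h2, hN, lt_irrefl,
      not_false_eq_true]
  · intro j hj m hm
    refine .seq ((hb j hj m hm).mono le_rfl fun m' hm' => .setInt ?_)
    have h1 : m'.int 10 q 0 0 = j := (hm'.counter q (by omega)).trans (hq j)
    simp only [OrliczRegression.counter, IntExpr.eval, h1]
    exact (hm'.dropCounter fun r hr => rfl).setCounter (j + 1) (hq (j + 1))
      fun r hr => (hc (j + 1) r hr).trans (hc j r hr).symm

end Inside

/-! ### Array assignments -/

/-- Values for the five loop counters. -/
def counters (i j l p q : ℕ) : ℕ → ℕ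
  | 0 => i
  | 1 => j
  | 2 => l
  | 3 => p
  | 4 => q
  | _ => 0

/-- Compute `∑ p < n₄, ∑ q < n₅, e` for all `i < n₁`, `j < n₂`, `l < n₃` into the array `8`. -/
def tabulate (n₁ n₂ n₃ n₄ n₅ : IntExpr) (e : RealExpr) : Program :=
  countLoop 0 n₁ <| countLoop 1 n₂ <| countLoop 2 n₃ <|
    .seq (.setReal 9 (.const 0) (.const 0) (.const 0) (.const 0)) <|
    .seq (countLoop 3 n₄ <| countLoop 4 n₅ <|
      .setReal 9 (.const 0) (.const 0) (.const 0)
        (.add (.get 9 (.const 0) (.const 0) (.const 0)) e)) <|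
    .setReal 8 (counter 0) (counter 1) (counter 2) (.get 9 (.const 0) (.const 0) (.const 0))

/-- Copy the cells `i < n₁`, `j < n₂`, `l < n₃` of the array `8` to the array `a`. -/
def copyBuffer (a : ℕ) (n₁ n₂ n₃ : IntExpr) : Program :=
  countLoop 0 n₁ <| countLoop 1 n₂ <| countLoop 2 n₃ <|
    .setReal a (counter 0) (counter 1) (counter 2) (.get 8 (counter 0) (counter 1) (counter 2))

/-- The simultaneous assignment `a[i, j, l] := ∑ p < n₄, ∑ q < n₅, e` for `i < n₁`, `j < n₂`,
`l < n₃`, where `e` may read the array `a`. -/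
def assign (a : ℕ) (n₁ n₂ n₃ n₄ n₅ : IntExpr) (e : RealExpr) : Program :=
  .seq (tabulate n₁ n₂ n₃ n₄ n₅ e) (copyBuffer a n₁ n₂ n₃)

/-! ### Effect and cost of the loop nests -/

section

variable {s m : Memory} {N₁ N₂ N₃ : ℕ}

/-- The nest of three loops which fill a table, cell by cell. -/
theorem Inside.fill {w : ℕ} {n₁ n₂ n₃ : IntExpr} {p : Program} {B : ℕ} {f : ℕ → ℕ → ℕ → ℝ}
    (v : ℕ → ℕ → ℕ → ℝ) {c : ℕ → ℕ} (h : Inside s w f none 0 c m)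
    (ho₁ : n₁.ok 0 = true) (ho₂ : n₂.ok 0 = true) (ho₃ : n₃.ok 0 = true)
    (hn₁ : n₁.eval s = N₁) (hn₂ : n₂.eval s = N₂) (hn₃ : n₃.eval s = N₃)
    (hp : ∀ i < N₁, ∀ j < N₂, ∀ l < N₃, ∀ g m, Inside s w g none 3 (counters i j l 0 0) m →
      Ends p m B (Inside s w
        (fun i' j' l' => if i' = i ∧ j' = j ∧ l' = l then v i j l else g i' j' l') none 3
        (counters i j l 0 0))) :
    Ends (OrliczRegression.countLoop 0 n₁ <| OrliczRegression.countLoop 1 n₂ <|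
      OrliczRegression.countLoop 2 n₃ p) m
      ((N₁ + 1) * ((N₂ + 1) * ((N₃ + 1) * (B + 2) + 2) + 2))
      (Inside s w
        (fun i j l => if i < N₁ ∧ j < N₂ ∧ l < N₃ then v i j l else f i j l) none 0 c) := by
  have e0 : (fun i j l => if i < 0 ∧ j < N₂ ∧ l < N₃ then v i j l else f i j l) = f := by
    ext; simp
  -- Cells are filled in lexicographic order: the invariants of the three loops describe the cells
  -- before i₀, before (i₀, j₀) and before (i₀, j₀, l₀).
  refine Inside.countLoop N₁ (fun i₀ i j l =>
    if i < i₀ ∧ j < N₂ ∧ l < N₃ then v i j l else f i j l) (fun _ => none)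
    (fun i => counters i 0 0 0 0) (fun _ => rfl) (fun _ _ h => absurd h (by omega))
    (by rw [e0]; exact h) ho₁ ((n₁.eval_withCounters ho₁).trans hn₁) fun i₀ hi₀ m hm => ?_
  refine Ends.mono (Inside.countLoop (w := w) (c := counters i₀ 0 0 0 0) N₂ (fun j₀ i j l =>
    if (i < i₀ ∧ j < N₂ ∧ l < N₃) ∨ (i = i₀ ∧ j < j₀ ∧ l < N₃) then v i j l else f i j l)
    (fun _ => none)
    (fun j => counters i₀ j 0 0 0) (fun _ => rfl) ?_ (m := m) (B := (N₃ + 1) * (B + 2)) ?_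
    (n₂.ok_of_ok_zero ho₂) ((n₂.eval_withCounters ho₂).trans hn₂) fun j₀ hj₀ m hm => ?_) le_rfl ?_
  · intro j r hr
    obtain rfl : r = 0 := by omega
    rfl
  · convert hm using 1
    ext i j l
    simp
  · refine Ends.mono (Inside.countLoop (w := w) (c := counters i₀ j₀ 0 0 0) N₃ (fun l₀ i j l =>
      if (i < i₀ ∧ j < N₂ ∧ l < N₃) ∨ (i = i₀ ∧ j < j₀ ∧ l < N₃) ∨ (i = i₀ ∧ j = j₀ ∧ l < l₀)
      then v i j l else f i j l)
      (fun _ => none)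
      (fun l => counters i₀ j₀ l 0 0) (fun _ => rfl) ?_ (m := m) (B := B) ?_
      (n₃.ok_of_ok_zero ho₃) ((n₃.eval_withCounters ho₃).trans hn₃) fun l₀ hl₀ m hm => ?_) le_rfl ?_
    · intro j r hr
      obtain rfl | rfl : r = 0 ∨ r = 1 := by omega
      all_goals rfl
    · convert hm using 1
      ext i j l
      simp
    · refine (hp i₀ hi₀ j₀ hj₀ l₀ hl₀ _ m hm).mono le_rfl fun m hm => ?_
      convert hm using 1
      ext i j l
      by_cases hh : i = i₀ ∧ j = j₀ ∧ l = l₀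
      · obtain ⟨rfl, rfl, rfl⟩ := hh
        simp
      · rw [if_neg hh]
        refine if_congr ?_ rfl rfl
        have : (i = i₀ ∧ j = j₀ ∧ l < l₀ + 1) ↔ (i = i₀ ∧ j = j₀ ∧ l < l₀) := by omega
        rw [this]
    · intro m hm
      convert hm using 1
      ext i j l
      refine if_congr ?_ rfl rfl
      omega
  · intro m hm
    convert hm using 1
    ext i j l
    refine if_congr ?_ rfl rfl
    omega

theorem counters_agree {i j l p q p' q' : ℕ} {r : ℕ} (hr : r < 3) :
    counters i j l p q r = counters i j l p' q' r := by
  interval_cases r <;> rfl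

/-- The accumulator holds the partial sum of the two inner loops. Since `e` reads neither the buffer
nor the accumulator, its values are those in the memory `s` before the loops. -/
theorem tabulate_ends {n₁ n₂ n₃ n₄ n₅ : IntExpr} {e : RealExpr} {N₄ N₅ : ℕ}
    {f : ℕ → ℕ → ℕ → ℝ} {c : ℕ → ℕ} (h : Inside s 8 f none 0 c m)
    (ho₁ : n₁.ok 0 = true) (ho₂ : n₂.ok 0 = true) (ho₃ : n₃.ok 0 = true) (ho₄ : n₄.ok 0 = true)
    (ho₅ : n₅.ok 0 = true) (he : e.ok 5 8 = true)
    (hn₁ : n₁.eval s = N₁) (hn₂ : n₂.eval s = N₂) (hn₃ : n₃.eval s = N₃)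
    (hn₄ : n₄.eval s = N₄) (hn₅ : n₅.eval s = N₅) :
    Ends (tabulate n₁ n₂ n₃ n₄ n₅ e) m
      ((N₁ + 1) * ((N₂ + 1) * ((N₃ + 1) * ((1 + ((N₄ + 1) * ((N₅ + 1) * 3 + 2) + 1)) + 2) + 2) + 2))
      (Inside s 8 (fun i j l => if i < N₁ ∧ j < N₂ ∧ l < N₃ then
        ∑ p ∈ Finset.range N₄, ∑ q ∈ Finset.range N₅, e.eval (s.withCounters (counters i j l p q))
        else f i j l) none 0 c) := by
  refine Inside.fill _ h ho₁ ho₂ ho₃ hn₁ hn₂ hn₃ fun i _ j _ l _ g m hm => ?_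
  refine .seq (.setReal ?_)
  have hm0 := hm.setAcc (by norm_num) 0
  simp only [IntExpr.eval, RealExpr.eval, Rat.cast_zero]
  refine .seq ?_
  let S : ℕ → ℕ → ℝ := fun p q => e.eval (s.withCounters (counters i j l p q))
  refine Ends.mono (Inside.countLoop (w := 8) (s := s) (c := counters i j l 0 0) (B := (N₅ + 1) * 3)
    N₄ (fun _ => g)
    (fun P => some (∑ p ∈ Finset.range P, ∑ q ∈ Finset.range N₅, S p q))
    (fun p => counters i j l p 0) (fun _ => rfl) (fun p r hr => counters_agree hr) (by simpa using hm0)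
    (n₄.ok_of_ok_zero ho₄) ((n₄.eval_withCounters ho₄).trans hn₄) fun p hp m hm => ?_) le_rfl
    fun m hm => .setReal ?_
  · refine Ends.mono (Inside.countLoop (w := 8) (s := s) (c := counters i j l p 0) (B := 1)
      N₅ (fun _ => g)
      (fun Q => some (∑ p ∈ Finset.range p, ∑ q ∈ Finset.range N₅, S p q
        + ∑ q ∈ Finset.range Q, S p q))
      (fun q => counters i j l p q) (fun _ => rfl) ?_ (by simpa using hm)
      (n₅.ok_of_ok_zero ho₅) ((n₅.eval_withCounters ho₅).trans hn₅) fun q hq m hm => ?_) le_rfl ?_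
    · intro q r hr
      interval_cases r <;> rfl
    · refine .setReal ?_
      have h1 := hm.acc _ rfl
      have h2 := hm.realEval e he
      simp only [IntExpr.eval, RealExpr.eval, h1, h2]
      rw [Finset.sum_range_succ, ← add_assoc]
      exact hm.setAcc (by norm_num) _
    · intro m hm
      rw [← Finset.sum_range_succ (fun p => ∑ q ∈ Finset.range N₅, S p q)] at hm
      exact hm
  · have h0 := hm.counter 0 (by norm_num)
    have h1 := hm.counter 1 (by norm_num)
    have h2 := hm.counter 2 (by norm_num)
    have h3 := hm.acc _ rfl
    simp only [counter, IntExpr.eval, RealExpr.eval, h0, h1, h2, h3]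
    exact hm.weaken.setBuffer (by norm_num) i j l _

theorem copyBuffer_ends {n₁ n₂ n₃ : IntExpr} {a : ℕ}
    {f : ℕ → ℕ → ℕ → ℝ} {c : ℕ → ℕ} (h : Inside s a f none 0 c m) (ha9 : a ≠ 9) (ha8 : a ≠ 8)
    (ho₁ : n₁.ok 0 = true) (ho₂ : n₂.ok 0 = true) (ho₃ : n₃.ok 0 = true)
    (hn₁ : n₁.eval s = N₁) (hn₂ : n₂.eval s = N₂) (hn₃ : n₃.eval s = N₃) :
    Ends (copyBuffer a n₁ n₂ n₃) m
      ((N₁ + 1) * ((N₂ + 1) * ((N₃ + 1) * (1 + 2) + 2) + 2))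
      (Inside s a (fun i j l => if i < N₁ ∧ j < N₂ ∧ l < N₃ then s.real 8 i j l else f i j l)
        none 0 c) := by
  refine Inside.fill _ h ho₁ ho₂ ho₃ hn₁ hn₂ hn₃ fun i _ j _ l _ g m hm => .setReal ?_
  have h0 := hm.counter 0 (by norm_num)
  have h1 := hm.counter 1 (by norm_num)
  have h2 := hm.counter 2 (by norm_num)
  have h3 := hm.real 8 (by norm_num) ha8.symm
  simp only [counter, IntExpr.eval, RealExpr.eval, h0, h1, h2, h3]
  exact hm.setBuffer ha9 i j l _

end

/-! ### Reasoning up to counters, accumulator and buffer -/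

/-- The memories agree except for the counters, the accumulator and the buffer. -/
structure Memory.Agrees (s s' : Memory) : Prop where
  int : ∀ a, a ≠ 10 → s.int a = s'.int a
  real : ∀ a, a ≠ 9 → a ≠ 8 → s.real a = s'.real a

theorem Memory.Agrees.refl (s : Memory) : s.Agrees s := ⟨fun _ _ => rfl, fun _ _ _ => rfl⟩

/-- Started in any memory which agrees with `s`, the program `p` halts within `T` steps in a
memory which agrees with one satisfying `Q`. -/
def Computes (p : Program) (s : Memory) (T : ℕ) (Q : Memory → Prop) : Prop :=
  ∀ m : Memory, m.Agrees s → Ends p m T fun m' => ∃ s', m'.Agrees s' ∧ Q s'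

namespace Computes

variable {p p' : Program} {s : Memory} {T T' : ℕ} {Q Q' : Memory → Prop}

theorem mono (h : Computes p s T Q) (hT : T ≤ T') (hQ : ∀ s, Q s → Q' s) : Computes p s T' Q' :=
  fun m hm => (h m hm).mono hT fun _ ⟨s', hs, hq⟩ => ⟨s', hs, hQ _ hq⟩

theorem seq (h : Computes p s T fun s' => Computes p' s' T' Q) :
    Computes (.seq p p') s (T + T') Q :=
  fun m hm => .seq ((h m hm).mono le_rfl fun m' ⟨_, hs, hq⟩ => hq m' hs)

theorem skip (h : Q s) : Computes .skip s 1 Q := fun _ hm => .skip ⟨s, hm, h⟩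

/-- The test reads neither counters nor the accumulator nor the buffer. -/
def _root_.OrliczRegression.Test.ok : Test → Bool
  | .intLt e f => e.ok 0 && f.ok 0
  | .realLt e f => e.ok 0 8 && f.ok 0 8
  | .realLe e f => e.ok 0 8 && f.ok 0 8

theorem holds_iff {c : Test} (hc : c.ok = true) {m : Memory} (h : m.Agrees s) :
    c.Holds m ↔ c.Holds s := by
  cases c <;> simp only [Test.ok, Bool.and_eq_true] at hc <;> simp only [Test.Holds]
  · rw [IntExpr.eval_congr h.int (by simp) _ hc.1, IntExpr.eval_congr h.int (by simp) _ hc.2]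
  all_goals rw [RealExpr.eval_congr h.int (by simp) h.real _ hc.1,
    RealExpr.eval_congr h.int (by simp) h.real _ hc.2]

theorem ite {c : Test} (hc : c.ok = true) (h : c.Holds s → Computes p s T Q)
    (h' : ¬ c.Holds s → Computes p' s T Q) : Computes (.ite c p p') s (T + 1) Q :=
  fun m hm => .ite (fun hh => h ((holds_iff hc hm).1 hh) m hm)
    fun hh => h' (fun h'' => hh ((holds_iff hc hm).2 h'')) m hm

theorem loop {c : Test} {B : ℕ} (N : ℕ) (I : ℕ → Memory → Prop) (hok : c.ok = true)
    (h0 : I 0 s) (hc : ∀ j < N, ∀ s, I j s → c.Holds s) (hN : ∀ s, I N s → ¬ c.Holds s)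
    (hb : ∀ j < N, ∀ s, I j s → Computes p s B (I (j + 1))) :
    Computes (.loop c p) s (N * (B + 1) + 1) (I N) := by
  intro m hm
  refine Ends.loop N (fun j m => ∃ s, m.Agrees s ∧ I j s) ⟨s, hm, h0⟩ ?_ ?_ ?_
  · rintro j hj m ⟨s, hs, hI⟩
    exact (holds_iff hok hs).2 (hc j hj s hI)
  · rintro m ⟨s, hs, hI⟩ h
    exact hN s hI ((holds_iff hok hs).1 h)
  · rintro j hj m ⟨s, hs, hI⟩
    exact hb j hj s hI m hs

theorem setInt {a : ℕ} {i j l e : IntExpr} (hi : i.ok 0 = true) (hj : j.ok 0 = true)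
    (hl : l.ok 0 = true) (he : e.ok 0 = true)
    (h : Q (s.setInt a (i.eval s) (j.eval s) (l.eval s) (e.eval s))) :
    Computes (.setInt a i j l e) s 1 Q := by
  intro m hm
  refine .setInt ⟨s.setInt a (i.eval s) (j.eval s) (l.eval s) (e.eval s),
    ⟨fun a' ha' => ?_, fun a' h9 h8 => hm.real a' h9 h8⟩, h⟩
  rw [i.eval_congr hm.int (by simp) hi, j.eval_congr hm.int (by simp) hj,
    l.eval_congr hm.int (by simp) hl, e.eval_congr hm.int (by simp) he]
  ext
  simp [Memory.setInt, hm.int a' ha']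

/-- Filling a buffer before copying makes the assignment simultaneous, so `e` is evaluated in the
old memory throughout. Five nested loops of lengths below M explain M⁵. -/
theorem assign {a : ℕ} {n₁ n₂ n₃ n₄ n₅ : IntExpr} {e : RealExpr} {M : ℕ}
    (ha9 : a ≠ 9) (ha8 : a ≠ 8)
    (hok : (n₁.ok 0 && n₂.ok 0 && n₃.ok 0 && n₄.ok 0 && n₅.ok 0 && e.ok 5 8) = true)
    (h₁ : n₁.eval s + 1 ≤ M) (h₂ : n₂.eval s + 1 ≤ M) (h₃ : n₃.eval s + 1 ≤ M)
    (h₄ : n₄.eval s + 1 ≤ M) (h₅ : n₅.eval s + 1 ≤ M)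
    (hQ : ∀ s' : Memory, s'.int = s.int → (∀ a', a' ≠ a → s'.real a' = s.real a') →
      (∀ i < n₁.eval s, ∀ j < n₂.eval s, ∀ l < n₃.eval s, s'.real a i j l =
        ∑ p ∈ Finset.range (n₄.eval s), ∑ q ∈ Finset.range (n₅.eval s),
          e.eval (s.withCounters (counters i j l p q))) → Q s') :
    Computes (assign a n₁ n₂ n₃ n₄ n₅ e) s (20 * M ^ 5) Q := by
  simp only [Bool.and_eq_true] at hok
  obtain ⟨⟨⟨⟨⟨ho₁, ho₂⟩, ho₃⟩, ho₄⟩, ho₅⟩, he⟩ := hok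
  intro m hm
  have h0 : Inside s 8 (m.real 8) none 0 (fun _ => 0) m :=
    ⟨hm.int, by simp, hm.real, rfl, by simp⟩
  refine Ends.mono (.seq ((tabulate_ends h0 ho₁ ho₂ ho₃ ho₄ ho₅ he rfl rfl rfl rfl rfl).mono le_rfl
    (Q' := fun m' => Ends (copyBuffer a n₁ n₂ n₃) m' ((n₁.eval s + 1) * ((n₂.eval s + 1) *
      ((n₃.eval s + 1) * (1 + 2) + 2) + 2)) fun m' => ∃ s', m'.Agrees s' ∧ Q s')
    fun m' hm' => ?_)) ?_ fun _ h => h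
  · have e' : ∀ n : IntExpr, n.ok 0 = true → n.eval m' = n.eval s := fun n hn =>
      (hm'.intEval n hn).trans (n.eval_withCounters hn)
    have h1 : Inside m' a (m'.real a) none 0 (fun _ => 0) m' :=
      ⟨fun _ _ => rfl, by simp, fun _ _ _ => rfl, rfl, by simp⟩
    refine (copyBuffer_ends h1 ha9 ha8 ho₁ ho₂ ho₃ (e' _ ho₁) (e' _ ho₂) (e' _ ho₃)).mono le_rfl ?_
    intro m'' hm''
    refine ⟨⟨s.int, fun a' => if a' = a then m''.real a else s.real a'⟩, ⟨?_, ?_⟩, hQ _ rfl ?_ ?_⟩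
    · intro a' ha'
      rw [hm''.int a' ha', hm'.int a' ha']
    · intro a' h9 h8
      by_cases ha : a' = a
      · subst ha
        simp
      · simp only [ha, if_false]
        rw [hm''.real a' h9 ha, hm'.real a' h9 h8]
    · intro a' ha
      simp [ha]
    · intro i hi j hj l hl
      simp only [if_true, hm''.buffer, hi, hj, hl, and_self, hm'.buffer]
  · generalize n₁.eval s + 1 = X₁ at *
    generalize n₂.eval s + 1 = X₂ at *
    generalize n₃.eval s + 1 = X₃ at *
    generalize n₄.eval s + 1 = X₄ at *
    generalize n₅.eval s + 1 = X₅ at *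
    have hM : 1 ≤ M ∨ M = 0 := by omega
    rcases hM with hM | rfl
    · have p1 : 1 ≤ M ^ 1 := Nat.one_le_pow _ _ hM
      have p2 : M ^ 1 ≤ M ^ 2 := Nat.pow_le_pow_right hM (by norm_num)
      have p3 : M ^ 2 ≤ M ^ 3 := Nat.pow_le_pow_right hM (by norm_num)
      have p4 : M ^ 3 ≤ M ^ 4 := Nat.pow_le_pow_right hM (by norm_num)
      have p5 : M ^ 4 ≤ M ^ 5 := Nat.pow_le_pow_right hM (by norm_num)
      calc _ ≤ M * (M * (M * ((1 + (M * (M * 3 + 2) + 1)) + 2) + 2) + 2) +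
            M * (M * (M * (1 + 2) + 2) + 2) := by gcongr
        _ = 3 * M ^ 5 + 2 * M ^ 4 + 7 * M ^ 3 + 4 * M ^ 2 + 4 * M ^ 1 := by ring
        _ ≤ _ := by omega
    · simp at h₁ h₂ h₃ h₄ h₅
      subst h₁
      simp

end Computes

/-! ### Forming the sketch -/

/-- The `i`-th of the sizes `k, d, t₁, t₂, t₃`. -/
def sizeExpr (i : ℕ) : IntExpr := .get 0 (.const i) (.const 0) (.const 0)

/-- The sizes stored in the memory. -/
structure Sizes (s : Memory) (k d t₁ t₂ t₃ : ℕ) : Prop where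
  k : s.int 0 0 0 0 = k
  d : s.int 0 1 0 0 = d
  t₁ : s.int 0 2 0 0 = t₁
  t₂ : s.int 0 3 0 0 = t₂
  t₃ : s.int 0 4 0 0 = t₃

theorem Sizes.of_int {s s' : Memory} {k d t₁ t₂ t₃ : ℕ} (h : Sizes s k d t₁ t₂ t₃)
    (hi : s'.int 0 = s.int 0) : Sizes s' k d t₁ t₂ t₃ := by
  constructor <;> rw [hi]
  exacts [h.k, h.d, h.t₁, h.t₂, h.t₃]

/-- Row number of the current list entry. -/
def rowExpr : IntExpr := .get 2 (counter 0) (counter 1) (.const 0)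

/-- Column number of the current list entry. -/
def colExpr : IntExpr := .get 3 (counter 0) (counter 1) (.const 0)

/-- Hash value of the row of the current list entry. -/
def hashExpr : IntExpr := .get 4 (counter 0) rowExpr (.const 0)

/-- Apply the sparse embedding: one update of the array `12` for each nonzero entry of `[A b]`. -/
def scatter : Program :=
  countLoop 0 (sizeExpr 0) <| countLoop 1 (.get 1 (counter 0) (.const 0) (.const 0)) <|
    .setReal 12 (counter 0) hashExpr colExpr <|
      .add (.get 12 (counter 0) hashExpr colExpr) <|
        .div (.mul (.get 1 (counter 0) (counter 1) (.const 0))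
          (.get 3 (counter 0) rowExpr (.const 0))) (.get 2 (counter 0) rowExpr (.const 0))

/-- The value added to the array `12` for the `p`-th list entry of block `i`. -/
def scatterValue (s : Memory) (i p : ℕ) : ℝ :=
  s.real 1 i p 0 * s.real 3 i (s.int 2 i p 0) 0 / s.real 2 i (s.int 2 i p 0) 0

/-- The only phase whose cost depends on the input length: a constant number of steps per listed
entry. It updates in place, since a tabulated assignment would range over all rows. -/
theorem scatter_computes {s : Memory} {k Λ : ℕ} {Q : Memory → Prop} (hk : s.int 0 0 0 0 = k)
    (hΛ : ∀ i < k, s.int 1 i 0 0 ≤ Λ)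
    (hQ : ∀ s' : Memory, s'.int = s.int → (∀ a', a' ≠ 12 → s'.real a' = s.real a') →
      (∀ i a l, s'.real 12 i a l = s.real 12 i a l + ∑ i' ∈ Finset.range k,
        ∑ p ∈ Finset.range (s.int 1 i' 0 0),
          if i = i' ∧ a = s.int 4 i' (s.int 2 i' p 0) 0 ∧ l = s.int 3 i' p 0
          then scatterValue s i' p else 0) → Q s') :
    Computes scatter s ((k + 1) * ((Λ + 1) * 3 + 2)) Q := by
  intro m hm
  have hm0 : Inside m 12 (m.real 12) none 0 (fun _ => 0) m :=
    ⟨fun _ _ => rfl, by simp, fun _ _ _ => rfl, rfl, by simp⟩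
  let v : ℕ → ℕ → ℕ → ℕ → ℕ → ℝ := fun i' p i a l =>
    if i = i' ∧ a = m.int 4 i' (m.int 2 i' p 0) 0 ∧ l = m.int 3 i' p 0
      then scatterValue m i' p else 0
  have hkm : m.int 0 0 0 0 = k := by rw [hm.int 0 (by norm_num), hk]
  refine Ends.mono (Inside.countLoop (w := 12) (s := m) (c := fun _ => 0) (B := (Λ + 1) * 3) k
    (fun I i a l => m.real 12 i a l + ∑ i' ∈ Finset.range I,
      ∑ p ∈ Finset.range (m.int 1 i' 0 0), v i' p i a l) (fun _ => none)
    (fun i => counters i 0 0 0 0) (fun _ => rfl) (fun _ _ h => absurd h (by omega))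
    (by simpa using hm0) rfl ?_ fun i hi m' hm' => ?_) le_rfl ?_
  · simpa [sizeExpr, IntExpr.eval, Memory.withCounters] using hkm
  · have hlen : m.int 1 i 0 0 ≤ Λ := by rw [hm.int 1 (by norm_num)]; exact hΛ i hi
    refine Ends.mono (Inside.countLoop (w := 12) (s := m) (c := counters i 0 0 0 0) (B := 1)
      (m.int 1 i 0 0)
      (fun P i₁ a l => m.real 12 i₁ a l + ∑ i' ∈ Finset.range i,
        ∑ p ∈ Finset.range (m.int 1 i' 0 0), v i' p i₁ a l + ∑ p ∈ Finset.range P, v i p i₁ a l)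
      (fun _ => none)
      (fun j => counters i j 0 0 0) (fun _ => rfl) ?_ (by simpa using hm') rfl rfl
      fun p hp m'' hm'' => ?_) ?_ ?_
    · intro j r hr
      interval_cases r
      rfl
    · refine .setReal ?_
      have h0 := hm''.counter 0 (by norm_num)
      have h1 := hm''.counter 1 (by norm_num)
      have e2 := hm''.int 2 (by norm_num)
      have e3 := hm''.int 3 (by norm_num)
      have e4 := hm''.int 4 (by norm_num)
      have r1 := hm''.real 1 (by norm_num) (by norm_num)
      have r2 := hm''.real 2 (by norm_num) (by norm_num)
      have r3 := hm''.real 3 (by norm_num) (by norm_num)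
      simp only [counters] at h0 h1
      simp only [counter, hashExpr, rowExpr, colExpr, IntExpr.eval, RealExpr.eval, h0, h1, e2, e3,
        e4, r1, r2, r3, hm''.buffer]
      convert hm''.setBuffer (by norm_num) i (m.int 4 i (m.int 2 i p 0) 0) (m.int 3 i p 0) _
        using 1
      ext i₁ a l
      rw [Finset.sum_range_succ]
      by_cases h : i₁ = i ∧ a = m.int 4 i (m.int 2 i p 0) 0 ∧ l = m.int 3 i p 0
      · obtain ⟨rfl, rfl, rfl⟩ := h
        simp only [and_self, if_true, v, scatterValue]
        ring
      · simp only [h, if_false, v]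
        ring
    · gcongr
    · intro m'' hm''
      convert hm'' using 1
      ext i₁ a l
      rw [Finset.sum_range_succ, add_assoc]
  · intro m' hm'
    refine ⟨⟨s.int, fun a => if a = 12 then m'.real 12 else s.real a⟩, ⟨?_, ?_⟩, hQ _ rfl ?_ ?_⟩
    · intro a ha
      rw [hm'.int a ha, hm.int a ha]
    · intro a h9 h8
      by_cases ha : a = 12
      · subst ha
        simp
      · simp only [ha, if_false]
        rw [hm'.real a h9 ha, hm.real a h9 h8]
    · intro a ha
      simp [ha]
    · intro i a l
      simp only [if_true, hm'.buffer, v, scatterValue]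
      rw [hm.int 1 (by norm_num), hm.int 2 (by norm_num), hm.int 3 (by norm_num),
        hm.int 4 (by norm_num), hm.real 1 (by norm_num) (by norm_num),
        hm.real 2 (by norm_num) (by norm_num), hm.real 3 (by norm_num) (by norm_num),
        hm.real 12 (by norm_num) (by norm_num)]

/-- Form `S [A b]` in the array `7`. -/
def formSketch : Program :=
  .seq scatter <|
  .seq (assign 13 (sizeExpr 0) (sizeExpr 3) (.succ (sizeExpr 1)) (sizeExpr 2) (.const 1) <|
    .mul (.div (.const 1) (.sqrt (.ofInt (sizeExpr 3)))) <|
      .mul (.get 4 (counter 0) (counter 1) (counter 3))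
        (.get 12 (counter 0) (counter 3) (counter 2))) <|
  assign 7 (sizeExpr 0) (sizeExpr 4) (.succ (sizeExpr 1)) (sizeExpr 3) (.const 1) <|
    .mul (.div (.sqrt (.div .pi (.const 2))) (.ofInt (sizeExpr 4))) <|
      .mul (.get 5 (counter 0) (counter 1) (counter 3))
        (.get 13 (counter 0) (counter 3) (counter 2))

/-! ### Correctness and cost of forming the sketch -/

section

variable {k d : ℕ} {n : Fin k → ℕ} {t₁ t₂ t₃ : ℕ}
  {A : (i : Fin k) → Matrix (Fin (n i)) (Fin d) ℝ} {b : (i : Fin k) → Fin (n i) → ℝ}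
  {L : (i : Fin k) → List (Fin (n i) × Fin (d + 1))} {ω : Draw n t₁ t₂ t₃} {ε : ℝ}

theorem pad_of_lt {α : Type} [Zero α] {m : ℕ} (f : Fin m → α) (i : Fin m) : pad f i = f i := by
  simp [pad]

/-- Zero entries contribute nothing, so summing over the list in any order equals summing over all
positions. -/
theorem sum_get_of_listsNonzeros {m n : ℕ} {L : List (Fin m × Fin n)}
    {M : Matrix (Fin m) (Fin n) ℝ} (h : ListsNonzeros L M) (F : Fin m → Fin n → ℝ → ℝ)
    (hF : ∀ r c, F r c 0 = 0) :
    ∑ p : Fin L.length, F (L.get p).1 (L.get p).2 (M (L.get p).1 (L.get p).2)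
      = ∑ r, ∑ c, F r c (M r c) := by
  rw [← Fintype.sum_prod_type' (f := fun r c => F r c (M r c))]
  have h1 : ∑ p : Fin L.length, F (L.get p).1 (L.get p).2 (M (L.get p).1 (L.get p).2)
      = (L.map fun x => F x.1 x.2 (M x.1 x.2)).sum := by
    rw [← List.sum_ofFn]
    congr 1
    apply List.ext_get <;> simp
  rw [h1, ← List.sum_toFinset _ h.1]
  refine Finset.sum_subset (Finset.subset_univ _) fun x _ hx => ?_
  rw [List.mem_toFinset, h.2, not_not] at hx
  rw [hx, hF]

theorem length_of_listsNonzeros {m d : ℕ} {A : Matrix (Fin m) (Fin d) ℝ} {b : Fin m → ℝ}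
    {L : List (Fin m × Fin (d + 1))} (h : ListsNonzeros L (augment A b)) :
    L.length = nnz A + nnzVec b := by
  classical
  rw [← List.toFinset_card_of_nodup h.1]
  have e : L.toFinset = Finset.univ.filter fun p : Fin m × Fin (d + 1) => augment A b p.1 p.2 ≠ 0 := by
    ext p
    simp [h.2]
  rw [e, nnz, nnzVec, Nat.card_eq_fintype_card, Nat.card_eq_fintype_card, Fintype.card_subtype,
    Fintype.card_subtype, Finset.card_filter, Finset.card_filter, Finset.card_filter,
    Fintype.sum_prod_type, Fintype.sum_prod_type, ← Finset.sum_add_distrib]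
  refine Finset.sum_congr rfl fun r _ => ?_
  rw [Fin.sum_univ_castSucc]
  simp [augment]

theorem initialMemory_sizes : Sizes (initialMemory A b L ε ω) k d t₁ t₂ t₃ := ⟨rfl, rfl, rfl, rfl, rfl⟩

/-- Identifies the accumulated updates with the entries of Π₁D⁻¹[A b]. -/
theorem initialMemory_scatter (hL : ∀ i, ListsNonzeros (L i) (augment (A i) (b i)))
    (i : Fin k) (a : Fin t₁) (l : Fin (d + 1)) :
    ∑ i' ∈ Finset.range k, ∑ p ∈ Finset.range ((initialMemory A b L ε ω).int 1 i' 0 0),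
      (if (i : ℕ) = i' ∧ (a : ℕ) = (initialMemory A b L ε ω).int 4 i'
          ((initialMemory A b L ε ω).int 2 i' p 0) 0 ∧
          (l : ℕ) = (initialMemory A b L ε ω).int 3 i' p 0
        then scatterValue (initialMemory A b L ε ω) i' p else 0)
      = sparseMap (ω i).2.1 (ω i).2.2.1
        (fun r => ((ω i).1 r)⁻¹ * augment (A i) (b i) r l) a := by
  rw [Finset.sum_eq_single (i : ℕ)]
  · have h1 : (initialMemory A b L ε ω).int 1 i 0 0 = (L i).length := by
      simp [initialMemory, pad_of_lt]
    rw [h1, Finset.sum_range]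
    let F : Fin (n i) → Fin (d + 1) → ℝ → ℝ := fun r c v =>
      if (ω i).2.2.1 r = a ∧ c = l then boolSign ((ω i).2.1 r) * (((ω i).1 r)⁻¹ * v) else 0
    have h2 : ∀ p : Fin (L i).length,
        (if (i : ℕ) = i ∧ (a : ℕ) = (initialMemory A b L ε ω).int 4 i
          ((initialMemory A b L ε ω).int 2 i p 0) 0 ∧
          (l : ℕ) = (initialMemory A b L ε ω).int 3 i p 0
        then scatterValue (initialMemory A b L ε ω) i p else 0)
        = F ((L i).get p).1 ((L i).get p).2
          (augment (A i) (b i) ((L i).get p).1 ((L i).get p).2) := by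
      intro p
      simp only [initialMemory, pad_of_lt, scatterValue, BlockDraw.hash, BlockDraw.diag,
        BlockDraw.sign, true_and, F]
      refine if_congr ?_ ?_ rfl
      · rw [Fin.ext_iff, Fin.ext_iff, eq_comm, @eq_comm _ (l : ℕ)]
      · rw [div_eq_mul_inv, boolSign]
        ring
    refine ((Finset.sum_congr rfl fun p _ => h2 p).trans
      (sum_get_of_listsNonzeros (hL i) F (by simp [F]))).trans ?_
    simp only [F]
    rw [sparseMap]
    refine Finset.sum_congr rfl fun r _ => ?_
    rw [Finset.sum_eq_single l]
    · simp only [and_true]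
      split_ifs <;> ring
    · intro c _ hc
      simp [hc]
    · simp
  · intro i' _ hi
    refine Finset.sum_eq_zero fun p _ => ?_
    rw [if_neg]
    exact fun h => hi h.1.symm
  · simp

/-- After the scatter, Π₂ and B are applied as dense products whose sizes do not involve n; only the
first summand of the time contains the number of nonzeros. -/
theorem formSketch_computes (hL : ∀ i, ListsNonzeros (L i) (augment (A i) (b i)))
    {M : ℕ} (hM : k + d + t₁ + t₂ + t₃ + 2 ≤ M) {Q : Memory → Prop}
    (hQ : ∀ s : Memory, s.int = (initialMemory A b L ε ω).int →
      (∀ a, a ≠ 7 → a ≠ 12 → a ≠ 13 → s.real a = (initialMemory A b L ε ω).real a) →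
      HoldsSketch A b ω s → Q s) :
    Computes formSketch (initialMemory A b L ε ω)
      ((k + 1) * ((∑ i, (nnz (A i) + nnzVec (b i)) + 1) * 3 + 2) + (20 * M ^ 5 + 20 * M ^ 5)) Q := by
  set s₀ := initialMemory A b L ε ω with hs₀
  have hz : Sizes s₀ k d t₁ t₂ t₃ := initialMemory_sizes
  refine .seq (scatter_computes hz.k ?_ fun s₁ hi₁ hr₁ hv₁ => ?_)
  · intro i hi
    have : s₀.int 1 i 0 0 = (L ⟨i, hi⟩).length := by
      simp [s₀, initialMemory, pad, hi]
    rw [this, length_of_listsNonzeros (hL ⟨i, hi⟩)]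
    exact Finset.single_le_sum (f := fun i => nnz (A i) + nnzVec (b i)) (fun _ _ => Nat.zero_le _)
      (Finset.mem_univ (⟨i, hi⟩ : Fin k))
  have hz₁ := hz.of_int (s' := s₁) (by rw [hi₁])
  refine .seq (.assign (by norm_num) (by norm_num) rfl ?_ ?_ ?_ ?_ ?_ fun s₂ hi₂ hr₂ hv₂ => ?_)
  iterate 5 (simp only [sizeExpr, IntExpr.eval, hz₁.k, hz₁.d, hz₁.t₁, hz₁.t₂]; omega)
  have hz₂ := hz₁.of_int (s' := s₂) (by rw [hi₂])
  refine .assign (by norm_num) (by norm_num) rfl ?_ ?_ ?_ ?_ ?_ fun s₃ hi₃ hr₃ hv₃ => ?_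
  iterate 5 (simp only [sizeExpr, IntExpr.eval, hz₂.k, hz₂.d, hz₂.t₂, hz₂.t₃]; omega)
  refine hQ s₃ (by rw [hi₃, hi₂, hi₁]) (fun a h7 h12 h13 => by
    rw [hr₃ a h7, hr₂ a h13, hr₁ a h12]) ?_
  simp only [sizeExpr, IntExpr.eval, RealExpr.eval, hz₁.k, hz₁.d, hz₁.t₁, hz₁.t₂, hz₂.k,
    hz₂.d, hz₂.t₂, hz₂.t₃, counter, Memory.withCounters, counters, if_true,
    OfNat.zero_ne_ofNat, if_false, Finset.range_one, Finset.sum_singleton] at hv₂ hv₃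
  intro i u j
  have e12 : ∀ a : Fin t₁, s₁.real 12 i a j = sparseMap (ω i).2.1 (ω i).2.2.1
        (fun r => ((ω i).1 r)⁻¹ * augment (A i) (b i) r j) a := by
    intro a
    rw [hv₁, hs₀, initialMemory_scatter hL]
    simp [initialMemory]
  have e4 : ∀ (v : Fin t₂) (a : Fin t₁), s₁.real 4 i v a = (ω i).2.2.2.1 v a := by
    intro v a
    rw [hr₁ 4 (by norm_num)]
    simp [hs₀, initialMemory, pad_of_lt, BlockDraw.gauss]
  have e5 : ∀ (v : Fin t₂), s₂.real 5 i u v = (ω i).2.2.2.2 u v := by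
    intro v
    rw [hr₂ 5 (by norm_num), hr₁ 5 (by norm_num)]
    simp [hs₀, initialMemory, pad_of_lt, BlockDraw.gaussL1]
  have e13 : ∀ v : Fin t₂, s₂.real 13 i v j = 1 / √(t₂ : ℝ) * ∑ a, (ω i).2.2.2.1 v a *
      sparseMap (ω i).2.1 (ω i).2.2.1 (fun r => ((ω i).1 r)⁻¹ * augment (A i) (b i) r j) a := by
    intro v
    rw [hv₂ i i.2 v v.2 j j.2, Finset.sum_range, Finset.mul_sum]
    refine Finset.sum_congr rfl fun a _ => ?_
    rw [e12, e4]
    simp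
  rw [hv₃ i i.2 u u.2 j j.2, Finset.sum_range]
  have key : (sketch ω * stack fun i => augment (A i) (b i)) ⟨i, u⟩ j
      = ((ω i).matrix *ᵥ fun r => augment (A i) (b i) r j) u := by
    rw [sketch_eq, Matrix.mul_apply, Fintype.sum_sigma, Finset.sum_eq_single i]
    · simp [Matrix.mulVec, dotProduct, stack, blockDiagonal'_apply_eq]
    · intro i' _ hi
      refine Finset.sum_eq_zero fun r _ => ?_
      rw [blockDiagonal'_apply_ne _ _ _ hi.symm, zero_mul]
    · simp
  rw [key, BlockDraw.matrix_mulVec_apply, Finset.mul_sum]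
  refine Finset.sum_congr rfl fun v _ => ?_
  rw [e5, e13]
  simp

end

/-! ### Orthogonalising the sketch -/

/-- `|e|`. -/
def absExpr (e : RealExpr) : RealExpr := .sqrt (.mul e e)

/-- The indicator of `x = y`, using `0 / 0 = 0`. -/
def indicatorExpr (x y : IntExpr) : RealExpr :=
  .sub (.const 1) (.div (.sub (.ofInt x) (.ofInt y)) (.sub (.ofInt x) (.ofInt y)))

theorem absExpr_eval (s : Memory) (e : RealExpr) : (absExpr e).eval s = |e.eval s| := by
  simp [absExpr, RealExpr.eval, Real.sqrt_mul_self_eq_abs]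

theorem indicatorExpr_eval (s : Memory) (x y : IntExpr) :
    (indicatorExpr x y).eval s = if x.eval s = y.eval s then 1 else 0 := by
  simp only [indicatorExpr, RealExpr.eval]
  split_ifs with h
  · simp [h]
  · have : ((x.eval s : ℝ) - y.eval s) ≠ 0 := by
      rw [sub_ne_zero]
      exact_mod_cast h
    simp [div_self this]

/-- The entry `a[i]` of an array used as a vector. -/
def vecExpr (a : ℕ) (i : IntExpr) : RealExpr := .get a i (.const 0) (.const 0)

/-- The entry `a[i, j]` of an array used as a matrix. -/
def matExpr (a : ℕ) (i j : IntExpr) : RealExpr := .get a i j (.const 0)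

/-- The column which is being orthogonalised. -/
def pivotExpr : IntExpr := .get 11 (.const 0) (.const 0) (.const 0)

/-- One step of the Gram–Schmidt process for the array `7`, with orthonormal columns in the array
`14` and the transformation in the array `15`. -/
def gramStep : Program :=
  .seq (assign 16 (sizeExpr 1) (.const 1) (.const 1) (sizeExpr 0) (sizeExpr 4) <|
    .mul (.get 14 (counter 3) (counter 4) (counter 0)) (.get 7 (counter 3) (counter 4) pivotExpr)) <|
  .seq (assign 17 (sizeExpr 0) (sizeExpr 4) (.const 1) (sizeExpr 1) (.const 1) <|
    .mul (.get 14 (counter 0) (counter 1) (counter 3)) (vecExpr 16 (counter 3))) <|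
  .seq (assign 17 (sizeExpr 0) (sizeExpr 4) (.const 1) (.const 1) (.const 1) <|
    .sub (.get 7 (counter 0) (counter 1) pivotExpr) (matExpr 17 (counter 0) (counter 1))) <|
  .seq (assign 18 (sizeExpr 1) (.const 1) (.const 1) (sizeExpr 1) (.const 1) <|
    .mul (matExpr 15 (counter 0) (counter 3)) (vecExpr 16 (counter 3))) <|
  .seq (assign 18 (sizeExpr 1) (.const 1) (.const 1) (.const 1) (.const 1) <|
    .sub (indicatorExpr (counter 0) pivotExpr) (vecExpr 18 (counter 0))) <|
  .seq (assign 19 (.const 1) (.const 1) (.const 1) (sizeExpr 0) (sizeExpr 4) <|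
    .mul (matExpr 17 (counter 3) (counter 4)) (matExpr 17 (counter 3) (counter 4))) <|
  .seq (assign 14 (sizeExpr 0) (sizeExpr 4) (sizeExpr 1) (.const 1) (.const 1) <|
    .add (.get 14 (counter 0) (counter 1) (counter 2)) <|
      .mul (indicatorExpr (counter 2) pivotExpr) <|
        .sub (.div (matExpr 17 (counter 0) (counter 1)) (.sqrt (vecExpr 19 (.const 0))))
          (.get 14 (counter 0) (counter 1) (counter 2))) <|
  .seq (assign 15 (sizeExpr 1) (sizeExpr 1) (.const 1) (.const 1) (.const 1) <|
    .add (matExpr 15 (counter 0) (counter 1)) <|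
      .mul (indicatorExpr (counter 1) pivotExpr) <|
        .sub (.div (vecExpr 18 (counter 0)) (.sqrt (vecExpr 19 (.const 0))))
          (matExpr 15 (counter 0) (counter 1))) <|
  .setInt 11 (.const 0) (.const 0) (.const 0) (.succ pivotExpr)

/-- Orthogonalise all columns of `SA`. -/
def gramSchmidt : Program := .loop (.intLt pivotExpr (sizeExpr 1)) gramStep

theorem sum_range_range {m n : ℕ} (f : ℕ → ℕ → ℝ) :
    ∑ i ∈ Finset.range m, ∑ j ∈ Finset.range n, f i j = ∑ p : Fin m × Fin n, f p.1 p.2 := by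
  rw [Fintype.sum_prod_type, Finset.sum_range]
  exact Finset.sum_congr rfl fun i _ => Finset.sum_range _

/-! ### Correctness and cost of the Gram–Schmidt program -/

section

variable {k d t₁ t₂ t₃ M : ℕ} {ε : ℝ} {Y : ℕ → ℕ → ℕ → ℝ} {s : Memory}

set_option linter.unusedSimpArgs false

attribute [local simp] RealExpr.eval IntExpr.eval sizeExpr counter Memory.withCounters counters
  vecExpr matExpr pivotExpr absExpr_eval indicatorExpr_eval

/-- The columns of `SA`. -/
def sketchColumns (k d t₃ : ℕ) (Y : ℕ → ℕ → ℕ → ℝ) (p : Fin k × Fin t₃) (q : Fin d) : ℝ :=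
  Y p.1 p.2 q

/-- The memory after `j` steps of the Gram–Schmidt process. -/
structure GramInv (k d t₁ t₂ t₃ : ℕ) (ε : ℝ) (Y : ℕ → ℕ → ℕ → ℝ) (j : ℕ) (s : Memory) : Prop where
  sizes : Sizes s k d t₁ t₂ t₃
  accuracy : s.real 0 0 0 0 = ε
  sketch : s.real 7 = Y
  pivot : s.int 11 0 0 0 = j
  gram : GramSchmidt (sketchColumns k d t₃ Y) j
    (fun p l => s.real 14 p.1 p.2 l) (fun q l => s.real 15 q l 0)

/-- With a the current column, the assignments compute c = Uᵀa, v = a − Uc, w = e_j − Rc and ‖v‖²,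
then replace column j of U and R. Indicators written as arithmetic leave the other columns
unchanged. -/
theorem gramStep_computes {j : ℕ} (h : GramInv k d t₁ t₂ t₃ ε Y j s) (hj : j < d)
    (hM : k + d + t₁ + t₂ + t₃ + 2 ≤ M) :
    Computes gramStep s (8 * (20 * M ^ 5) + 1) (GramInv k d t₁ t₂ t₃ ε Y (j + 1)) := by
  refine Computes.mono (T := 20 * M ^ 5 + (20 * M ^ 5 + (20 * M ^ 5 + (20 * M ^ 5 + (20 * M ^ 5 +
    (20 * M ^ 5 + (20 * M ^ 5 + (20 * M ^ 5 + 1)))))))) ?_ (by omega) fun s hs => hs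
  have hz := h.sizes
  have hp := h.pivot
  -- Symbolic execution, repeated for each assignment: the `hr` facts say that the other real arrays
  -- are unchanged, the `hv` facts give the new values.
  refine .seq (.assign (by norm_num) (by norm_num) rfl ?_ ?_ ?_ ?_ ?_ fun s₁ hi hr₁ hv₁ => ?_)
  iterate 5 (simp [hz.k, hz.d, hz.t₃]; try omega)
  simp [hz.k, hz.d, hz.t₃, hp, sum_range_range, h.sketch] at hv₁
  replace hz := hz.of_int (s' := s₁) (by rw [hi])
  rw [← hi] at hp
  clear hi
  refine .seq (.assign (by norm_num) (by norm_num) rfl ?_ ?_ ?_ ?_ ?_ fun s₂ hi hr₂ hv₂ => ?_)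
  iterate 5 (simp [hz.k, hz.d, hz.t₃]; try omega)
  simp [hz.k, hz.d, hz.t₃, hp, hr₁] at hv₂
  replace hz := hz.of_int (s' := s₂) (by rw [hi])
  rw [← hi] at hp
  clear hi
  refine .seq (.assign (by norm_num) (by norm_num) rfl ?_ ?_ ?_ ?_ ?_ fun s₃ hi hr₃ hv₃ => ?_)
  iterate 5 (simp [hz.k, hz.d, hz.t₃]; try omega)
  simp [hz.k, hz.d, hz.t₃, hp, hr₁, hr₂, h.sketch] at hv₃
  replace hz := hz.of_int (s' := s₃) (by rw [hi])
  rw [← hi] at hp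
  clear hi
  refine .seq (.assign (by norm_num) (by norm_num) rfl ?_ ?_ ?_ ?_ ?_ fun s₄ hi hr₄ hv₄ => ?_)
  iterate 5 (simp [hz.k, hz.d, hz.t₃]; try omega)
  simp [hz.k, hz.d, hz.t₃, hp, hr₁, hr₂, hr₃] at hv₄
  replace hz := hz.of_int (s' := s₄) (by rw [hi])
  rw [← hi] at hp
  clear hi
  refine .seq (.assign (by norm_num) (by norm_num) rfl ?_ ?_ ?_ ?_ ?_ fun s₅ hi hr₅ hv₅ => ?_)
  iterate 5 (simp [hz.k, hz.d, hz.t₃]; try omega)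
  simp [hz.k, hz.d, hz.t₃, hp, hr₁, hr₂, hr₃, hr₄] at hv₅
  replace hz := hz.of_int (s' := s₅) (by rw [hi])
  rw [← hi] at hp
  clear hi
  refine .seq (.assign (by norm_num) (by norm_num) rfl ?_ ?_ ?_ ?_ ?_ fun s₆ hi hr₆ hv₆ => ?_)
  iterate 5 (simp [hz.k, hz.d, hz.t₃]; try omega)
  simp [hz.k, hz.d, hz.t₃, hp, hr₄, hr₅, sum_range_range] at hv₆
  replace hz := hz.of_int (s' := s₆) (by rw [hi])
  rw [← hi] at hp
  clear hi
  refine .seq (.assign (by norm_num) (by norm_num) rfl ?_ ?_ ?_ ?_ ?_ fun s₇ hi hr₇ hv₇ => ?_)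
  iterate 5 (simp [hz.k, hz.d, hz.t₃]; try omega)
  simp [hz.k, hz.d, hz.t₃, hp, hr₁, hr₂, hr₃, hr₄, hr₅, hr₆] at hv₇
  replace hz := hz.of_int (s' := s₇) (by rw [hi])
  rw [← hi] at hp
  clear hi
  refine .seq (.assign (by norm_num) (by norm_num) rfl ?_ ?_ ?_ ?_ ?_ fun s₈ hi hr₈ hv₈ => ?_)
  iterate 5 (simp [hz.k, hz.d, hz.t₃]; try omega)
  simp [hz.k, hz.d, hz.t₃, hp, hr₁, hr₂, hr₃, hr₄, hr₅, hr₆, hr₇] at hv₈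
  replace hz := hz.of_int (s' := s₈) (by rw [hi])
  rw [← hi] at hp
  clear hi
  refine .setInt rfl rfl rfl rfl ⟨?_, ?_, ?_, ?_, ?_⟩
  · exact hz.of_int (by ext; simp [Memory.setInt])
  · simp [Memory.setInt, hr₁, hr₂, hr₃, hr₄, hr₅, hr₆, hr₇, hr₈, h.accuracy]
  · simp [Memory.setInt, hr₁, hr₂, hr₃, hr₄, hr₅, hr₆, hr₇, hr₈, h.sketch]
  · simp [Memory.setInt, hp]
  · refine h.gram.step hj (c := fun l => s₁.real 16 l 0 0) (v := fun p => s₃.real 17 p.1 p.2 0)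
      (w := fun q => s₅.real 18 q 0 0) (N := √(s₆.real 19 0 0 0)) ?_ ?_ ?_ ?_ ?_ ?_
    · intro l
      simp [hv₁ l l.2, sketchColumns]
    · intro p
      simp [hv₃ p.1 p.1.2 p.2 p.2.2, hv₂ p.1 p.1.2 p.2 p.2.2, sketchColumns, Finset.sum_range]
    · intro q
      simp [hv₅ q q.2, hv₄ q q.2, Finset.sum_range, Fin.ext_iff]
    · simp [hv₆]
    · intro p l
      simp only [Memory.setInt]
      rw [hr₈ 14 (by norm_num), hv₇ p.1 p.1.2 p.2 p.2.2 l l.2]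
      by_cases hl : (l : ℕ) = j <;> simp [hl, Fin.ext_iff]
    · intro q l
      simp only [Memory.setInt]
      rw [hv₈ q q.2 l l.2]
      by_cases hl : (l : ℕ) = j <;> simp [hl, Fin.ext_iff]

theorem gramSchmidt_computes (h : GramInv k d t₁ t₂ t₃ ε Y 0 s)
    (hM : k + d + t₁ + t₂ + t₃ + 2 ≤ M) :
    Computes gramSchmidt s (d * (8 * (20 * M ^ 5) + 1 + 1) + 1) (GramInv k d t₁ t₂ t₃ ε Y d) := by
  refine .loop d (fun j => GramInv k d t₁ t₂ t₃ ε Y j) rfl h ?_ ?_ ?_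
  · intro j hj s hs
    simp [Test.Holds, hs.pivot, hs.sizes.d, hj]
  · intro s hs
    simp [Test.Holds, hs.pivot, hs.sizes.d]
  · exact fun j hj s hs => gramStep_computes hs hj hM

end

/-! ### Minimising the sketched loss -/

/-- `1 / (d + 2)`. -/
def shiftExpr : RealExpr := .div (.const 1) (.add (.ofInt (sizeExpr 1)) (.const 2))

/-- `(d + 1) / √(d (d + 2))`. -/
def scaleExpr : RealExpr :=
  .div (.add (.ofInt (sizeExpr 1)) (.const 1))
    (.sqrt (.mul (.ofInt (sizeExpr 1)) (.add (.ofInt (sizeExpr 1)) (.const 2))))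

/-- The factor by which the volume bound shrinks. -/
def rateExpr : RealExpr :=
  .sub (.const 1) (.div (.const 1) (.mul (.const 4)
    (.mul (.add (.ofInt (sizeExpr 1)) (.const 2)) (.add (.ofInt (sizeExpr 1)) (.const 2)))))

/-- `ε / (2 k t₃)`. -/
def toleranceExpr : RealExpr :=
  .div (vecExpr 0 (.const 0)) (.mul (.const 2) (.mul (.ofInt (sizeExpr 0)) (.ofInt (sizeExpr 4))))

/-- Split `Sb` into its projection (with coordinates in the array `16` and preimage in the array
`18`) and the residual (array `17`), and initialise best value `21`, best point `22`, centre `23`,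
factor `24` and volume bound `25` of the ellipsoid method. -/
def ellipsoidSetup : Program :=
  .seq (assign 16 (sizeExpr 1) (.const 1) (.const 1) (sizeExpr 0) (sizeExpr 4) <|
    .mul (.get 14 (counter 3) (counter 4) (counter 0))
      (.get 7 (counter 3) (counter 4) (sizeExpr 1))) <|
  .seq (assign 17 (sizeExpr 0) (sizeExpr 4) (.const 1) (sizeExpr 1) (.const 1) <|
    .mul (.get 14 (counter 0) (counter 1) (counter 3)) (vecExpr 16 (counter 3))) <|
  .seq (assign 17 (sizeExpr 0) (sizeExpr 4) (.const 1) (.const 1) (.const 1) <|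
    .sub (.get 7 (counter 0) (counter 1) (sizeExpr 1)) (matExpr 17 (counter 0) (counter 1))) <|
  .seq (assign 18 (sizeExpr 1) (.const 1) (.const 1) (sizeExpr 1) (.const 1) <|
    .mul (matExpr 15 (counter 0) (counter 3)) (vecExpr 16 (counter 3))) <|
  .seq (assign 21 (.const 1) (.const 1) (.const 1) (sizeExpr 0) (sizeExpr 4) <|
    absExpr (matExpr 17 (counter 3) (counter 4))) <|
  .seq (assign 22 (sizeExpr 1) (.const 1) (.const 1) (.const 1) (.const 1) <| .const 0) <|
  .seq (assign 23 (sizeExpr 1) (.const 1) (.const 1) (.const 1) (.const 1) <| .const 0) <|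
  .seq (assign 24 (sizeExpr 1) (sizeExpr 1) (.const 1) (.const 1) (.const 1) <|
    .mul (vecExpr 21 (.const 0)) (indicatorExpr (counter 0) (counter 1))) <|
  assign 25 (.const 1) (.const 1) (.const 1) (.const 1) (.const 1) <| .const 1

/-- Evaluate the loss at the centre (array `27`) with residuals in the array `26`, and keep the
best point. -/
def evaluateCentre : Program :=
  .seq (assign 26 (sizeExpr 0) (sizeExpr 4) (.const 1) (sizeExpr 1) (.const 1) <|
    .mul (.get 14 (counter 0) (counter 1) (counter 3)) (vecExpr 23 (counter 3))) <|
  .seq (assign 26 (sizeExpr 0) (sizeExpr 4) (.const 1) (.const 1) (.const 1) <|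
    .sub (matExpr 26 (counter 0) (counter 1)) (matExpr 17 (counter 0) (counter 1))) <|
  .seq (assign 27 (.const 1) (.const 1) (.const 1) (sizeExpr 0) (sizeExpr 4) <|
    absExpr (matExpr 26 (counter 3) (counter 4))) <|
  .ite (.realLt (vecExpr 27 (.const 0)) (vecExpr 21 (.const 0)))
    (.seq (assign 21 (.const 1) (.const 1) (.const 1) (.const 1) (.const 1) <|
        vecExpr 27 (.const 0)) <|
      assign 22 (sizeExpr 1) (.const 1) (.const 1) (.const 1) (.const 1) <| vecExpr 23 (counter 0))
    .skip

/-- Replace the ellipsoid by a smaller one containing its half on which the loss may be smaller. -/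
def shrinkEllipsoid : Program :=
  .seq (assign 28 (sizeExpr 1) (.const 1) (.const 1) (sizeExpr 0) (sizeExpr 4) <|
    .mul (.div (matExpr 26 (counter 3) (counter 4)) (absExpr (matExpr 26 (counter 3) (counter 4))))
      (.get 14 (counter 3) (counter 4) (counter 0))) <|
  .seq (assign 29 (sizeExpr 1) (.const 1) (.const 1) (sizeExpr 1) (.const 1) <|
    .mul (matExpr 24 (counter 3) (counter 0)) (vecExpr 28 (counter 3))) <|
  .seq (assign 30 (.const 1) (.const 1) (.const 1) (sizeExpr 1) (.const 1) <|
    .mul (vecExpr 29 (counter 3)) (vecExpr 29 (counter 3))) <|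
  .seq (assign 31 (sizeExpr 1) (.const 1) (.const 1) (.const 1) (.const 1) <|
    .div (vecExpr 29 (counter 0)) (.sqrt (vecExpr 30 (.const 0)))) <|
  .seq (assign 32 (sizeExpr 1) (.const 1) (.const 1) (sizeExpr 1) (.const 1) <|
    .mul (matExpr 24 (counter 0) (counter 3)) (vecExpr 31 (counter 3))) <|
  .seq (assign 23 (sizeExpr 1) (.const 1) (.const 1) (.const 1) (.const 1) <|
    .sub (vecExpr 23 (counter 0)) (.mul shiftExpr (vecExpr 32 (counter 0)))) <|
  .seq (assign 24 (sizeExpr 1) (sizeExpr 1) (.const 1) (.const 1) (.const 1) <|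
    .add (.mul scaleExpr (matExpr 24 (counter 0) (counter 1)))
      (.mul (.sub (.sub (.const 1) shiftExpr) scaleExpr)
        (.mul (vecExpr 32 (counter 0)) (vecExpr 31 (counter 1))))) <|
  assign 25 (.const 1) (.const 1) (.const 1) (.const 1) (.const 1) <|
    .mul (vecExpr 25 (.const 0)) rateExpr

/-- The ellipsoid method. -/
def ellipsoidLoop : Program :=
  .loop (.realLe toleranceExpr (vecExpr 25 (.const 0))) (.seq evaluateCentre shrinkEllipsoid)

/-- Transform the best point back and output it. -/
def writeOutput : Program :=
  .seq (assign 32 (sizeExpr 1) (.const 1) (.const 1) (sizeExpr 1) (.const 1) <|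
    .mul (matExpr 15 (counter 0) (counter 3)) (vecExpr 22 (counter 3))) <|
  assign 6 (sizeExpr 1) (.const 1) (.const 1) (.const 1) (.const 1) <|
    .add (vecExpr 18 (counter 0)) (vecExpr 32 (counter 0))

/-! ### Correctness and cost of the ellipsoid program -/

section

variable {k d t₁ t₂ t₃ M : ℕ} {ε : ℝ} {Y : ℕ → ℕ → ℕ → ℝ} {s : Memory}
  {U : Fin k × Fin t₃ → Fin d → ℝ} {R : Fin d → Fin d → ℝ} {r : Fin k × Fin t₃ → ℝ}
  {x₀ : Fin d → ℝ}

set_option linter.unusedSimpArgs false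

attribute [local simp] RealExpr.eval IntExpr.eval sizeExpr counter Memory.withCounters counters
  vecExpr matExpr absExpr_eval indicatorExpr_eval

/-- The tolerance of the ellipsoid method. -/
def tolerance (k t₃ : ℕ) (ε : ℝ) : ℝ := ε / (2 * (k * t₃))

/-- The sketch has N = k t₃ rows, and δ = ε/(2N) is the largest value allowed by
`OrthoPair.l1Loss_near_le`; for N = 0 division by zero gives δ = 0. -/
theorem tolerance_mul_le (hε : 0 ≤ ε) :
    tolerance k t₃ ε * (2 * Fintype.card (Fin k × Fin t₃)) ≤ ε := by
  rw [tolerance, Fintype.card_prod, Fintype.card_fin, Fintype.card_fin, Nat.cast_mul]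
  rcases eq_or_ne ((k : ℝ) * t₃) 0 with h | h
  · simp [h, hε]
  · rw [div_mul_cancel₀ _ (by simpa using h)]

theorem tolerance_nonneg (hε : 0 ≤ ε) : 0 ≤ tolerance k t₃ ε := by
  unfold tolerance
  positivity

theorem tolerance_le_one (hε1 : ε ≤ 1) : tolerance k t₃ ε ≤ 1 := by
  rw [tolerance]
  rcases Nat.eq_zero_or_pos (k * t₃) with h | h
  · rw [← Nat.cast_mul, h]
    simp
  · have : (1 : ℝ) ≤ k * t₃ := by exact_mod_cast h
    rw [div_le_one (by positivity)]
    linarith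

/-- The memory after `j` steps of the ellipsoid method. -/
structure EllipsoidState (k d t₁ t₂ t₃ : ℕ) (ε : ℝ) (Y : ℕ → ℕ → ℕ → ℝ)
    (U : Fin k × Fin t₃ → Fin d → ℝ) (R : Fin d → Fin d → ℝ) (r : Fin k × Fin t₃ → ℝ)
    (x₀ : Fin d → ℝ) (j : ℕ) (s : Memory) : Prop where
  sizes : Sizes s k d t₁ t₂ t₃
  accuracy : s.real 0 0 0 0 = ε
  sketch : s.real 7 = Y
  basis : ∀ (p : Fin k × Fin t₃) (l : Fin d), s.real 14 p.1 p.2 l = U p l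
  transform : ∀ q l : Fin d, s.real 15 q l 0 = R q l
  residual : ∀ p : Fin k × Fin t₃, s.real 17 p.1 p.2 0 = r p
  shift : ∀ q : Fin d, s.real 18 q 0 0 = x₀ q
  best : s.real 21 0 0 0 = l1Loss U r fun l => s.real 22 l 0 0
  volume : s.real 25 0 0 0 = stepRate d ^ j
  inv : EllipsoidInv U r ε (tolerance k t₃ ε) (fun l => s.real 23 l 0 0)
    (Matrix.of fun q l : Fin d => s.real 24 q l 0) (stepRate d ^ j) (s.real 21 0 0 0)

/-- Changes variables: with c = UᵀSb, r = Sb − Uc and x₀ = Rc, the two identities handed to `hQ` say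
that every residual has the form Uz − r, and that x₀ + Rz realises it. Minimising in z is thus
equivalent to minimising in x. -/
theorem ellipsoidSetup_computes (h : GramInv k d t₁ t₂ t₃ ε Y d s)
    (hM : k + d + t₁ + t₂ + t₃ + 2 ≤ M) (hε : 0 ≤ ε) (hε1 : ε ≤ 1) {Q : Memory → Prop}
    (hQ : ∀ U R r x₀, OrthoPair U r → (∀ x : Fin d → ℝ, ∃ z : Fin d → ℝ, ∀ p : Fin k × Fin t₃,
        ∑ q, sketchColumns k d t₃ Y p q * x q - Y p.1 p.2 d = ∑ l, U p l * z l - r p) →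
      (∀ (z : Fin d → ℝ) (p : Fin k × Fin t₃),
        ∑ q, sketchColumns k d t₃ Y p q * (x₀ q + ∑ l, R q l * z l) - Y p.1 p.2 d
          = ∑ l, U p l * z l - r p) →
      ∀ s, EllipsoidState k d t₁ t₂ t₃ ε Y U R r x₀ 0 s → Q s) :
    Computes ellipsoidSetup s (9 * (20 * M ^ 5)) Q := by
  refine Computes.mono (T := 20 * M ^ 5 + (20 * M ^ 5 + (20 * M ^ 5 + (20 * M ^ 5 + (20 * M ^ 5 +
    (20 * M ^ 5 + (20 * M ^ 5 + (20 * M ^ 5 + 20 * M ^ 5)))))))) ?_ (by omega) fun s hs => hs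
  have hz := h.sizes
  refine .seq (.assign (by norm_num) (by norm_num) rfl ?_ ?_ ?_ ?_ ?_ fun s₁ hi hr₁ hv₁ => ?_)
  iterate 5 (simp [hz.k, hz.d, hz.t₃]; try omega)
  simp [hz.k, hz.d, hz.t₃, sum_range_range, h.sketch] at hv₁
  replace hz := hz.of_int (s' := s₁) (by rw [hi])
  clear hi
  refine .seq (.assign (by norm_num) (by norm_num) rfl ?_ ?_ ?_ ?_ ?_ fun s₂ hi hr₂ hv₂ => ?_)
  iterate 5 (simp [hz.k, hz.d, hz.t₃]; try omega)
  simp [hz.k, hz.d, hz.t₃, hr₁] at hv₂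
  replace hz := hz.of_int (s' := s₂) (by rw [hi])
  clear hi
  refine .seq (.assign (by norm_num) (by norm_num) rfl ?_ ?_ ?_ ?_ ?_ fun s₃ hi hr₃ hv₃ => ?_)
  iterate 5 (simp [hz.k, hz.d, hz.t₃]; try omega)
  simp [hz.k, hz.d, hz.t₃, hr₁, hr₂, h.sketch] at hv₃
  replace hz := hz.of_int (s' := s₃) (by rw [hi])
  clear hi
  refine .seq (.assign (by norm_num) (by norm_num) rfl ?_ ?_ ?_ ?_ ?_ fun s₄ hi hr₄ hv₄ => ?_)
  iterate 5 (simp [hz.k, hz.d, hz.t₃]; try omega)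
  simp [hz.k, hz.d, hz.t₃, hr₁, hr₂, hr₃] at hv₄
  replace hz := hz.of_int (s' := s₄) (by rw [hi])
  clear hi
  refine .seq (.assign (by norm_num) (by norm_num) rfl ?_ ?_ ?_ ?_ ?_ fun s₅ hi hr₅ hv₅ => ?_)
  iterate 5 (simp [hz.k, hz.d, hz.t₃]; try omega)
  simp [hz.k, hz.d, hz.t₃, hr₄, sum_range_range] at hv₅
  replace hz := hz.of_int (s' := s₅) (by rw [hi])
  clear hi
  refine .seq (.assign (by norm_num) (by norm_num) rfl ?_ ?_ ?_ ?_ ?_ fun s₆ hi hr₆ hv₆ => ?_)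
  iterate 5 (simp [hz.k, hz.d, hz.t₃]; try omega)
  simp [hz.d] at hv₆
  replace hz := hz.of_int (s' := s₆) (by rw [hi])
  clear hi
  refine .seq (.assign (by norm_num) (by norm_num) rfl ?_ ?_ ?_ ?_ ?_ fun s₇ hi hr₇ hv₇ => ?_)
  iterate 5 (simp [hz.k, hz.d, hz.t₃]; try omega)
  simp [hz.d] at hv₇
  replace hz := hz.of_int (s' := s₇) (by rw [hi])
  clear hi
  refine .seq (.assign (by norm_num) (by norm_num) rfl ?_ ?_ ?_ ?_ ?_ fun s₈ hi hr₈ hv₈ => ?_)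
  iterate 5 (simp [hz.k, hz.d, hz.t₃]; try omega)
  simp [hz.d, hr₆, hr₇] at hv₈
  replace hz := hz.of_int (s' := s₈) (by rw [hi])
  clear hi
  refine .assign (by norm_num) (by norm_num) rfl ?_ ?_ ?_ ?_ ?_ fun s₉ hi hr₉ hv₉ => ?_
  iterate 5 (simp [hz.k, hz.d, hz.t₃]; try omega)
  simp at hv₉
  replace hz := hz.of_int (s' := s₉) (by rw [hi])
  clear hi
  have hg := h.gram
  let c : Fin d → ℝ := fun l => s₁.real 16 l 0 0
  let r : Fin k × Fin t₃ → ℝ := fun p => s₃.real 17 p.1 p.2 0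
  let x₀ : Fin d → ℝ := fun q => s₄.real 18 q 0 0
  have hc : ∀ l, c l = ∑ p : Fin k × Fin t₃, s.real 14 p.1 p.2 l * Y p.1 p.2 d :=
    fun l => hv₁ l l.2
  have hr : ∀ p, r p = Y p.1 p.2 d - ∑ l : Fin d, s.real 14 p.1 p.2 l * c l := by
    intro p
    simp only [r, c, hv₃ p.1 p.1.2 p.2 p.2.2, hv₂ p.1 p.1.2 p.2 p.2.2, Finset.sum_range]
  have hx : ∀ q, x₀ q = ∑ l : Fin d, s.real 15 q l 0 * c l := by
    intro q
    simp only [x₀, c, hv₄ q q.2, Finset.sum_range]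
  have ho : OrthoPair (fun (p : Fin k × Fin t₃) (l : Fin d) => s.real 14 p.1 p.2 l) r := by
    refine ⟨hg.orthogonal, hg.norm, fun l => ?_⟩
    have := hg.residual_orthogonal (fun p => Y p.1 p.2 d) l
    simp only [← hc] at this
    simp only [hr]
    exact this
  have hval : s₉.real 21 0 0 0
      = l1Loss (fun (p : Fin k × Fin t₃) (l : Fin d) => s.real 14 p.1 p.2 l) r 0 := by
    rw [l1Loss_zero]
    simp [hr₉, hr₈, hr₇, hr₆, hv₅, r]
  have hz22 : (fun l : Fin d => s₉.real 22 l 0 0) = 0 := by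
    ext l
    simp [hr₉, hr₈, hr₇, hv₆ l l.2]
  have hz23 : (fun l : Fin d => s₉.real 23 l 0 0) = 0 := by
    ext l
    simp [hr₉, hr₈, hv₇ l l.2]
  refine hQ _ (fun q l => s.real 15 q l 0) r x₀ ho ?_ ?_ s₉ ⟨hz, ?_, ?_, ?_, ?_, ?_, ?_, ?_, ?_, ?_⟩
  · intro x
    obtain ⟨z, hz⟩ := hg.exists_coord x
    refine ⟨z - c, fun p => ?_⟩
    rw [hz p, hr]
    simp only [Pi.sub_apply, mul_sub, Finset.sum_sub_distrib]
    ring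
  · intro z p
    have h1 := hg.mul_eq c p
    have h2 := hg.mul_eq z p
    simp only [mul_add, Finset.sum_add_distrib, hx, h1, h2, hr]
    ring
  · simp [hr₁, hr₂, hr₃, hr₄, hr₅, hr₆, hr₇, hr₈, hr₉, h.accuracy]
  · simp [hr₁, hr₂, hr₃, hr₄, hr₅, hr₆, hr₇, hr₈, hr₉, h.sketch]
  · simp [hr₁, hr₂, hr₃, hr₄, hr₅, hr₆, hr₇, hr₈, hr₉]
  · simp [hr₁, hr₂, hr₃, hr₄, hr₅, hr₆, hr₇, hr₈, hr₉]
  · simp [hr₄, hr₅, hr₆, hr₇, hr₈, hr₉, r]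
  · simp [hr₅, hr₆, hr₇, hr₈, hr₉, x₀]
  · rw [hz22, hval]
  · simp [hv₉]
  · rw [hz23, hval, pow_zero]
    convert EllipsoidInv.init hε (tolerance_nonneg hε) (tolerance_le_one hε1) using 1
    ext q l
    have h21 : s₇.real 21 0 0 0 = s₉.real 21 0 0 0 := by simp [hr₉, hr₈]
    have h21' : s₅.real 21 0 0 0 = s₉.real 21 0 0 0 := by simp [hr₉, hr₈, hr₇, hr₆]
    simp [hr₉, hv₈ q q.2 l l.2, Matrix.one_apply, Fin.ext_iff, h21, h21', hval]

/-- The memory after the loss has been evaluated at the centre, in terms of the memory `s` before. -/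
structure Evaluated (U : Fin k × Fin t₃ → Fin d → ℝ) (r : Fin k × Fin t₃ → ℝ) (s s' : Memory) :
    Prop where
  int : s'.int = s.int
  real : ∀ a, a ≠ 21 → a ≠ 22 → a ≠ 26 → a ≠ 27 → s'.real a = s.real a
  residual : ∀ p : Fin k × Fin t₃, s'.real 26 p.1 p.2 0
    = ∑ l : Fin d, U p l * s.real 23 l 0 0 - r p
  best_le : s'.real 21 0 0 0 ≤ s.real 21 0 0 0
  best_le' : s'.real 21 0 0 0 ≤ l1Loss U r fun l => s.real 23 l 0 0
  best : s'.real 21 0 0 0 = l1Loss U r fun l => s'.real 22 l 0 0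

theorem evaluateCentre_computes {j : ℕ} (h : EllipsoidState k d t₁ t₂ t₃ ε Y U R r x₀ j s)
    (hM : k + d + t₁ + t₂ + t₃ + 2 ≤ M) :
    Computes evaluateCentre s (5 * (20 * M ^ 5) + 1) (Evaluated U r s) := by
  refine Computes.mono (T := 20 * M ^ 5 + (20 * M ^ 5 + (20 * M ^ 5 +
    (20 * M ^ 5 + 20 * M ^ 5 + 1)))) ?_ (by omega) fun s hs => hs
  have hz := h.sizes
  refine .seq (.assign (by norm_num) (by norm_num) rfl ?_ ?_ ?_ ?_ ?_ fun s₁ hi₁ hr₁ hv₁ => ?_)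
  iterate 5 (simp [hz.k, hz.d, hz.t₃]; try omega)
  simp [hz.k, hz.d, hz.t₃] at hv₁
  replace hz := hz.of_int (s' := s₁) (by rw [hi₁])
  refine .seq (.assign (by norm_num) (by norm_num) rfl ?_ ?_ ?_ ?_ ?_ fun s₂ hi₂ hr₂ hv₂ => ?_)
  iterate 5 (simp [hz.k, hz.d, hz.t₃]; try omega)
  simp [hz.k, hz.d, hz.t₃, hr₁] at hv₂
  replace hz := hz.of_int (s' := s₂) (by rw [hi₂])
  refine .seq (.assign (by norm_num) (by norm_num) rfl ?_ ?_ ?_ ?_ ?_ fun s₃ hi₃ hr₃ hv₃ => ?_)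
  iterate 5 (simp [hz.k, hz.d, hz.t₃]; try omega)
  simp [hz.k, hz.d, hz.t₃, sum_range_range] at hv₃
  replace hz := hz.of_int (s' := s₃) (by rw [hi₃])
  have hy : ∀ p : Fin k × Fin t₃, s₂.real 26 p.1 p.2 0
      = ∑ l : Fin d, U p l * s.real 23 l 0 0 - r p := by
    intro p
    rw [hv₂ p.1 p.1.2 p.2 p.2.2, hv₁ p.1 p.1.2 p.2 p.2.2, h.residual, Finset.sum_range]
    simp [h.basis]
  have hf : s₃.real 27 0 0 0 = l1Loss U r fun l => s.real 23 l 0 0 := by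
    rw [hv₃, l1Loss]
    simp [hy]
  refine .ite rfl (fun hc => ?_) fun hc => ?_
  · simp [Test.Holds, hf] at hc
    refine .seq (.assign (by norm_num) (by norm_num) rfl ?_ ?_ ?_ ?_ ?_ fun s₄ hi₄ hr₄ hv₄ => ?_)
    iterate 5 (simp; try omega)
    simp at hv₄
    replace hz := hz.of_int (s' := s₄) (by rw [hi₄])
    refine .assign (by norm_num) (by norm_num) rfl ?_ ?_ ?_ ?_ ?_ fun s₅ hi₅ hr₅ hv₅ => ?_
    iterate 5 (simp [hz.d]; try omega)
    simp [hz.d] at hv₅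
    have h21 : s₅.real 21 0 0 0 = l1Loss U r fun l => s.real 23 l 0 0 := by
      rw [hr₅ 21 (by norm_num), hv₄, hf]
    refine ⟨by rw [hi₅, hi₄, hi₃, hi₂, hi₁], fun a h21 h22 h26 h27 => ?_, fun p => ?_, ?_, h21.le, ?_⟩
    · rw [hr₅ a h22, hr₄ a h21, hr₃ a h27, hr₂ a h26, hr₁ a h26]
    · rw [hr₅ 26 (by norm_num), hr₄ 26 (by norm_num), hr₃ 26 (by norm_num), hy]
    · rw [h21]
      refine hc.le.trans_eq ?_
      rw [hr₃ 21 (by norm_num), hr₂ 21 (by norm_num), hr₁ 21 (by norm_num)]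
    · rw [h21]
      congr 1
      ext l
      rw [hv₅ l l.2, hr₄ 23 (by norm_num), hr₃ 23 (by norm_num), hr₂ 23 (by norm_num),
        hr₁ 23 (by norm_num)]
  · simp [Test.Holds, hf] at hc
    have hM0 : 0 < M ^ 5 := pow_pos (by omega) 5
    have hr21 : ∀ a, a ≠ 26 → a ≠ 27 → s₃.real a = s.real a := fun a h26 h27 => by
      rw [hr₃ a h27, hr₂ a h26, hr₁ a h26]
    refine (Computes.skip ?_).mono (by omega) fun s hs => hs
    refine ⟨by rw [hi₃, hi₂, hi₁], fun a _ _ h26 h27 => hr21 a h26 h27, fun p => ?_, ?_, hc, ?_⟩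
    · rw [hr₃ 26 (by norm_num), hy]
    · rw [hr21 21 (by norm_num) (by norm_num)]
    · rw [hr21 21 (by norm_num) (by norm_num), hr21 22 (by norm_num) (by norm_num), h.best]

/-- The arrays written are the subgradient, its pullback by Lᵀ, the normalised u and Lu, followed by
the new centre, factor and volume bound. -/
theorem shrinkEllipsoid_computes {j : ℕ} (hd : 1 ≤ d) (hε : 0 ≤ ε) (hε1 : ε ≤ 1)
    (ho : OrthoPair U r) {s₀ : Memory}
    (h : EllipsoidState k d t₁ t₂ t₃ ε Y U R r x₀ j s₀) (he : Evaluated U r s₀ s)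
    (hM : k + d + t₁ + t₂ + t₃ + 2 ≤ M) :
    Computes shrinkEllipsoid s (8 * (20 * M ^ 5))
      (EllipsoidState k d t₁ t₂ t₃ ε Y U R r x₀ (j + 1)) := by
  refine Computes.mono (T := 20 * M ^ 5 + (20 * M ^ 5 + (20 * M ^ 5 + (20 * M ^ 5 + (20 * M ^ 5 +
    (20 * M ^ 5 + (20 * M ^ 5 + 20 * M ^ 5))))))) ?_ (by omega) fun s hs => hs
  have hz := h.sizes.of_int (s' := s) (by rw [he.int])
  have hr₀ := he.real
  refine .seq (.assign (by norm_num) (by norm_num) rfl ?_ ?_ ?_ ?_ ?_ fun s₁ hi hr₁ hv₁ => ?_)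
  iterate 5 (simp [hz.k, hz.d, hz.t₃]; try omega)
  simp [hz.k, hz.d, hz.t₃, sum_range_range, hr₀] at hv₁
  replace hz := hz.of_int (s' := s₁) (by rw [hi])
  clear hi
  refine .seq (.assign (by norm_num) (by norm_num) rfl ?_ ?_ ?_ ?_ ?_ fun s₂ hi hr₂ hv₂ => ?_)
  iterate 5 (simp [hz.k, hz.d, hz.t₃]; try omega)
  simp [hz.k, hz.d, hz.t₃, hr₁, hr₀] at hv₂
  replace hz := hz.of_int (s' := s₂) (by rw [hi])
  clear hi
  refine .seq (.assign (by norm_num) (by norm_num) rfl ?_ ?_ ?_ ?_ ?_ fun s₃ hi hr₃ hv₃ => ?_)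
  iterate 5 (simp [hz.k, hz.d, hz.t₃]; try omega)
  simp [hz.d] at hv₃
  replace hz := hz.of_int (s' := s₃) (by rw [hi])
  clear hi
  refine .seq (.assign (by norm_num) (by norm_num) rfl ?_ ?_ ?_ ?_ ?_ fun s₄ hi hr₄ hv₄ => ?_)
  iterate 5 (simp [hz.k, hz.d, hz.t₃]; try omega)
  simp [hz.d, hr₃] at hv₄
  replace hz := hz.of_int (s' := s₄) (by rw [hi])
  clear hi
  refine .seq (.assign (by norm_num) (by norm_num) rfl ?_ ?_ ?_ ?_ ?_ fun s₅ hi hr₅ hv₅ => ?_)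
  iterate 5 (simp [hz.k, hz.d, hz.t₃]; try omega)
  simp [hz.d, hr₀, hr₁, hr₂, hr₃, hr₄] at hv₅
  replace hz := hz.of_int (s' := s₅) (by rw [hi])
  clear hi
  refine .seq (.assign (by norm_num) (by norm_num) rfl ?_ ?_ ?_ ?_ ?_ fun s₆ hi hr₆ hv₆ => ?_)
  iterate 5 (simp [hz.k, hz.d, hz.t₃]; try omega)
  simp [hz.d, shiftExpr,
    hr₀, hr₁, hr₂, hr₃, hr₄, hr₅] at hv₆
  replace hz := hz.of_int (s' := s₆) (by rw [hi])
  clear hi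
  refine .seq (.assign (by norm_num) (by norm_num) rfl ?_ ?_ ?_ ?_ ?_ fun s₇ hi hr₇ hv₇ => ?_)
  iterate 5 (simp [hz.k, hz.d, hz.t₃]; try omega)
  simp [hz.d, shiftExpr, scaleExpr,
    hr₀, hr₁, hr₂, hr₃, hr₄, hr₅, hr₆] at hv₇
  replace hz := hz.of_int (s' := s₇) (by rw [hi])
  clear hi
  refine .assign (by norm_num) (by norm_num) rfl ?_ ?_ ?_ ?_ ?_ fun s₈ hi hr₈ hv₈ => ?_
  iterate 5 (simp [hz.k, hz.d, hz.t₃]; try omega)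
  simp [hz.d, rateExpr,
    hr₀, hr₁, hr₂, hr₃, hr₄, hr₅, hr₆, hr₇, h.volume] at hv₈
  replace hz := hz.of_int (s' := s₈) (by rw [hi])
  clear hi
  have h21 : s₈.real 21 = s.real 21 := by simp [hr₁, hr₂, hr₃, hr₄, hr₅, hr₆, hr₇, hr₈]
  have h22 : s₈.real 22 = s.real 22 := by simp [hr₁, hr₂, hr₃, hr₄, hr₅, hr₆, hr₇, hr₈]
  refine ⟨hz, ?_, ?_, fun p l => ?_, fun q l => ?_, fun p => ?_, fun q => ?_, ?_, ?_, ?_⟩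
  · simp [hr₀, hr₁, hr₂, hr₃, hr₄, hr₅, hr₆, hr₇, hr₈, h.accuracy]
  · simp [hr₀, hr₁, hr₂, hr₃, hr₄, hr₅, hr₆, hr₇, hr₈, h.sketch]
  · simp [hr₀, hr₁, hr₂, hr₃, hr₄, hr₅, hr₆, hr₇, hr₈, h.basis]
  · simp [hr₀, hr₁, hr₂, hr₃, hr₄, hr₅, hr₆, hr₇, hr₈, h.transform]
  · simp [hr₀, hr₁, hr₂, hr₃, hr₄, hr₅, hr₆, hr₇, hr₈, h.residual]
  · simp [hr₀, hr₁, hr₂, hr₃, hr₄, hr₅, hr₆, hr₇, hr₈, h.shift]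
  · rw [h21, h22, he.best]
  · rw [hv₈, pow_succ]
    simp [stepRate]
  · rw [h21, pow_succ]
    refine h.inv.step hd ho (tolerance_nonneg hε) (tolerance_le_one hε1) (tolerance_mul_le hε)
      he.best_le he.best_le' (h := fun l => s₂.real 29 l 0 0) (u := fun l => s₄.real 31 l 0 0)
      ?_ ?_ ?_ ?_
    · ext l
      have hg : ∀ m : Fin d, s₁.real 28 m 0 0 = subgrad U r (fun l => s₀.real 23 l 0 0) m := by
        intro m
        rw [hv₁ m m.2, subgrad]
        refine Finset.sum_congr rfl fun p _ => ?_
        rw [he.residual, h.basis, Real.sqrt_mul_self_eq_abs]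
      simp [hv₂ l l.2, Matrix.mulVec, dotProduct, Finset.sum_range, hg]
    · intro l
      rw [hv₄ l l.2, hv₃, Finset.sum_range]
    · ext l
      rw [hr₈ 23 (by norm_num), hr₇ 23 (by norm_num), hv₆ l l.2, hv₅ l l.2, Finset.sum_range]
      simp [Matrix.mulVec, dotProduct, stepShift]
    · ext q l
      -- L(αI + βuuᵀ) = αL + β(Lu)uᵀ, so no matrix product is needed.
      rw [Matrix.mul_add, Matrix.mul_smul, Matrix.mul_smul, Matrix.mul_one, Matrix.mul_vecMulVec]
      simp [hr₈, hv₇ q q.2 l l.2, hv₅ q q.2, Finset.sum_range, Matrix.mulVec, dotProduct,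
        Matrix.vecMulVec_apply, stepRank, stepShift, stepScale]

/-- The test compares only the tracked bound rate^j with the tolerance, so the number of passes
depends on d, k, t₃ and ε but not on the data. -/
theorem ellipsoidLoop_computes {N : ℕ} (hd : 1 ≤ d) (hε : 0 ≤ ε) (hε1 : ε ≤ 1)
    (ho : OrthoPair U r) (h : EllipsoidState k d t₁ t₂ t₃ ε Y U R r x₀ 0 s)
    (hM : k + d + t₁ + t₂ + t₃ + 2 ≤ M)
    (hN : ∀ j < N, tolerance k t₃ ε ≤ stepRate d ^ j) (hN' : stepRate d ^ N < tolerance k t₃ ε) :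
    Computes ellipsoidLoop s (N * (5 * (20 * M ^ 5) + 1 + 8 * (20 * M ^ 5) + 1) + 1)
      (EllipsoidState k d t₁ t₂ t₃ ε Y U R r x₀ N) := by
  have ht : ∀ {s : Memory} {j : ℕ}, EllipsoidState k d t₁ t₂ t₃ ε Y U R r x₀ j s →
      ((Test.realLe toleranceExpr (vecExpr 25 (.const 0))).Holds s ↔
        tolerance k t₃ ε ≤ stepRate d ^ j) := by
    intro s j hs
    simp [Test.Holds, toleranceExpr, tolerance, hs.accuracy, hs.sizes.k, hs.sizes.t₃, hs.volume]
  refine .loop N (fun j => EllipsoidState k d t₁ t₂ t₃ ε Y U R r x₀ j) rfl h ?_ ?_ ?_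
  · exact fun j hj s hs => (ht hs).2 (hN j hj)
  · exact fun s hs => by rw [ht hs]; exact not_le.2 hN'
  · exact fun j hj s hs => .seq ((evaluateCentre_computes hs hM).mono le_rfl fun s' hs' =>
      shrinkEllipsoid_computes hd hε hε1 ho hs hs' hM)

theorem writeOutput_computes {j : ℕ} (h : EllipsoidState k d t₁ t₂ t₃ ε Y U R r x₀ j s)
    (hM : k + d + t₁ + t₂ + t₃ + 2 ≤ M) {Q : Memory → Prop}
    (hQ : ∀ s' : Memory, s'.real 7 = Y →
      (output d s' = fun q => x₀ q + ∑ l, R q l * s.real 22 l 0 0) → Q s') :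
    Computes writeOutput s (20 * M ^ 5 + 20 * M ^ 5) Q := by
  have hz := h.sizes
  refine .seq (.assign (by norm_num) (by norm_num) rfl ?_ ?_ ?_ ?_ ?_ fun s₁ hi hr₁ hv₁ => ?_)
  iterate 5 (simp [hz.d]; try omega)
  simp [hz.d] at hv₁
  replace hz := hz.of_int (s' := s₁) (by rw [hi])
  refine .assign (by norm_num) (by norm_num) rfl ?_ ?_ ?_ ?_ ?_ fun s₂ hi hr₂ hv₂ => ?_
  iterate 5 (simp [hz.d]; try omega)
  simp [hz.d] at hv₂
  refine hQ s₂ (by rw [hr₂ 7 (by norm_num), hr₁ 7 (by norm_num), h.sketch]) ?_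
  ext q
  rw [output, hv₂ q q.2, hr₁ 18 (by norm_num), h.shift, hv₁ q q.2, Finset.sum_range]
  simp [h.transform]

end

/-! ### The whole program and its running time -/

/-- Form the sketch, orthogonalise it, and minimise the sketched loss by the ellipsoid method. -/
def regressionProgram : Program :=
  .seq formSketch <| .seq gramSchmidt <| .seq ellipsoidSetup <| .seq ellipsoidLoop writeOutput

section

variable {k d : ℕ} {n : Fin k → ℕ} {t₁ t₂ t₃ : ℕ}
  {A : (i : Fin k) → Matrix (Fin (n i)) (Fin d) ℝ} {b : (i : Fin k) → Fin (n i) → ℝ}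
  {L : (i : Fin k) → List (Fin (n i) × Fin (d + 1))} {ω : Draw n t₁ t₂ t₃} {ε : ℝ}

theorem sketchedLoss_eq_of_holdsSketch {s : Memory} (h : HoldsSketch A b ω s) (x : Fin d → ℝ) :
    sketchedLoss ω A b x = ∑ p : Fin k × Fin t₃,
      |∑ q, sketchColumns k d t₃ (s.real 7) p q * x q - s.real 7 p.1 p.2 d| := by
  have h1 : stack A *ᵥ x - stackVec b
      = (stack fun i => augment (A i) (b i)) *ᵥ (Fin.snoc x (-1) : Fin (d + 1) → ℝ) := by
    ext p
    have := congrFun (augment_mulVec (A p.1) (b p.1) x) p.2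
    simpa [stack, stackVec, Matrix.mulVec, dotProduct] using this.symm
  rw [sketchedLoss, h1, Fintype.sum_sigma, Fintype.sum_prod_type]
  refine Finset.sum_congr rfl fun i _ => Finset.sum_congr rfl fun u _ => ?_
  rw [Matrix.mulVec_mulVec, Matrix.mulVec, dotProduct, Fin.sum_univ_castSucc]
  simp only [Fin.snoc_castSucc, Fin.snoc_last, ← h i u, sketchColumns, Fin.val_castSucc, Fin.val_last]
  congr 1
  ring

/-- Valid for every draw: optimality comes from `EllipsoidInv.final` in the coordinates z,
transported back to x, and no probabilistic estimate is used. -/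
theorem regressionProgram_runs (hd : 1 ≤ d) (hε : 0 < ε) (hε1 : ε ≤ 1)
    (hL : ∀ i, ListsNonzeros (L i) (augment (A i) (b i)))
    {M N : ℕ} (hM : k + d + t₁ + t₂ + t₃ + 2 ≤ M)
    (hN : ∀ j < N, tolerance k t₃ ε ≤ stepRate d ^ j) (hN' : stepRate d ^ N < tolerance k t₃ ε) :
    ∃ s T, Runs regressionProgram (initialMemory A b L ε ω) s T ∧
      T ≤ 3 * (k + 1) * ∑ i, (nnz (A i) + nnzVec (b i)) + 500 * M ^ 6 + 262 * N * M ^ 5 ∧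
      HoldsSketch A b ω s ∧
      ∀ x, sketchedLoss ω A b (output d s) ≤ (1 + ε) * sketchedLoss ω A b x := by
  let Q : Memory → Prop := fun s => HoldsSketch A b ω s ∧
      ∀ x, sketchedLoss ω A b (output d s) ≤ (1 + ε) * sketchedLoss ω A b x
  have key : Computes regressionProgram (initialMemory A b L ε ω)
      (((k + 1) * ((∑ i, (nnz (A i) + nnzVec (b i)) + 1) * 3 + 2) + (20 * M ^ 5 + 20 * M ^ 5)) +
      ((d * (8 * (20 * M ^ 5) + 1 + 1) + 1) + (9 * (20 * M ^ 5) +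
      ((N * (5 * (20 * M ^ 5) + 1 + 8 * (20 * M ^ 5) + 1) + 1) +
        (20 * M ^ 5 + 20 * M ^ 5))))) Q := by
    refine .seq (formSketch_computes hL hM fun s₁ hi₁ hr₁ hs₁ => ?_)
    have hg : GramInv k d t₁ t₂ t₃ ε (s₁.real 7) 0 s₁ := by
      refine ⟨initialMemory_sizes.of_int (by rw [hi₁]), ?_, rfl, ?_, ?_⟩
      · rw [hr₁ 0 (by norm_num) (by norm_num) (by norm_num)]
        simp [initialMemory]
      · rw [hi₁]
        simp [initialMemory]
      · rw [hr₁ 14 (by norm_num) (by norm_num) (by norm_num),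
          hr₁ 15 (by norm_num) (by norm_num) (by norm_num)]
        exact GramSchmidt.init _
    refine .seq ((gramSchmidt_computes hg hM).mono le_rfl fun s₂ hs₂ => .seq ?_)
    refine ellipsoidSetup_computes hs₂ hM hε.le hε1 fun U R r x₀ ho hz hx s₃ hs₃ => .seq ?_
    refine (ellipsoidLoop_computes hd hε.le hε1 ho hs₃ hM hN hN').mono le_rfl fun s₄ hs₄ => ?_
    refine writeOutput_computes hs₄ hM fun s₅ h7 hout => ⟨fun i u j => by rw [h7, hs₁ i u j], ?_⟩
    intro x
    obtain ⟨z, hz⟩ := hz x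
    rw [sketchedLoss_eq_of_holdsSketch hs₁, sketchedLoss_eq_of_holdsSketch hs₁ x, hout]
    simp only [hz, hx]
    have := hs₄.inv.final hd ho hε.le (tolerance_nonneg hε.le) hN' z
    rw [hs₄.best] at this
    exact this
  obtain ⟨s, T, hr, hT, s', hs, hq⟩ := key _ (.refl _)
  refine ⟨s, T, hr, hT.trans ?_, ?_, ?_⟩
  · generalize ∑ i, (nnz (A i) + nnzVec (b i)) = Λ
    have hM1 : 1 ≤ M := by omega
    have hkM : k + 1 ≤ M := by omega
    have h5 : 1 ≤ M ^ 5 := Nat.one_le_pow _ _ hM1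
    have h56 : M ^ 5 ≤ M ^ 6 := Nat.pow_le_pow_right hM1 (by norm_num)
    have h16 : M ≤ M ^ 6 := Nat.le_self_pow (by norm_num) M
    have h1 : d * (8 * (20 * M ^ 5) + 1 + 1) ≤ 162 * M ^ 6 := by
      calc d * (8 * (20 * M ^ 5) + 1 + 1) ≤ M * (162 * M ^ 5) := by
            gcongr
            · omega
            · omega
        _ = 162 * M ^ 6 := by ring
    have h2 : N * (5 * (20 * M ^ 5) + 1 + 8 * (20 * M ^ 5) + 1) ≤ 262 * N * M ^ 5 := by
      calc N * (5 * (20 * M ^ 5) + 1 + 8 * (20 * M ^ 5) + 1) ≤ N * (262 * M ^ 5) := by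
            gcongr
            omega
        _ = _ := by ring
    have h3 : (k + 1) * ((Λ + 1) * 3 + 2) = 3 * (k + 1) * Λ + 5 * (k + 1) := by ring
    omega
  · intro i u j
    rw [hs.real 7 (by norm_num) (by norm_num)]
    exact hq.1 i u j
  · have : output d s = output d s' := by
      ext j
      rw [output, output, hs.real 6 (by norm_num) (by norm_num)]
    rw [this]
    exact hq.2

theorem tolerance_pos (hk : 0 < k) (ht₃ : 0 < t₃) (hε : 0 < ε) : 0 < tolerance k t₃ ε := by
  have h1 : (0 : ℝ) < k := by exact_mod_cast hk
  have h2 : (0 : ℝ) < t₃ := by exact_mod_cast ht₃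
  unfold tolerance
  positivity

/-- The number of passes of the ellipsoid method. -/
theorem exists_iterations (hk : 0 < k) (ht₃ : 0 < t₃) (hε : 0 < ε) (hε1 : ε ≤ 1) (d : ℕ) :
    ∃ N : ℕ, (∀ j < N, tolerance k t₃ ε ≤ stepRate d ^ j) ∧
      stepRate d ^ N < tolerance k t₃ ε ∧
      (N : ℝ) ≤ 1 + 4 * ((d : ℝ) + 2) ^ 2 * (2 * (k * t₃) + Real.log (1 / ε)) := by
  classical
  have hδ := tolerance_pos hk ht₃ hε
  have hlt : stepRate d < 1 := by
    rw [stepRate]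
    have : (0 : ℝ) < 1 / (4 * (((d : ℝ) + 2) * (d + 2))) := by positivity
    linarith
  have hex := exists_pow_lt_of_lt_one hδ hlt
  refine ⟨Nat.find hex, fun j hj => not_lt.1 (Nat.find_min hex hj), Nat.find_spec hex, ?_⟩
  have hlog : 0 ≤ Real.log (1 / ε) := Real.log_nonneg (by rw [le_div_iff₀ hε]; linarith)
  have hkt : (0 : ℝ) < k * t₃ := by
    have : 0 < k * t₃ := Nat.mul_pos hk ht₃
    exact_mod_cast this
  rcases Nat.eq_zero_or_pos (Nat.find hex) with h0 | h0
  · rw [h0]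
    push_cast
    positivity
  · obtain ⟨m, hm⟩ := Nat.exists_eq_succ_of_ne_zero h0.ne'
    have h1 : tolerance k t₃ ε ≤ stepRate d ^ m := not_lt.1 (Nat.find_min hex (by omega))
    set a : ℝ := 1 / (4 * (((d : ℝ) + 2) * (d + 2))) with ha
    -- With rate 1 − a, the power (1 − a)^m is at most e^{−ma}; taking logarithms bounds the last
    -- pass that still satisfies the test.
    have h2 : stepRate d ^ m ≤ Real.exp (-(m * a)) := by
      have : stepRate d ≤ Real.exp (-a) := by
        rw [stepRate, ← ha]
        linarith [Real.add_one_le_exp (-a)]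
      calc stepRate d ^ m ≤ Real.exp (-a) ^ m := pow_le_pow_left₀ (stepRate_nonneg d) this m
        _ = _ := by rw [← Real.exp_nat_mul]; congr 1; ring
    have h3 : Real.log (tolerance k t₃ ε) ≤ -(m * a) := by
      rw [Real.log_le_iff_le_exp hδ]
      exact h1.trans h2
    have h4 : Real.log (tolerance k t₃ ε) = -Real.log (1 / ε) - Real.log (2 * (k * t₃)) := by
      rw [tolerance, Real.log_div hε.ne' (by positivity), one_div, Real.log_inv]
      ring
    -- A crude bound, linear instead of logarithmic in k t₃, suffices for a polynomial running time.
    have h5 : Real.log (2 * ((k : ℝ) * t₃)) ≤ 2 * (k * t₃) :=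
      (Real.log_le_sub_one_of_pos (by positivity)).trans (by linarith)
    have h6 : m * a ≤ 2 * (k * t₃) + Real.log (1 / ε) := by linarith
    have h7 : (m : ℝ) = 4 * ((d : ℝ) + 2) ^ 2 * (m * a) := by
      rw [ha]
      field_simp
    rw [hm]
    push_cast
    have h8 : (m : ℝ) ≤ 4 * ((d : ℝ) + 2) ^ 2 * (2 * (k * t₃) + Real.log (1 / ε)) := by
      rw [h7]
      gcongr
    linarith

/-- The sizes of the sketch are polynomial in `d`. -/
theorem sizes_le {K : ℝ} {κ : ℕ} (hκ : |K| ≤ κ) (hκ1 : 1 ≤ κ) (hd : 1 ≤ d)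
    (h₁ : (t₁ : ℝ) ≤ K * (d : ℝ) ^ 2) (h₂ : (t₂ : ℝ) ≤ K * (d : ℝ))
    (h₃ : (t₃ : ℝ) ≤ K * (t₂ * Real.log t₂)) :
    (t₃ : ℝ) ≤ κ ^ 3 * (d : ℝ) ^ 2 ∧
    ((k + d + t₁ + t₂ + t₃ + 2 : ℕ) : ℝ) ≤ ((k + 3 + 2 * κ + κ ^ 3 : ℕ) : ℝ) * (d : ℝ) ^ 2 := by
  have hd' : (1 : ℝ) ≤ d := by exact_mod_cast hd
  have hκ' : (1 : ℝ) ≤ κ := by exact_mod_cast hκ1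
  have hK : K ≤ κ := (le_abs_self K).trans hκ
  have ht₂ : (t₂ : ℝ) ≤ κ * d := h₂.trans (by gcongr)
  have hl0 : 0 ≤ Real.log t₂ := Real.log_natCast_nonneg t₂
  -- Replacing log t₂ by t₂ makes t₃ at most κ³d², still polynomial in d.
  have hl : Real.log t₂ ≤ t₂ := by
    rcases Nat.eq_zero_or_pos t₂ with h | h
    · simp [h]
    · exact (Real.log_le_sub_one_of_pos (by exact_mod_cast h)).trans (by linarith)
  have ht₃ : (t₃ : ℝ) ≤ κ ^ 3 * (d : ℝ) ^ 2 := by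
    calc (t₃ : ℝ) ≤ K * (t₂ * Real.log t₂) := h₃
      _ ≤ κ * ((κ * d) * (κ * d)) := by
        gcongr
        exact hl.trans ht₂
      _ = _ := by ring
  have ht₁ : (t₁ : ℝ) ≤ κ * (d : ℝ) ^ 2 := h₁.trans (by gcongr)
  have hdd : (d : ℝ) ≤ (d : ℝ) ^ 2 := by nlinarith
  refine ⟨ht₃, ?_⟩
  push_cast
  have e1 : (k : ℝ) + 2 ≤ (k + 2) * (d : ℝ) ^ 2 := le_mul_of_one_le_right (by positivity) (by nlinarith)
  have e2 : (κ : ℝ) * d ≤ κ * (d : ℝ) ^ 2 := by gcongr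
  nlinarith

/-- The running time in the form `O(nnz) + poly(d, log (1 / ε))`. -/
theorem runtime_le {K X : ℝ} {κ M N Λ : ℕ} (hκ : |K| ≤ κ) (hκ1 : 1 ≤ κ) (hd : 1 ≤ d)
    (hε : 0 < ε) (hε1 : ε ≤ 1) (hX : X = d + Real.log (1 / ε))
    (h₁ : (t₁ : ℝ) ≤ K * (d : ℝ) ^ 2) (h₂ : (t₂ : ℝ) ≤ K * (d : ℝ))
    (h₃ : (t₃ : ℝ) ≤ K * (t₂ * Real.log t₂)) (hM : M = k + d + t₁ + t₂ + t₃ + 2)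
    (hN : (N : ℝ) ≤ 1 + 4 * ((d : ℝ) + 2) ^ 2 * (2 * (k * t₃) + Real.log (1 / ε)))
    {C m ν : ℕ} (hm : m = k + 3 + 2 * κ + κ ^ 3) (hν : ν = 1 + 36 * (2 * (k * κ ^ 3) + 1))
    (hC : C = 3 * (k + 1) + 500 * m ^ 6 + 262 * ν * m ^ 5 + 14) :
    ((3 * (k + 1) * Λ + 500 * M ^ 6 + 262 * N * M ^ 5 : ℕ) : ℝ) ≤ C * Λ + C * X ^ C := by
  have hlog : 0 ≤ Real.log (1 / ε) := Real.log_nonneg (by rw [le_div_iff₀ hε]; linarith)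
  have hd' : (1 : ℝ) ≤ d := by exact_mod_cast hd
  have hdX : (d : ℝ) ≤ X := by linarith
  have hX1 : 1 ≤ X := hd'.trans hdX
  have hX0 : 0 ≤ X := by linarith
  obtain ⟨ht₃, hM'⟩ := sizes_le (k := k) hκ hκ1 hd h₁ h₂ h₃
  rw [← hM, ← hm] at hM'
  have hMX : (M : ℝ) ≤ m * X ^ 2 := hM'.trans (by gcongr)
  have hNX : (N : ℝ) ≤ ν * X ^ 4 := by
    have e1 : ((d : ℝ) + 2) ^ 2 ≤ 9 * X ^ 2 := by nlinarith
    have e2 : 2 * ((k : ℝ) * t₃) + Real.log (1 / ε) ≤ (2 * (k * κ ^ 3) + 1) * X ^ 2 := by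
      have e3 : (t₃ : ℝ) ≤ κ ^ 3 * X ^ 2 := ht₃.trans (by gcongr)
      have e4 : (k : ℝ) * t₃ ≤ k * (κ ^ 3 * X ^ 2) := by gcongr
      have e5 : Real.log (1 / ε) ≤ X ^ 2 := by nlinarith
      nlinarith
    have e6 : (1 : ℝ) ≤ X ^ 4 := one_le_pow₀ hX1
    calc (N : ℝ) ≤ 1 + 4 * ((d : ℝ) + 2) ^ 2 * (2 * (k * t₃) + Real.log (1 / ε)) := hN
      _ ≤ 1 * X ^ 4 + 4 * (9 * X ^ 2) * ((2 * (k * κ ^ 3) + 1) * X ^ 2) := by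
        gcongr
        linarith
      _ = ν * X ^ 4 := by rw [hν]; push_cast; ring
  -- C serves as factor and as exponent: its summand 14 admits the exponents 12 here and 4 + 10
  -- below, as X ≥ 1.
  have f1 : (M : ℝ) ^ 6 ≤ m ^ 6 * X ^ C := by
    calc (M : ℝ) ^ 6 ≤ (m * X ^ 2) ^ 6 := by gcongr
      _ = m ^ 6 * X ^ 12 := by ring
      _ ≤ _ := by
        gcongr
        omega
  have f2 : (N : ℝ) * (M : ℝ) ^ 5 ≤ ν * m ^ 5 * X ^ C := by
    calc (N : ℝ) * (M : ℝ) ^ 5 ≤ (ν * X ^ 4) * (m * X ^ 2) ^ 5 := by gcongr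
      _ = ν * m ^ 5 * X ^ 14 := by ring
      _ ≤ _ := by
        gcongr
        omega
  have hΛ : (0 : ℝ) ≤ Λ := Nat.cast_nonneg _
  have g1 : (3 * (k + 1) : ℝ) * Λ ≤ C * Λ := by
    gcongr
    rw [hC]
    push_cast
    have : (0 : ℝ) ≤ 500 * m ^ 6 + 262 * ν * m ^ 5 := by positivity
    linarith
  have g2 : (500 * (m : ℝ) ^ 6 + 262 * ν * m ^ 5) * X ^ C ≤ C * X ^ C := by
    gcongr
    rw [hC]
    push_cast
    have : (0 : ℝ) ≤ k := Nat.cast_nonneg _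
    linarith
  push_cast
  nlinarith

end

end OrliczRegression

end

/-! ### Assembly of the error bound and the running time -/

theorem theorem21 (k : ℕ) (hk : 0 < k) :
    -- `c` and `K` are the constants hidden in the sizes `t₁ = Θ(d²)`, `t₂ = Θ(d)`,
    -- `t₃ = Θ(t₂ log t₂)`; `C` is the constant of the running time, and `β` that of the error.
    ∃ (c : ℝ) (P : Program), 0 < c ∧ ∀ K : ℝ, ∃ C : ℕ,
      ∀ G : Fin k → ℝ → ℝ, (∀ i, PropertyP (G i)) → ∃ β : ℝ, 0 < β ∧
        ∀ (d : ℕ) (n : Fin k → ℕ), 1 ≤ d → 2 ≤ ∑ i, n i →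
        ∀ (A : (i : Fin k) → Matrix (Fin (n i)) (Fin d) ℝ) (b : (i : Fin k) → Fin (n i) → ℝ)
          (t₁ t₂ t₃ : ℕ),
        c * (d : ℝ) ^ 2 ≤ t₁ → (t₁ : ℝ) ≤ K * (d : ℝ) ^ 2 →
        c * (d : ℝ) ≤ t₂ → (t₂ : ℝ) ≤ K * (d : ℝ) →
        c * (t₂ * Real.log t₂) ≤ t₃ → (t₃ : ℝ) ≤ K * (t₂ * Real.log t₂) →
        ∀ ν : Fin k → MeasureTheory.Measure ℝ, (∀ i, HasOrliczCDF (G i) (ν i)) →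
        -- the good event, of probability at least `0.7`
        ∃ E : Set (Draw n t₁ t₂ t₃), MeasurableSet E ∧ 0.7 ≤ (drawLaw ν n t₁ t₂ t₃).real E ∧
          -- exact minimisers of the sketched problem exist, and on `E` all of them are good
          (∀ ω : Draw n t₁ t₂ t₃, ∃ xhat, ∀ x, sketchedLoss ω A b xhat ≤ sketchedLoss ω A b x) ∧
          (∀ ω ∈ E, ∀ xhat, (∀ x, sketchedLoss ω A b xhat ≤ sketchedLoss ω A b x) →
            ∀ x, loss G A b xhat
              ≤ β * d * Real.log ((∑ i, n i : ℕ) : ℝ) ^ 2 * loss G A b x) ∧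
          -- running time: for all draws, the program forms the sketch and solves the sketched
          -- problem to relative accuracy `ε`; on `E` its output is good
          (∀ ω : Draw n t₁ t₂ t₃, ∀ ε : ℝ, 0 < ε → ε ≤ 1 →
            ∀ L : (i : Fin k) → List (Fin (n i) × Fin (d + 1)),
            (∀ i, ListsNonzeros (L i) (augment (A i) (b i))) →
            ∃ (s : Memory) (T : ℕ), Runs P (initialMemory A b L ε ω) s T ∧
              (T : ℝ) ≤ C * ((∑ i, (nnz (A i) + nnzVec (b i)) : ℕ) : ℝ)
                + C * ((d : ℝ) + Real.log (1 / ε)) ^ C ∧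
              HoldsSketch A b ω s ∧
              (∀ x, sketchedLoss ω A b (output d s) ≤ (1 + ε) * sketchedLoss ω A b x) ∧
              (ω ∈ E → ∀ x, loss G A b (output d s)
                ≤ β * d * Real.log ((∑ i, n i : ℕ) : ℝ) ^ 2 * loss G A b x)) := by
  obtain ⟨c, hc, hgood⟩ := exists_good_event hk
  -- The extra 2 gives t₂ ≥ 2, hence log t₂ > 0 and t₃ > 0, so that the tolerance is positive and
  -- the ellipsoid method stops.
  refine ⟨c + 2, regressionProgram, by positivity, fun K => ?_⟩
  obtain ⟨κ, hκ⟩ := exists_nat_ge (max |K| 1)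
  have hκK : |K| ≤ κ := (le_max_left _ _).trans hκ
  have hκ1 : 1 ≤ κ := by exact_mod_cast (le_max_right _ _).trans hκ
  obtain ⟨m, hm⟩ : ∃ m, m = k + 3 + 2 * κ + κ ^ 3 := ⟨_, rfl⟩
  obtain ⟨μ, hμ⟩ : ∃ μ, μ = 1 + 36 * (2 * (k * κ ^ 3) + 1) := ⟨_, rfl⟩
  obtain ⟨C, hC⟩ : ∃ C, C = 3 * (k + 1) + 500 * m ^ 6 + 262 * μ * m ^ 5 + 14 := ⟨_, rfl⟩
  refine ⟨C, fun G hG => ?_⟩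
  obtain ⟨β, hβ, hgood⟩ := hgood G hG
  refine ⟨β, hβ, fun d n hd hn A b t₁ t₂ t₃ h₁ h₁' h₂ h₂' h₃ h₃' ν hν => ?_⟩
  have hd' : (1 : ℝ) ≤ d := by exact_mod_cast hd
  have ht₂ : (2 : ℝ) ≤ t₂ := by nlinarith
  have hlog : 0 < Real.log t₂ := Real.log_pos (by linarith)
  have hmul : 0 < t₂ * Real.log t₂ := by positivity
  have ht₃ : 0 < t₃ := by
    have : (0 : ℝ) < t₃ := lt_of_lt_of_le (by positivity) h₃
    exact_mod_cast this
  obtain ⟨E, hE, hpE, hE'⟩ := hgood d n hd hn A b t₁ t₂ t₃ (by nlinarith) (by nlinarith)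
    (by nlinarith) ν hν
  have hnonneg : ∀ (ω : Draw n t₁ t₂ t₃) (x : Fin d → ℝ), 0 ≤ sketchedLoss ω A b x :=
    fun ω x => Finset.sum_nonneg fun _ _ => abs_nonneg _
  -- The good event does not involve ε: exact minimisers and the program's outputs are all within a
  -- factor 2 of the sketched optimum, as the loss is nonnegative and 1 + ε ≤ 2.
  refine ⟨E, hE, hpE, fun ω => exists_minimizer_sketchedLoss ω A b, fun ω hω xhat hx =>
    hE' ω hω xhat fun x => (hx x).trans (by linarith [hnonneg ω x]), fun ω ε hε hε1 L hL => ?_⟩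
  obtain ⟨N, hN, hN', hNle⟩ := exists_iterations hk ht₃ hε hε1 d
  obtain ⟨s, T, hrun, hT, hsk, hopt⟩ :=
    regressionProgram_runs (ω := ω) hd hε hε1 hL le_rfl hN hN'
  refine ⟨s, T, hrun, ?_, hsk, hopt, fun hω => hE' ω hω _ fun x => (hopt x).trans ?_⟩
  · exact (Nat.cast_le.2 hT).trans
      (runtime_le hκK hκ1 hd hε hε1 rfl h₁' h₂' h₃' rfl hNle hm hμ hC)
  · nlinarith [hnonneg ω x]
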